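/- **Setting.** Let $M$ be a smooth $n$-dimensional manifold and $X^1,\dots,X^m$ smooth vector fields on $M$. Let $\mathcal A=\frac12\sum_{j=1}^m L_{X^j}L_{X^j}$, with symbol $\sigma^{\mathcal A}_x(a)=\frac12\sum_j a(X^j(x))X^j(x)$, and let $E_x=\operatorname{Im}\sigma^{\mathcal A}_x=\operatorname{span}\{X^1(x),\dots,X^m(x)\}$. Assume that $\mathcal A$ is cohesive: $\dim E_x=p$ is constant and non-zero, and $\delta^{\mathcal A}\phi:=\frac12\sum_j L_{X^j}(\phi(X^j))=0$ for all $C^1$ one-forms $\phi$ vanishing on $E$. Write $X(x):\mathbb R^m\to E_x$, $X(x)e=\sum_j e_jX^j(x)$; let $Y_x:E_x\to(\ker X(x))^\perp$ be its right inverse, and give $E_x$ the inner product $\langle v,w\rangle_x=\langle Y_xv,Y_xw\rangle$. Let $\breve\nabla_vU=X(x)\,d[y\mapsto Y_yU(y)](v)$ ($v\in T_xM$, $U$ a section of $E$), let $R$ be the curvature tensor of $\breve\nabla$, $R(V,W)U=\breve\nabla_V\breve\nabla_WU-\breve\nabla_W\breve\nabla_VU-\breve\nabla_{[V,W]}U$,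 and let $\mathrm{Ric}^\#(v)=\sum_{j=1}^m R(v,X^j(x))X^j(x)$, a linear map of $T_xM$. **Vertical diffusion.** Let $\pi:GLM\to M$ be the linear frame bundle, whose points are the linear isomorphisms $u:\mathbb R^n\to T_{\pi(u)}M$. For a vector field $Z$ on $M$ with flow $\eta_t$ let $Z^{GL}$ be the vector field on $GLM$ generating $u\mapsto T\eta_t\circ u$. Let $\mathcal B=\frac12\sum_jL_{(X^j)^{GL}}L_{(X^j)^{GL}}$ be the generator of the derivative process on $GLM$, with symbol $\sigma^{\mathcal B}$. Let $h_u:E_{\pi(u)}\to T_uGLM$ be the horizontal lift determined by $h_u\circ\sigma^{\mathcal A}_{\pi(u)}=\sigma^{\mathcal B}_u\circ(T_u\pi)^*$, let $\mathcal A^H=\frac12\sum_jL_{\bar X^j}L_{\bar X^j}$ with $\bar X^j(u)=h_u(X^j(\pi(u)))$, and let $\mathcal B^V=\mathcal B-\mathcal A^H$ be the vertical diffusion operator. **Zero order operator.** For $A\in\mathfrak{gl}(n)=L(\mathbb R^n;\mathbb R^n)$ let $A^*(u)=\frac{d}{dt}\big|_{t=0}u\circ e^{tA}$, and let $d\wedge(A)$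 be the operator on exterior algebras given by $d\wedge(A)(v_1\wedge\dots\wedge v_q)=\sum_{j}v_1\wedge\dots\wedge Av_j\wedge\dots\wedge v_q$; write $d\wedge^q(A)$ for its restriction to degree $q$. **Claim.** Let $(A_i)$ be any basis of $\mathfrak{gl}(n)$. 1. There are unique functions $\alpha^{ij},\beta^k$ on $GLM$, with $(\alpha^{ij}(u))$ symmetric and positive semi-definite for every $u$, such that on smooth functions $\mathcal B^V=\sum_{i,j}\alpha^{ij}L_{A_i^*}L_{A_j^*}+\sum_k\beta^kL_{A_k^*}$. 2. Let $\lambda(u)=\sum_k\beta^k(u)\,d\wedge(A_k)+\sum_{i,j}\alpha^{ij}(u)\,d\wedge(A_i)\,d\wedge(A_j)$ on $\wedge\mathbb R^n$. For every $x\in M$, every frame $u$ at $x$, every $q\ge 0$ and every $V\in\wedge^qT_xM$, the zero order operator $W_x=(\wedge u)\,\lambda(u)\,(\wedge u)^{-1}$ induced by $\mathcal B^V$ on the exterior bundle is the generalized Weitzenböck curvature $$W_xV=-\tfrac12\,d\wedge^q(\mathrm{Ric}^\#)V-\sum_{\substack{1\le i\le k\le n\\ 1\le j<l\le p}}R_{ikjl}\,a_l^*a_j^*a_ka_i\,V,\qquad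 R_{ikjl}=\langle R(e_i,e_k)e_l,e_j\rangle_x .$$ Here $e_1,\dots,e_n$ is any basis of $T_xM$ such that $e_1,\dots,e_p$ is an orthonormal basis of $E_x$, $a_i^*=e_i\wedge\cdot$ is creation, and $a_i$ is contraction with the $i$-th element of the dual basis (annihilation). 3. Equivalently, on differential forms, $\mathcal B^V$ induces the transpose of $W$: for every smooth differential form $\phi$ on $M$ and every $w\in\wedge\mathbb R^n$, $\mathcal B^V\big[u\mapsto\phi_{\pi(u)}((\wedge u)w)\big](u)=\phi_{\pi(u)}\big(W_{\pi(u)}(\wedge u)w\big)$. -/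

import Mathlib

open scoped Manifold ContDiff Topology Bundle

noncomputable section

namespace DerivativeProcess

/-! ### Operators in Hörmander form on a manifold -/

section Operators

variable {EN HN N : Type*} [NormedAddCommGroup EN] [NormedSpace ℝ EN] [TopologicalSpace HN]
  (J : ModelWithCorners ℝ EN HN) [TopologicalSpace N] [ChartedSpace HN N]

/-- The Lie derivative `L_V f = df(V)` of a function along a vector field. -/
def lieDer (V : ∀ y : N, TangentSpace J y) (f : N → ℝ) : N → ℝ :=
  fun y => mfderiv J 𝓘(ℝ, ℝ) f y (V y)

/-- The drift-free Hörmander form operator `½ ∑ⱼ L_{Vʲ} L_{Vʲ}`. -/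
def hormander {m : ℕ} (V : Fin m → ∀ y : N, TangentSpace J y) (f : N → ℝ) : N → ℝ :=
  fun y => (1 / 2 : ℝ) * ∑ j, lieDer J (V j) (lieDer J (V j) f) y

/-- The symbol `σ_y : T*_y N → T_y N` of `½ ∑ⱼ L_{Vʲ} L_{Vʲ}`, that is
`σ_y(a) = ½ ∑ⱼ a(Vʲ(y)) Vʲ(y)`. -/
def symbol {m : ℕ} (V : Fin m → ∀ y : N, TangentSpace J y) (y : N) :
    (TangentSpace J y →L[ℝ] ℝ) →ₗ[ℝ] TangentSpace J y where
  toFun a := (1 / 2 : ℝ) • ∑ j, a (V j y) • V j y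
  map_add' a b := by simp [add_smul, Finset.sum_add_distrib]
  map_smul' c a := by
    simp only [smul_apply, smul_eq_mul, mul_smul, ← Finset.smul_sum,
      RingHom.id_apply]
    rw [smul_comm]

/-- The fibre `E_y` of the image of the symbol. -/
def symbolImage {m : ℕ} (V : Fin m → ∀ y : N, TangentSpace J y) (y : N) :
    Submodule ℝ (TangentSpace J y) :=
  LinearMap.range (symbol J V y)

/-- The first order operator `δ` on one-forms associated with `½ ∑ⱼ L_{Vʲ} L_{Vʲ}`, namely
`δ φ = ½ ∑ⱼ L_{Vʲ} (φ(Vʲ))`. -/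
def deltaOp {m : ℕ} (V : Fin m → ∀ y : N, TangentSpace J y)
    (φ : ∀ y : N, TangentSpace J y →L[ℝ] ℝ) : N → ℝ :=
  fun y => (1 / 2 : ℝ) * ∑ j, lieDer J (V j) (fun z => φ z (V j z)) y

/-- `½ ∑ⱼ L_{Vʲ} L_{Vʲ}` is cohesive, with symbol of rank `p`: the rank is constant and non-zero,
and the operator is along the image of its symbol, i.e. `δ φ = 0` for every `C¹` one-form `φ`
that vanishes on that image. -/
structure IsCohesive [IsManifold J 1 N] {m : ℕ} (V : Fin m → ∀ y : N, TangentSpace J y)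
    (p : ℕ) : Prop where
  rank_pos : 0 < p
  rank_eq : ∀ y, Module.finrank ℝ (symbolImage J V y) = p
  along : ∀ φ : ∀ y : N, TangentSpace J y →L[ℝ] ℝ,
    ContMDiff J (J.prod 𝓘(ℝ, EN →L[ℝ] ℝ)) 1
      (fun y => Bundle.TotalSpace.mk' (EN →L[ℝ] ℝ)
        (E := fun y : N => TangentSpace J y →L[ℝ] Bundle.Trivial N ℝ y) y (φ y)) →
    (∀ y, ∀ v ∈ symbolImage J V y, φ y v = 0) → ∀ y, deltaOp J V φ y = 0

end Operators

/-! ### The exterior algebra -/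

section Exterior

variable {V : Type*} [AddCommGroup V] [Module ℝ V]

/-- The map `v ↦ v + ε A v` into the dual numbers over the exterior algebra. -/
def epsMap (A : V →ₗ[ℝ] V) :
    V →ₗ[ℝ] TrivSqZeroExt (ExteriorAlgebra ℝ V) (ExteriorAlgebra ℝ V) where
  toFun v := TrivSqZeroExt.inl (ExteriorAlgebra.ι ℝ v) +
    TrivSqZeroExt.inr (ExteriorAlgebra.ι ℝ (A v))
  map_add' v w := by ext <;> simp
  map_smul' c v := by ext <;> simp

theorem epsMap_mul_self (A : V →ₗ[ℝ] V) (v : V) : epsMap A v * epsMap A v = 0 := by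
  ext
  · simp [epsMap]
  · simp [epsMap, ExteriorAlgebra.ι_add_mul_swap]

/-- `dΛ(A)` on the exterior algebra: the `ε`-coefficient of `Λ(1 + ε A)`, that is, the derivative
at the identity, in the direction `A`, of `g ↦ Λ g`.  It is given by
`dΛ(A)(v₁ ∧ ⋯ ∧ v_q) = ∑ⱼ v₁ ∧ ⋯ ∧ A vⱼ ∧ ⋯ ∧ v_q`, see `dExt_ι_mul` and `dExt_ιMulti`. -/
def dExt (A : V →ₗ[ℝ] V) : ExteriorAlgebra ℝ V →ₗ[ℝ] ExteriorAlgebra ℝ V where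
  toFun x := (ExteriorAlgebra.lift ℝ ⟨epsMap A, epsMap_mul_self A⟩ x).snd
  map_add' x y := by simp
  map_smul' c x := by simp

theorem dExt_one (A : V →ₗ[ℝ] V) : dExt A 1 = 0 := by simp [dExt]

theorem lift_epsMap_fst (A : V →ₗ[ℝ] V) (x : ExteriorAlgebra ℝ V) :
    (ExteriorAlgebra.lift ℝ ⟨epsMap A, epsMap_mul_self A⟩ x).fst = x := by
  have h : (TrivSqZeroExt.fstHom ℝ (ExteriorAlgebra ℝ V) (ExteriorAlgebra ℝ V)).comp
      (ExteriorAlgebra.lift ℝ ⟨epsMap A, epsMap_mul_self A⟩) = AlgHom.id ℝ _ := by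
    apply ExteriorAlgebra.hom_ext
    ext v
    simp [epsMap]
  exact DFunLike.congr_fun h x

theorem dExt_ι_mul (A : V →ₗ[ℝ] V) (v : V) (x : ExteriorAlgebra ℝ V) :
    dExt A (ExteriorAlgebra.ι ℝ v * x) =
      ExteriorAlgebra.ι ℝ (A v) * x + ExteriorAlgebra.ι ℝ v * dExt A x := by
  have h := lift_epsMap_fst A x
  simp only [dExt, LinearMap.coe_mk, AddHom.coe_mk, map_mul, TrivSqZeroExt.snd_mul,
    lift_epsMap_fst, ExteriorAlgebra.lift_ι_apply]
  simp [epsMap, add_comm]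

theorem dExt_ιMulti (A : V →ₗ[ℝ] V) {q : ℕ} (v : Fin q → V) :
    dExt A (ExteriorAlgebra.ιMulti ℝ q v) =
      ∑ j, ExteriorAlgebra.ιMulti ℝ q (Function.update v j (A (v j))) := by
  induction q with
  | zero => simp [dExt_one]
  | succ q ih =>
    rw [ExteriorAlgebra.ιMulti_succ_apply, dExt_ι_mul, ih, Fin.sum_univ_succ, Finset.mul_sum]
    congr 1
    · rw [ExteriorAlgebra.ιMulti_succ_apply]
      simp [Matrix.vecTail, Function.comp_def]
    · refine Finset.sum_congr rfl fun j _ => ?_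
      rw [ExteriorAlgebra.ιMulti_succ_apply]
      congr 2
      exact (Function.update_comp_eq_of_injective v (Fin.succ_injective q) j (A (v j.succ))).symm

/-- The creation operator `x ↦ v ∧ x`. -/
def creation (v : V) : ExteriorAlgebra ℝ V →ₗ[ℝ] ExteriorAlgebra ℝ V :=
  LinearMap.mulLeft ℝ (ExteriorAlgebra.ι ℝ v)

/-- The annihilation operator: contraction with a linear form `d`,
`v₁ ∧ ⋯ ∧ v_q ↦ ∑ⱼ (-1)^(j+1) d(vⱼ) v₁ ∧ ⋯ ∧ v̂ⱼ ∧ ⋯ ∧ v_q`. -/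
def annihilation (d : Module.Dual ℝ V) : ExteriorAlgebra ℝ V →ₗ[ℝ] ExteriorAlgebra ℝ V :=
  CliffordAlgebra.contractLeft d

end Exterior

/-! ### The frame bundle -/

section FrameBundle

variable (n : ℕ) (M : Type*) [TopologicalSpace M] [ChartedSpace (EuclideanSpace ℝ (Fin n)) M]
  [IsManifold (𝓡 n) ∞ M]

/-- `ℝⁿ` with its Euclidean structure. -/
abbrev Euc (n : ℕ) : Type := EuclideanSpace ℝ (Fin n)

/-- The total space of the smooth vector bundle `Hom(ℝⁿ, TM)` over `M`. -/
abbrev HomBundle : Type _ :=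
  Bundle.TotalSpace (Euc n →L[ℝ] Euc n)
    (fun x : M => Bundle.Trivial M (Euc n) x →L[ℝ] TangentSpace (𝓡 n) x)

theorem isOpen_frames : IsOpen {u : HomBundle n M | u.2.IsInvertible} := by
  rw [isOpen_iff_mem_nhds]
  intro u₀ h₀
  have hc := (continuousAt_hom_bundle (σ := RingHom.id ℝ) (F₁ := Euc n)
    (E₁ := Bundle.Trivial M (Euc n))
    (F₂ := Euc n) (E₂ := fun x : M => TangentSpace (𝓡 n) x)
    (fun u : HomBundle n M => u) (x₀ := u₀)).1 continuousAt_id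
  have hm := FiberBundle.mem_baseSet_trivializationAt (Euc n)
    (fun x : M => TangentSpace (𝓡 n) x) u₀.1
  have key : ∀ u : HomBundle n M,
      u.1 ∈ (trivializationAt (Euc n) (fun x : M => TangentSpace (𝓡 n) x) u₀.1).baseSet →
      (u.2.IsInvertible ↔
      ContinuousLinearMap.inCoordinates (Euc n) (Bundle.Trivial M (Euc n)) (Euc n)
        (fun x : M => TangentSpace (𝓡 n) x) u₀.1 u.1 u₀.1 u.1 u.2 ∈
        Set.range ((↑) : (Euc n ≃L[ℝ] Euc n) → Euc n →L[ℝ] Euc n)) := by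
    intro u hu
    rw [ContinuousLinearMap.inCoordinates_eq (by simp) hu]
    generalize Bundle.Trivialization.continuousLinearEquivAt ℝ
      (trivializationAt (Euc n) (Bundle.Trivial M (Euc n)) u₀.1) u.1 _ = S
    generalize Bundle.Trivialization.continuousLinearEquivAt ℝ
      (trivializationAt (Euc n) (fun x : M => TangentSpace (𝓡 n) x) u₀.1) u.1 hu = T
    constructor
    · rintro ⟨e, he⟩
      rw [← he]
      exact ⟨(S.symm.trans e).trans T, rfl⟩
    · rintro ⟨e, he⟩
      refine ⟨(S.trans e).trans T.symm, ?_⟩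
      ext v
      have h := DFunLike.congr_fun he (S v)
      simp only [ContinuousLinearEquiv.coe_coe, ContinuousLinearMap.comp_apply,
        ContinuousLinearEquiv.symm_apply_apply] at h
      simp only [ContinuousLinearEquiv.coe_coe, ContinuousLinearEquiv.trans_apply, h,
        ContinuousLinearEquiv.symm_apply_apply]
  have h1 : ∀ᶠ u : HomBundle n M in 𝓝 u₀,
      u.1 ∈ (trivializationAt (Euc n) (fun x : M => TangentSpace (𝓡 n) x) u₀.1).baseSet :=
    hc.1.eventually ((Bundle.Trivialization.open_baseSet _).mem_nhds hm)
  have h2 := hc.2.eventually (ContinuousLinearEquiv.isOpen.mem_nhds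
    ((key u₀ hm).1 h₀))
  filter_upwards [h1, h2] with u hu hu'
  exact (key u hu).2 hu'

/-- The frame bundle `GLM`, an open submanifold of `Hom(ℝⁿ, TM)`: its points are the pairs of
a point `x` and an invertible linear map `ℝⁿ → T_x M`. -/
def frames : TopologicalSpace.Opens (HomBundle n M) :=
  ⟨{u | u.2.IsInvertible}, isOpen_frames n M⟩

abbrev GLM : Type _ := frames n M

/-- The model with corners of `GLM`. -/
abbrev modelGL : ModelWithCorners ℝ (Euc n × (Euc n →L[ℝ] Euc n))
    (ModelProd (Euc n) (Euc n →L[ℝ] Euc n)) :=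
  (𝓡 n).prod 𝓘(ℝ, Euc n →L[ℝ] Euc n)

variable {n M}

/-- The projection `π : GLM → M`. -/
def proj (u : GLM n M) : M := u.1.1

/-- A frame `u : ℝⁿ → T_{π(u)} M` as a linear map. -/
def frameMap (u : GLM n M) : Euc n →L[ℝ] TangentSpace (𝓡 n) (proj u) := u.1.2

/-- The natural lift `Z^GL` of a vector field `Z` on `M` to `GLM`: the velocity of
`t ↦ Tη_t ∘ u`, where `η` is the flow of `Z`.  In the coordinates `(x, u)` of `GLM` given by a
chart of `M` it is `(Z(x), DZ(x) ∘ u)`.  Here the chart is the preferred one at `π(u)`; it induces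
the chart of `GLM` at `u` through which `T_u GLM` is identified with `ℝⁿ × L(ℝⁿ; ℝⁿ)`, and
in it the vector field `Z` is `y ↦ (trivializationAt _ _ (π u) ⟨y, Z y⟩).2`. -/
def naturalLift (Z : ∀ x : M, TangentSpace (𝓡 n) x) (u : GLM n M) :
    TangentSpace (modelGL n) u :=
  let DZ : TangentSpace (𝓡 n) (proj u) →L[ℝ] Euc n :=
    mfderiv (𝓡 n) 𝓘(ℝ, Euc n)
      (fun y => (trivializationAt (Euc n) (TangentSpace (𝓡 n)) (proj u) ⟨y, Z y⟩).2) (proj u)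
  ((Z (proj u), DZ.comp (frameMap u)) : Euc n × (Euc n →L[ℝ] Euc n))

/-- The fundamental vector field `A^*(u) = d/dt (u ∘ exp(tA))` at `t = 0`, for `A` in the Lie
algebra `L(ℝⁿ; ℝⁿ)` of `GL(n)`. In the chart of `GLM` at `u` it is `(0, u ∘ A)`. -/
def fundamental (A : Euc n →L[ℝ] Euc n) (u : GLM n M) : TangentSpace (modelGL n) u :=
  ((0, (frameMap u).comp A) : Euc n × (Euc n →L[ℝ] Euc n))

end FrameBundle

/-! ### The semi-connection and the vertical diffusion -/

section Decomposition

variable {n m : ℕ} {M : Type*} [TopologicalSpace M] [ChartedSpace (EuclideanSpace ℝ (Fin n)) M]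
  [IsManifold (𝓡 n) ∞ M] (X : Fin m → ∀ x : M, TangentSpace (𝓡 n) x)

/-- The generator `B = ½ ∑ⱼ L_{(Xʲ)^GL} L_{(Xʲ)^GL}` of the derivative process on `GLM`. -/
def derivGenerator : (GLM n M → ℝ) → GLM n M → ℝ :=
  hormander (modelGL n) fun j => naturalLift (X j)

/-- The horizontal lift `h_u : E_{π(u)} → T_u GLM` induced by `B`, characterised by
`h_u ∘ σ^𝒜_{π(u)} = σ^B_u ∘ (T_u π)^*`: `h_u(v) = σ^B_u (a ∘ T_u π)` for any `a ∈ T^*M` with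
`σ^𝒜(a) = v`.  (Only used for `v` in the image of `σ^𝒜`.) -/
def horLift (u : GLM n M) (v : TangentSpace (𝓡 n) (proj u)) : TangentSpace (modelGL n) u :=
  let a : TangentSpace (𝓡 n) (proj u) →L[ℝ] ℝ :=
    Classical.epsilon fun a => symbol (𝓡 n) X (proj u) a = v
  let Tπ : TangentSpace (modelGL n) u →L[ℝ] TangentSpace (𝓡 n) (proj u) :=
    mfderiv (modelGL n) (𝓡 n) (proj : GLM n M → M) u
  symbol (modelGL n) (fun j => naturalLift (X j)) u (a.comp Tπ)

/-- The horizontal lift `𝒜^H = ½ ∑ⱼ L_{X̄ʲ} L_{X̄ʲ}` of `𝒜`, with `X̄ʲ(u) = h_u(Xʲ(π(u)))`. -/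
def horizontalPart : (GLM n M → ℝ) → GLM n M → ℝ :=
  hormander (modelGL n) fun j u => horLift X u (X j (proj u))

/-- The vertical diffusion operator `B^V = B - 𝒜^H`. -/
def verticalPart (f : GLM n M → ℝ) : GLM n M → ℝ :=
  fun u => derivGenerator X f u - horizontalPart X f u

/-- `B^V = ∑ αⁱʲ L_{A_i^*} L_{A_j^*} + ∑ βᵏ L_{A_k^*}` with respect to a basis `A` of the Lie
algebra of `GL(n)`, with `(αⁱʲ(u))` symmetric and positive semi-definite. -/
structure IsVerticalRep {κ : Type*} [Fintype κ] (A : Module.Basis κ ℝ (Euc n →L[ℝ] Euc n))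
    (α : GLM n M → Matrix κ κ ℝ) (β : GLM n M → κ → ℝ) : Prop where
  posSemidef : ∀ u, (α u).PosSemidef
  eq : ∀ f : GLM n M → ℝ, ContMDiff (modelGL n) 𝓘(ℝ, ℝ) ∞ f → ∀ u,
    verticalPart X f u =
      ∑ i, ∑ j, α u i j *
        lieDer (modelGL n) (fundamental (A i)) (lieDer (modelGL n) (fundamental (A j)) f) u +
      ∑ k, β u k * lieDer (modelGL n) (fundamental (A k)) f u

/-- The function `u ↦ φ_{π(u)}((Λu) w)` on `GLM`, for a family `φ` of linear forms on the
exterior algebras `ΛT_x M` (a differential form, possibly of mixed degree) and `w ∈ Λℝⁿ`. -/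
def formFunction (φ : ∀ x : M, Module.Dual ℝ (ExteriorAlgebra ℝ (TangentSpace (𝓡 n) x)))
    (w : ExteriorAlgebra ℝ (Euc n)) (u : GLM n M) : ℝ :=
  φ (proj u)
    (ExteriorAlgebra.map (frameMap u : Euc n →ₗ[ℝ] TangentSpace (𝓡 n) (proj u)) w)

/-- The differential form `φ` is smooth: the corresponding equivariant map
`u ↦ φ_{π(u)} ∘ Λu` from `GLM` to the dual of `Λℝⁿ` is smooth. -/
def IsSmoothForm (φ : ∀ x : M, Module.Dual ℝ (ExteriorAlgebra ℝ (TangentSpace (𝓡 n) x))) :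
    Prop :=
  ∀ w, ContMDiff (modelGL n) 𝓘(ℝ, ℝ) ∞ (formFunction φ w)

/-- For the representation `Λρ` of `GL(n)` on `Λℝⁿ` given by the standard representation `ρ`,
`λ(u) = (Λρ)_*(β(u)) + Comp ∘ ((Λρ)_* ⊗ (Λρ)_*)(α(u))`, where `(Λρ)_* = dΛ` is the induced
representation of the Lie algebra. -/
def zeroOrder {κ : Type*} [Fintype κ] (A : Module.Basis κ ℝ (Euc n →L[ℝ] Euc n))
    (α : Matrix κ κ ℝ) (β : κ → ℝ) :
    ExteriorAlgebra ℝ (Euc n) →ₗ[ℝ] ExteriorAlgebra ℝ (Euc n) :=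
  ∑ k, β k • dExt (A k : Euc n →ₗ[ℝ] Euc n) +
    ∑ i, ∑ j, α i j • (dExt (A i : Euc n →ₗ[ℝ] Euc n) ∘ₗ dExt (A j : Euc n →ₗ[ℝ] Euc n))

end Decomposition

/-! ### The connection and the Weitzenböck curvature -/

section Connection

variable {n m : ℕ} {M : Type*} [TopologicalSpace M] [ChartedSpace (EuclideanSpace ℝ (Fin n)) M]
  [IsManifold (𝓡 n) ∞ M] (X : Fin m → ∀ x : M, TangentSpace (𝓡 n) x)

/-- The bundle map `X(x) : ℝᵐ → T_x M`, `X(x)(e) = ∑ⱼ eⱼ Xʲ(x)`. -/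
def noise (x : M) : Euc m →ₗ[ℝ] TangentSpace (𝓡 n) x where
  toFun e := ∑ j, e j • X j x
  map_add' e e' := by simp [add_smul, Finset.sum_add_distrib]
  map_smul' c e := by simp [mul_smul, Finset.smul_sum]

/-- The right inverse `Y_x : E_x → ℝᵐ` of `X(x)` with values in the orthogonal complement of
`ker X(x)`.  (Only used on `E_x`, where it is uniquely determined by the two conditions.) -/
def noiseInv (x : M) (v : TangentSpace (𝓡 n) x) : Euc m :=
  Classical.epsilon fun e => e ∈ (LinearMap.ker (noise X x))ᗮ ∧ noise X x e = v

/-- The inner product on `E_x` induced by `Y_x`. -/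
def innerE (x : M) (v w : TangentSpace (𝓡 n) x) : ℝ :=
  inner ℝ (noiseInv X x v) (noiseInv X x w)

/-- The connection `∇̆_v U = X(x) d[y ↦ Y_y U(y)](v)`, for `v ∈ T_x M` and sections `U` of `E`. -/
def covDeriv (U : ∀ x : M, TangentSpace (𝓡 n) x) (x : M) (v : TangentSpace (𝓡 n) x) :
    TangentSpace (𝓡 n) x :=
  noise X x (mfderiv (𝓡 n) 𝓘(ℝ, Euc m) (fun y => noiseInv X y (U y)) x v)

/-- `∇̆_V ∇̆_W U - ∇̆_W ∇̆_V U - ∇̆_{[V,W]} U` for vector fields `V`, `W` and sections `U` of `E`. -/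
def curvatureField (V W U : ∀ x : M, TangentSpace (𝓡 n) x) (x : M) : TangentSpace (𝓡 n) x :=
  covDeriv X (fun y => covDeriv X U y (W y)) x (V x) -
    covDeriv X (fun y => covDeriv X U y (V y)) x (W x) -
    covDeriv X U x (VectorField.mlieBracket (𝓡 n) V W x)

/-- The curvature tensor `R(v, w) z` of `∇̆`, for `v, w ∈ T_x M` and `z ∈ E_x`: extend `v`, `w` to
vector fields that are smooth near `x`, and `z` to the section `y ↦ X(y) Y_x z` of `E`. -/
def curvature (x : M) (v w z : TangentSpace (𝓡 n) x) : TangentSpace (𝓡 n) x :=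
  curvatureField X (FiberBundle.extend (Euc n) v) (FiberBundle.extend (Euc n) w)
    (fun y => noise X y (noiseInv X x z)) x

/-- `Ric` is the Ricci curvature `Ric^# : T_x M → E_x ⊆ T_x M`, `Ric^#(v) = ∑ⱼ R(v, Xʲ(x)) Xʲ(x)`. -/
def IsRicciSharp (x : M) (Ric : TangentSpace (𝓡 n) x →ₗ[ℝ] TangentSpace (𝓡 n) x) : Prop :=
  ∀ v, Ric v = ∑ j, curvature X x v (X j x) (X j x)

/-- A basis `e_1, …, e_n` of `T_x M` whose first `p` members form an orthonormal basis of `E_x`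
(of dimension `p`). Equivalently, `e` is orthonormal for some inner product on `T_x M` that
extends the one of `E_x`, and starts with a basis of `E_x`. -/
def IsAdapted (p : ℕ) (x : M) (e : Module.Basis (Fin n) ℝ (TangentSpace (𝓡 n) x)) : Prop :=
  ∀ j l : Fin n, j.val < p → l.val < p →
    e j ∈ symbolImage (𝓡 n) X x ∧ innerE X x (e j) (e l) = if j = l then 1 else 0

/-- The generalized Weitzenböck curvature
`-½ dΛ(Ric^#) - ∑_{i ≤ k ≤ n, j < l ≤ p} R_{ikjl} a_l^* a_j^* a_k a_i` on `ΛT_x M`, with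
`R_{ikjl} = ⟨R(e_i, e_k) e_l, e_j⟩`, `a_l^* = e_l ∧ ·` and `a_i` the contraction with the `i`-th
member of the dual basis (i.e. with `e_i`, for an inner product making `e` orthonormal). -/
def weitzenbock (p : ℕ) (x : M) (Ric : TangentSpace (𝓡 n) x →ₗ[ℝ] TangentSpace (𝓡 n) x)
    (e : Module.Basis (Fin n) ℝ (TangentSpace (𝓡 n) x)) :
    ExteriorAlgebra ℝ (TangentSpace (𝓡 n) x) →ₗ[ℝ] ExteriorAlgebra ℝ (TangentSpace (𝓡 n) x) :=
  (-(1 / 2) : ℝ) • dExt Ric -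
    ∑ i : Fin n, ∑ k : Fin n, ∑ j : Fin n, ∑ l : Fin n,
      if i ≤ k ∧ j < l ∧ l.val < p then
        innerE X x (curvature X x (e i) (e k) (e l)) (e j) •
          (creation (e l) ∘ₗ creation (e j) ∘ₗ annihilation (e.coord k) ∘ₗ
            annihilation (e.coord i))
      else 0

end Connection

end DerivativeProcess

end

open DerivativeProcess

noncomputable section

namespace DerivativeProcess

/-! ### Second quantization on the exterior algebra -/

section ExteriorLemmas

variable {V W : Type*} [AddCommGroup V] [Module ℝ V] [AddCommGroup W] [Module ℝ W]

/-! Let `P(x)` be the orthogonal projection of `ℝᵐ` onto `(ker X(x))ᗮ`, let `e_k` be the standard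
basis, and work in the preferred chart at `x = π(u)`. The natural lifts combine into the linear map
`F_u(e) = ∑ e_k (X^k)^GL(u) = (X e, DX(e) ∘ u)`, and the horizontal lift of `X^j` is `F_u(P e_j)`.
Hence `F_u((1 - P) e_k)` is vertical. It equals `Γ_k ∘ u` with `Γ_k = DX((1 - P) e_k)`, and
differentiating `X P = X` gives `Γ_k v = X dP(v) e_k = ∇̆_v X^k`.

Generator and horizontal part are traces of one bilinear form, over the vectors `e_j` and `P e_j`
respectively, up to the drift produced by differentiating the coefficients `P e_j`. Since `P` is a
self-adjoint idempotent the cross terms vanish, and `verticalPart_eq` gives, at each `u`, `B^V = ½ ∑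
(Γ_k^*)² - ½ G^*`. Here the endomorphisms are read in the frame `u` and held constant, `G = DX(d)`,
and `d = ∑ dP(X^j) e_j` lies in `ker X`. So `α` is half a Gram matrix. Uniqueness follows from test
functions with prescribed first and second vertical derivatives at a point (`repr_unique_of_symm`).

On exterior powers this operator becomes `-½ dΛ(G) + ½ ∑ dΛ(Γ_k)²`. Normal ordering (`dExt_dExt`)
replaces `dΛ(Γ_k)²` by `dΛ(Γ_k²)` minus a term with two creations and two annihilations. On the
geometric side `R(v, w) X e = X [dP(v), dP(w)] P e` (`curvature_noise`). Its trace is `Ric^# = G - ∑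
Γ_k²` (`ricciSharp_eq_sum`), and its pairing with `E` is the Gauss-type identity `⟨R(v,w)z, z'⟩ = ∑
(⟨z, Γ_r w⟩⟨z', Γ_r v⟩ - ⟨z, Γ_r v⟩⟨z', Γ_r w⟩)` (`innerE_curvature`). The first turns the quadratic
terms into `-½ dΛ(Ric^#)`. The second, with the antisymmetry of the quartic monomials, turns the
rest into the curvature sum (`sum_quartic_eq`).

For forms, differentiating `u ↦ φ((Λu) w)` along `A^*` replaces `w` by `dΛ(A) w`, so the same
operator appears inside `φ`. -/

@[elab_as_elim]
theorem exteriorAlgebra_left_induction {P : ExteriorAlgebra ℝ V → Prop} (one : P 1)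
    (add : ∀ x y, P x → P y → P (x + y)) (smul : ∀ (r : ℝ) x, P x → P (r • x))
    (ι_mul : ∀ x v, P x → P (ExteriorAlgebra.ι ℝ v * x)) (x : ExteriorAlgebra ℝ V) : P x := by
  refine CliffordAlgebra.left_induction (Q := (0 : QuadraticForm ℝ V)) (fun r => ?_) add
    (fun x v h => ι_mul x v h) x
  rw [Algebra.algebraMap_eq_smul_one]
  exact smul r 1 one

theorem dExt_add (A B : V →ₗ[ℝ] V) : dExt (A + B) = dExt A + dExt B := by
  refine LinearMap.ext fun x => ?_
  induction x using exteriorAlgebra_left_induction with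
  | one => simp [dExt_one]
  | add x y hx hy => simp only [map_add, hx, hy]
  | smul r x hx => simp only [map_smul, hx]
  | ι_mul x v hx =>
    simp only [LinearMap.add_apply] at hx ⊢
    simp only [dExt_ι_mul, hx, LinearMap.add_apply, map_add, add_mul, mul_add]
    abel

theorem dExt_smul (c : ℝ) (A : V →ₗ[ℝ] V) : dExt (c • A) = c • dExt A := by
  refine LinearMap.ext fun x => ?_
  induction x using exteriorAlgebra_left_induction with
  | one => simp [dExt_one]
  | add x y hx hy => simp only [map_add, hx, hy]
  | smul r x hx => simp only [map_smul, hx]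
  | ι_mul x v hx =>
    simp only [LinearMap.smul_apply] at hx ⊢
    simp only [dExt_ι_mul, hx, LinearMap.smul_apply, map_smul, smul_add, smul_mul_assoc,
      mul_smul_comm]

/-- `dExt` as a linear map. -/
def dExtₗ : (V →ₗ[ℝ] V) →ₗ[ℝ] ExteriorAlgebra ℝ V →ₗ[ℝ] ExteriorAlgebra ℝ V where
  toFun := dExt
  map_add' := dExt_add
  map_smul' := dExt_smul

theorem dExtₗ_apply (A : V →ₗ[ℝ] V) : dExtₗ A = dExt A := rfl

theorem map_dExt {f : V →ₗ[ℝ] W} {A : V →ₗ[ℝ] V} {B : W →ₗ[ℝ] W} (h : ∀ v, f (A v) = B (f v))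
    (x : ExteriorAlgebra ℝ V) :
    ExteriorAlgebra.map f (dExt A x) = dExt B (ExteriorAlgebra.map f x) := by
  induction x using exteriorAlgebra_left_induction with
  | one => simp [dExt_one]
  | add x y hx hy => simp only [map_add, hx, hy]
  | smul r x hx => simp only [map_smul, hx]
  | ι_mul x v hx =>
    simp only [dExt_ι_mul, map_add, map_mul, ExteriorAlgebra.map_apply_ι, hx, h]

theorem annihilation_ι_mul (d : Module.Dual ℝ V) (v : V) (x : ExteriorAlgebra ℝ V) :
    annihilation d (ExteriorAlgebra.ι ℝ v * x) =
      d v • x - ExteriorAlgebra.ι ℝ v * annihilation d x :=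
  CliffordAlgebra.contractLeft_ι_mul (Q := (0 : QuadraticForm ℝ V)) d v x

theorem annihilation_one (d : Module.Dual ℝ V) :
    annihilation d (1 : ExteriorAlgebra ℝ V) = 0 :=
  CliffordAlgebra.contractLeft_one (Q := (0 : QuadraticForm ℝ V)) d

theorem annihilation_comm (d d' : Module.Dual ℝ V) (x : ExteriorAlgebra ℝ V) :
    annihilation d (annihilation d' x) = -annihilation d' (annihilation d x) :=
  CliffordAlgebra.contractLeft_comm (Q := (0 : QuadraticForm ℝ V)) d d' x

theorem annihilation_self (d : Module.Dual ℝ V) (x : ExteriorAlgebra ℝ V) :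
    annihilation d (annihilation d x) = 0 :=
  CliffordAlgebra.contractLeft_contractLeft (Q := (0 : QuadraticForm ℝ V)) d x

theorem creation_apply (v : V) (x : ExteriorAlgebra ℝ V) :
    creation v x = ExteriorAlgebra.ι ℝ v * x := rfl

theorem creation_comm (v w : V) (x : ExteriorAlgebra ℝ V) :
    creation v (creation w x) = -creation w (creation v x) := by
  simp only [creation_apply, ← mul_assoc]
  rw [eq_neg_iff_add_eq_zero, ← add_mul, ExteriorAlgebra.ι_add_mul_swap, zero_mul]

theorem creation_self (v : V) (x : ExteriorAlgebra ℝ V) : creation v (creation v x) = 0 := by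
  simp [creation_apply, ← mul_assoc]

/-- `creation` as a linear map. -/
def creationₗ : V →ₗ[ℝ] ExteriorAlgebra ℝ V →ₗ[ℝ] ExteriorAlgebra ℝ V where
  toFun := creation
  map_add' v w := by ext x; simp [creation_apply, add_mul]
  map_smul' c v := by ext x; simp [creation_apply]

theorem creation_sum_smul {ι : Type*} (s : Finset ι) (c : ι → ℝ) (v : ι → V)
    (x : ExteriorAlgebra ℝ V) :
    creation (∑ i ∈ s, c i • v i) x = ∑ i ∈ s, c i • creation (v i) x := by
  change creationₗ _ x = _
  simp only [map_sum, map_smul, LinearMap.sum_apply, LinearMap.smul_apply]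
  rfl

variable {κ : Type*} [Fintype κ]

/-- Expanding `v` in the basis recovers the term `A v ∧ x` of the derivation rule. The other terms
match because creation operators anticommute. -/
theorem dExt_apply_eq_sum (e : Module.Basis κ ℝ V) (A : V →ₗ[ℝ] V) (x : ExteriorAlgebra ℝ V) :
    dExt A x = ∑ a, creation (A (e a)) (annihilation (e.coord a) x) := by
  induction x using exteriorAlgebra_left_induction with
  | one => simp [dExt_one, annihilation_one]
  | add x y hx hy => simp only [map_add, hx, hy, Finset.sum_add_distrib]
  | smul r x hx => simp only [map_smul, hx, Finset.smul_sum]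
  | ι_mul x v hx =>
    rw [dExt_ι_mul, hx]
    simp only [annihilation_ι_mul, map_sub, Finset.sum_sub_distrib]
    have h1 : ∑ a, creation (A (e a)) ((e.coord a) v • x) = ExteriorAlgebra.ι ℝ (A v) * x := by
      conv_rhs => rw [← creation_apply, ← e.sum_repr v, map_sum]
      simp only [map_smul, creation_sum_smul, Module.Basis.coord_apply]
    rw [h1, sub_eq_add_neg, ← Finset.sum_neg_distrib, Finset.mul_sum]
    congr 1
    refine Finset.sum_congr rfl fun a _ => ?_
    rw [← creation_apply, ← creation_apply, creation_comm]

/-- Normal ordering: in `dΛ(A)` applied to `B e_i ∧ a_i x`, the derivation either hits `B e_i`,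
which gives `dΛ(A ∘ B)`, or passes to `a_i x`. In the second case moving the new creation operator
to the front costs a sign. -/
theorem dExt_dExt (e : Module.Basis κ ℝ V) (A B : V →ₗ[ℝ] V) (x : ExteriorAlgebra ℝ V) :
    dExt A (dExt B x) = dExt (A ∘ₗ B) x -
      ∑ i, ∑ k, creation (A (e k)) (creation (B (e i))
        (annihilation (e.coord k) (annihilation (e.coord i) x))) := by
  rw [dExt_apply_eq_sum e B, map_sum, dExt_apply_eq_sum e (A ∘ₗ B), ← Finset.sum_sub_distrib]
  refine Finset.sum_congr rfl fun i _ => ?_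
  rw [creation_apply, dExt_ι_mul, dExt_apply_eq_sum e A, sub_eq_add_neg, ← Finset.sum_neg_distrib,
    Finset.mul_sum]
  congr 1
  refine Finset.sum_congr rfl fun k _ => ?_
  rw [← creation_apply, creation_comm]

theorem sum_sum_lt_of_symmetric {n : ℕ} {G : Type*} [AddCommGroup G] [Module ℝ G]
    (f : Fin n → Fin n → G) (hs : ∀ i k, f i k = f k i) (hd : ∀ i, f i i = 0) :
    ∑ i, ∑ k, (if i < k then f i k else 0) = (1 / 2 : ℝ) • ∑ i, ∑ k, f i k := by
  have h : ∑ i, ∑ k, f i k = ∑ i, ∑ k, (if i < k then f i k else 0) +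
      ∑ i, ∑ k, (if i < k then f i k else 0) := by
    conv_rhs =>
      arg 2
      rw [Finset.sum_comm]
    rw [← Finset.sum_add_distrib]
    refine Finset.sum_congr rfl fun i _ => ?_
    rw [← Finset.sum_add_distrib]
    refine Finset.sum_congr rfl fun k _ => ?_
    rcases lt_trichotomy i k with h | h | h
    · simp [h, not_lt.2 h.le]
    · simp [h, hd]
    · simp [h, not_lt.2 h.le, hs i k]
  rw [h, ← two_smul ℝ (∑ i, ∑ k, (if i < k then f i k else 0)), smul_smul]
  norm_num

/-- The normally ordered quartic term built from an antisymmetric curvature tensor of the form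
`R_{ikjl} = ∑ᵣ (⟨e_l, Γᵣ e_k⟩⟨e_j, Γᵣ e_i⟩ - ⟨e_l, Γᵣ e_i⟩⟨e_j, Γᵣ e_k⟩)`. -/
theorem sum_quartic_eq {n m p : ℕ} (e : Module.Basis (Fin n) ℝ V) (Γ : Fin m → V →ₗ[ℝ] V)
    (hΓ : ∀ r v (j : Fin n), p ≤ j.val → e.coord j (Γ r v) = 0)
    (R : Fin n → Fin n → Fin n → Fin n → ℝ)
    (hR : ∀ i k j l : Fin n, j.val < p → l.val < p → R i k j l =
      ∑ r, (e.coord l (Γ r (e k)) * e.coord j (Γ r (e i)) -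
        e.coord l (Γ r (e i)) * e.coord j (Γ r (e k)))) (x : ExteriorAlgebra ℝ V) :
    (∑ i : Fin n, ∑ k : Fin n, ∑ j : Fin n, ∑ l : Fin n,
      if i ≤ k ∧ j < l ∧ l.val < p then
        R i k j l • creation (e l) (creation (e j)
          (annihilation (e.coord k) (annihilation (e.coord i) x)))
      else 0) =
    (1 / 2 : ℝ) • ∑ r, ∑ i, ∑ k, creation (Γ r (e k)) (creation (Γ r (e i))
        (annihilation (e.coord k) (annihilation (e.coord i) x))) := by
  set T : Fin n → Fin n → Fin n → Fin n → ExteriorAlgebra ℝ V := fun i k j l =>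
    creation (e l) (creation (e j) (annihilation (e.coord k) (annihilation (e.coord i) x))) with hT
  have hT1 : ∀ i k j l, T i k j l = -T k i j l := fun i k j l => by
    simp only [hT]
    rw [annihilation_comm (e.coord k)]
    simp
  have hT2 : ∀ i k j l, T i k j l = -T i k l j := fun i k j l => by
    simp only [hT]
    rw [creation_comm (e l)]
  have hT1d : ∀ i j l, T i i j l = 0 := fun i j l => by
    simp only [hT, annihilation_self, map_zero]
  have hT2d : ∀ i k j, T i k j j = 0 := fun i k j => by simp only [hT, creation_self]
  set g : Fin m → Fin n → Fin n → ℝ := fun r j k => e.coord j (Γ r (e k)) with hg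
  set S : Fin n → Fin n → Fin n → Fin n → ℝ := fun i k j l =>
    ∑ r, (g r l k * g r j i - g r l i * g r j k) with hS
  have hS1 : ∀ i k j l, S i k j l = -S k i j l := fun i k j l => by
    simp only [hS, ← Finset.sum_neg_distrib]
    exact Finset.sum_congr rfl fun r _ => by ring
  have hS2 : ∀ i k j l, S i k j l = -S i k l j := fun i k j l => by
    simp only [hS, ← Finset.sum_neg_distrib]
    exact Finset.sum_congr rfl fun r _ => by ring
  -- The diagonal `i = k` drops out because an annihilation operator squares to zero. The bound `l <
  -- p` can be dropped because the `l`-th coordinate of each `Γ r v` vanishes for `l ≥ p`; when it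
  -- holds, `j < l` bounds `j` as well.
  have step1 : ∀ i k j l : Fin n, (if i ≤ k ∧ j < l ∧ l.val < p then R i k j l • T i k j l else 0) =
      if i < k then (if j < l then S i k j l • T i k j l else 0) else 0 := by
    intro i k j l
    rcases lt_trichotomy i k with h | h | h
    · by_cases hjl : j < l
      · by_cases hl : l.val < p
        · simp only [h.le, h, hjl, hl, and_self, if_true]
          rw [hR i k j l (lt_trans hjl hl) hl]
        · have hz : ∀ r v, g r l v = 0 := fun r v => hΓ r _ l (not_lt.1 hl)
          have : S i k j l = 0 := by simp [hS, hz]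
          simp [hl, this]
      · simp [hjl]
    · subst h; simp [hT1d]
    · simp [not_lt.2 h.le, not_le.2 h]
  have step2 : ∀ i k, ∑ j, ∑ l, (if i < k then (if j < l then S i k j l • T i k j l else 0) else 0)
      = if i < k then (1 / 2 : ℝ) • ∑ j, ∑ l, S i k j l • T i k j l else 0 := by
    intro i k
    split_ifs
    · refine sum_sum_lt_of_symmetric _ (fun j l => ?_) (fun j => by simp [hT2d])
      rw [hS2 i k j l, hT2 i k j l, neg_smul_neg]
    · simp
  -- Swapping `i` and `k` exchanges the two products in `S` and changes the sign of `T`, so both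
  -- halves of `S` contribute equally.
  have step3 : ∑ i, ∑ k, ∑ j, ∑ l, S i k j l • T i k j l =
      (2 : ℝ) • ∑ i, ∑ k, ∑ j, ∑ l, (∑ r, g r l k * g r j i) • T i k j l := by
    rw [two_smul]
    conv_rhs =>
      arg 2
      rw [Finset.sum_comm]
    simp only [← Finset.sum_add_distrib]
    refine Finset.sum_congr rfl fun i _ => Finset.sum_congr rfl fun k _ =>
      Finset.sum_congr rfl fun j _ => Finset.sum_congr rfl fun l _ => ?_
    rw [hT1 k i, smul_neg, ← sub_eq_add_neg, ← sub_smul]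
    simp only [hS, Finset.sum_sub_distrib]
  have step4 : ∀ r i k, creation (Γ r (e k)) (creation (Γ r (e i))
        (annihilation (e.coord k) (annihilation (e.coord i) x))) =
      ∑ j, ∑ l, (g r l k * g r j i) • T i k j l := by
    intro r i k
    have hk : Γ r (e k) = ∑ l, g r l k • e l := (e.sum_repr _).symm
    have hi : Γ r (e i) = ∑ j, g r j i • e j := (e.sum_repr _).symm
    rw [hi, creation_sum_smul, map_sum]
    refine Finset.sum_congr rfl fun j _ => ?_
    rw [map_smul, hk, creation_sum_smul, Finset.smul_sum]
    refine Finset.sum_congr rfl fun l _ => ?_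
    rw [smul_smul, mul_comm]
  simp only [step4]
  have step5 : ∑ r, ∑ i, ∑ k, ∑ j, ∑ l, (g r l k * g r j i) • T i k j l =
      ∑ i, ∑ k, ∑ j, ∑ l, (∑ r, g r l k * g r j i) • T i k j l := by
    rw [Finset.sum_comm]
    refine Finset.sum_congr rfl fun i _ => ?_
    rw [Finset.sum_comm]
    refine Finset.sum_congr rfl fun k _ => ?_
    rw [Finset.sum_comm]
    refine Finset.sum_congr rfl fun j _ => ?_
    rw [Finset.sum_comm]
    exact Finset.sum_congr rfl fun l _ => (Finset.sum_smul).symm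
  rw [step5]
  -- Each of the two triangular sums is half of a full sum, and `step3` gives back a factor `2`,
  -- which leaves `½`.
  calc _ = ∑ i, ∑ k, if i < k then (1 / 2 : ℝ) • ∑ j, ∑ l, S i k j l • T i k j l else 0 := by
        refine Finset.sum_congr rfl fun i _ => Finset.sum_congr rfl fun k _ => ?_
        rw [← step2]
        exact Finset.sum_congr rfl fun j _ => Finset.sum_congr rfl fun l _ => step1 i k j l
    _ = (1 / 2 : ℝ) • ∑ i, ∑ k, (1 / 2 : ℝ) • ∑ j, ∑ l, S i k j l • T i k j l := by
        refine sum_sum_lt_of_symmetric _ (fun i k => ?_) (fun i => by simp [hT1d])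
        congr 1
        refine Finset.sum_congr rfl fun j _ => Finset.sum_congr rfl fun l _ => ?_
        rw [hS1 i k j l, hT1 i k j l, neg_smul_neg]
    _ = _ := by
        simp only [← Finset.smul_sum]
        rw [step3, smul_smul, smul_smul]
        norm_num

/-- `dΛ(A)` is the derivative of `g ↦ Λ g` at the identity in the direction `A`. -/
theorem hasDerivAt_map_one_add_smul (A : V →ₗ[ℝ] V) (w : ExteriorAlgebra ℝ V) :
    ∀ ℓ : Module.Dual ℝ (ExteriorAlgebra ℝ V),
      HasDerivAt (fun t : ℝ => ℓ (ExteriorAlgebra.map (LinearMap.id + t • A) w)) (ℓ (dExt A w)) 0 := by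
  have h0 : ∀ x : ExteriorAlgebra ℝ V,
      ExteriorAlgebra.map (LinearMap.id + (0 : ℝ) • A) x = x := fun x => by simp
  induction w using exteriorAlgebra_left_induction with
  | one => intro ℓ; simpa [dExt_one] using hasDerivAt_const (0 : ℝ) (ℓ 1)
  | add x y hx hy =>
    intro ℓ
    simp only [map_add]
    exact (hx ℓ).add (hy ℓ)
  | smul r x hx =>
    intro ℓ
    simp only [map_smul]
    exact (hx ℓ).const_smul r
  | ι_mul x v hx =>
    intro ℓ
    -- `Λ(1 + tA)(v ∧ x)` is `v ∧ Λ(1 + tA)x + t (A v ∧ Λ(1 + tA)x)`. The induction hypothesis is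
    -- needed for functionals composed with a creation operator, hence for all `ℓ`.
    have h1 := hx (ℓ ∘ₗ creation v)
    have h2 := (hasDerivAt_id (0 : ℝ)).mul (hx (ℓ ∘ₗ creation (A v)))
    have h := h1.add h2
    simp only [LinearMap.comp_apply, creation_apply, h0, id_eq, one_mul, zero_mul, add_zero] at h
    rw [dExt_ι_mul, map_add, add_comm]
    refine h.congr_of_eventuallyEq (Filter.Eventually.of_forall fun t => ?_)
    simp [add_mul]

end ExteriorLemmas

/-! ### The orthogonal projection onto the complement of the kernel of the noise -/

section Noise

variable {n m : ℕ} {M : Type*} [TopologicalSpace M] [ChartedSpace (EuclideanSpace ℝ (Fin n)) M]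
  (X : Fin m → ∀ x : M, TangentSpace (𝓡 n) x)

/-- The orthogonal projection of `ℝᵐ` onto `(ker X(x))ᗮ`. -/
def noiseProj (x : M) : Euc m →L[ℝ] Euc m :=
  (LinearMap.ker (noise X x))ᗮ.starProjection

theorem noise_apply (x : M) (e : Euc m) : noise X x e = ∑ j, e j • X j x := rfl

theorem noise_single (x : M) (j : Fin m) : noise X x (EuclideanSpace.single j 1) = X j x := by
  simp [noise_apply, ite_smul]

theorem noiseProj_mem (x : M) (e : Euc m) : noiseProj X x e ∈ (LinearMap.ker (noise X x))ᗮ :=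
  Submodule.starProjection_apply_mem _ _

theorem noise_noiseProj (x : M) (e : Euc m) : noise X x (noiseProj X x e) = noise X x e := by
  have h : e - noiseProj X x e ∈ (LinearMap.ker (noise X x))ᗮᗮ :=
    Submodule.sub_starProjection_mem_orthogonal e
  rw [Submodule.orthogonal_orthogonal, LinearMap.mem_ker, map_sub, sub_eq_zero] at h
  exact h.symm

theorem eq_of_mem_orthogonal_ker_noise {x : M} {e e' : Euc m}
    (he : e ∈ (LinearMap.ker (noise X x))ᗮ) (he' : e' ∈ (LinearMap.ker (noise X x))ᗮ)
    (h : noise X x e = noise X x e') : e = e' := by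
  rw [← sub_eq_zero]
  have h1 : e - e' ∈ LinearMap.ker (noise X x) := by rw [LinearMap.mem_ker, map_sub, h, sub_self]
  have h2 := Submodule.sub_mem _ he he'
  exact inner_self_eq_zero.1 (h2 _ h1)

theorem eq_noiseProj {x : M} {e e' : Euc m} (he : e ∈ (LinearMap.ker (noise X x))ᗮ)
    (h : noise X x e = noise X x e') : e = noiseProj X x e' :=
  eq_of_mem_orthogonal_ker_noise X he (noiseProj_mem X x e') (by rw [noise_noiseProj, h])

theorem noiseProj_of_mem {x : M} {e : Euc m} (he : e ∈ (LinearMap.ker (noise X x))ᗮ) :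
    noiseProj X x e = e :=
  (eq_noiseProj X he rfl).symm

theorem noiseProj_noiseProj (x : M) (e : Euc m) :
    noiseProj X x (noiseProj X x e) = noiseProj X x e :=
  noiseProj_of_mem X (noiseProj_mem X x e)

theorem inner_noiseProj (x : M) (e e' : Euc m) :
    inner ℝ (noiseProj X x e) e' = inner ℝ e (noiseProj X x e') :=
  Submodule.inner_starProjection_left_eq_right _ e e'

theorem noiseProj_eq_zero {x : M} {e : Euc m} (h : noise X x e = 0) : noiseProj X x e = 0 :=
  (eq_noiseProj X (Submodule.zero_mem _) (by simp [h])).symm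

theorem noiseInv_noise (x : M) (e : Euc m) : noiseInv X x (noise X x e) = noiseProj X x e := by
  have h := Classical.epsilon_spec (p := fun e' : Euc m =>
    e' ∈ (LinearMap.ker (noise X x))ᗮ ∧ noise X x e' = noise X x e)
    ⟨noiseProj X x e, noiseProj_mem X x e, noise_noiseProj X x e⟩
  exact eq_noiseProj X h.1 h.2

theorem innerE_noise (x : M) (e e' : Euc m) :
    innerE X x (noise X x e) (noise X x e') = inner ℝ (noiseProj X x e) (noiseProj X x e') := by
  rw [innerE, noiseInv_noise, noiseInv_noise]

/-- Under the Euclidean identification of `ℝᵐ` with its dual, `(ker X)ᗮ` is the annihilator of `ker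
X`, which is the range of the transpose of `X`. -/
theorem exists_dual_of_mem_orthogonal {x : M} {e : Euc m}
    (he : e ∈ (LinearMap.ker (noise X x))ᗮ) :
    ∃ a : TangentSpace (𝓡 n) x →L[ℝ] ℝ, ∀ j, a (X j x) = e j := by
  have h1 : ((innerSL ℝ e : Euc m →L[ℝ] ℝ) : Euc m →ₗ[ℝ] ℝ) ∈
      (LinearMap.ker (noise X x)).dualAnnihilator := by
    rw [Submodule.mem_dualAnnihilator]
    intro w hw
    have := he w hw
    rw [real_inner_comm] at this
    simpa using this
  rw [← LinearMap.range_dualMap_eq_dualAnnihilator_ker] at h1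
  obtain ⟨a, ha⟩ := h1
  let a' : Euc n →ₗ[ℝ] ℝ := a
  let b : Euc n →L[ℝ] ℝ := LinearMap.toContinuousLinearMap a'
  refine ⟨b, fun j => ?_⟩
  have := DFunLike.congr_fun ha (EuclideanSpace.single j 1)
  rw [LinearMap.dualMap_apply, noise_single] at this
  refine this.trans ?_
  simp [EuclideanSpace.inner_single_right]

/-- The coefficients `½ a(Xʲ)` of `σ(a)` with respect to the `Xʲ`. -/
def symbolCoeff (x : M) (a : TangentSpace (𝓡 n) x →L[ℝ] ℝ) : Euc m :=
  WithLp.toLp 2 fun j => (1 / 2 : ℝ) * a (X j x)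

theorem noise_symbolCoeff (x : M) (a : TangentSpace (𝓡 n) x →L[ℝ] ℝ) :
    noise X x (symbolCoeff X x a) = symbol (𝓡 n) X x a := by
  simp [noise_apply, symbolCoeff, symbol, Finset.smul_sum, smul_smul]

theorem symbolCoeff_mem (x : M) (a : TangentSpace (𝓡 n) x →L[ℝ] ℝ) :
    symbolCoeff X x a ∈ (LinearMap.ker (noise X x))ᗮ := by
  intro w hw
  have h : (1 / 2 : ℝ) * a (noise X x w) = 0 := by rw [LinearMap.mem_ker.1 hw]; simp
  rw [← h, noise_apply, map_sum, Finset.mul_sum, PiLp.inner_apply]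
  refine Finset.sum_congr rfl fun j _ => ?_
  simp [symbolCoeff]
  ring

/-- The symbol is `½ X Xᵀ`, and `Xᵀ` maps onto `(ker X)ᗮ`, on which `X` already attains its whole
range. -/
theorem symbolImage_eq_range_noise (x : M) :
    symbolImage (𝓡 n) X x = LinearMap.range (noise X x) := by
  apply le_antisymm
  · rintro _ ⟨a, rfl⟩
    exact ⟨symbolCoeff X x a, noise_symbolCoeff X x a⟩
  · rintro _ ⟨e, rfl⟩
    obtain ⟨a, ha⟩ := exists_dual_of_mem_orthogonal X (noiseProj_mem X x e)
    -- The factor `2` cancels the `½` in the symbol.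
    refine ⟨(2 : ℝ) • a, ?_⟩
    rw [← noise_noiseProj, ← noise_symbolCoeff]
    congr 1
    ext j
    simp [symbolCoeff, ha]

theorem mem_symbolImage (x : M) (j : Fin m) : X j x ∈ symbolImage (𝓡 n) X x := by
  rw [symbolImage_eq_range_noise]
  exact ⟨_, noise_single X x j⟩

/-- The coefficients of any covector with symbol `Xʲ(x)` are those of the `j`-th column of the
projection. -/
theorem symbolCoeff_epsilon (x : M) (j : Fin m) :
    symbolCoeff X x (Classical.epsilon fun a => symbol (𝓡 n) X x a = X j x) =
      noiseProj X x (EuclideanSpace.single j 1) := by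
  have h : symbol (𝓡 n) X x (Classical.epsilon fun a => symbol (𝓡 n) X x a = X j x) = X j x :=
    Classical.epsilon_spec (p := fun a => symbol (𝓡 n) X x a = X j x) (mem_symbolImage X x j)
  refine eq_noiseProj X (symbolCoeff_mem X x _) ?_
  rw [noise_symbolCoeff, h, noise_single]

theorem finrank_ker_noise (x : M) {p : ℕ}
    (h : Module.finrank ℝ (symbolImage (𝓡 n) X x) = p) :
    p + Module.finrank ℝ (LinearMap.ker (noise X x)) = m := by
  have := LinearMap.finrank_range_add_finrank_ker (noise X x)
  rw [← symbolImage_eq_range_noise, h] at this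
  simpa using this

end Noise

/-! ### Smooth dependence of the projection on the base point. -/

section NoiseSmooth

/-- The function `f ↦ (v ↦ ⟪f, v⟫ • w)` as a continuous linear map. -/
def rankOneAdjoint {E F : Type*} [NormedAddCommGroup E] [InnerProductSpace ℝ E]
    [FiniteDimensional ℝ E] [NormedAddCommGroup F] [NormedSpace ℝ F] (w : F) :
    E →L[ℝ] E →L[ℝ] F :=
  LinearMap.toContinuousLinearMap
    { toFun := fun f => (innerSL ℝ f).smulRight w
      map_add' := fun f g => by ext v; simp [add_smul]
      map_smul' := fun c f => by ext v; simp [mul_smul] }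

/-- The function `f ↦ (v ↦ c(v) • f)` as a continuous linear map. -/
def rankOne {E F : Type*} [NormedAddCommGroup E] [NormedSpace ℝ E]
    [FiniteDimensional ℝ E] [NormedAddCommGroup F] [NormedSpace ℝ F] (c : F →L[ℝ] ℝ) :
    E →L[ℝ] F →L[ℝ] E :=
  LinearMap.toContinuousLinearMap
    { toFun := fun f => c.smulRight f
      map_add' := fun f g => by ext v; simp
      map_smul' := fun r f => by ext v; simp [smul_smul, mul_comm] }

variable {n m : ℕ} {M : Type*} [TopologicalSpace M] [ChartedSpace (EuclideanSpace ℝ (Fin n)) M]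
  [IsManifold (𝓡 n) ∞ M]

/-- The coordinate representation of the vector field `Z` in the trivialization at `x₀`. -/
def coordField (x₀ : M) (Z : ∀ x : M, TangentSpace (𝓡 n) x) (y : M) : Euc n :=
  (trivializationAt (Euc n) (TangentSpace (𝓡 n)) x₀ ⟨y, Z y⟩).2

theorem contMDiffAt_coordField {Z : ∀ x : M, TangentSpace (𝓡 n) x}
    (hZ : ContMDiff (𝓡 n) (𝓡 n).tangent ∞ (fun x => (⟨x, Z x⟩ : TangentBundle (𝓡 n) M))) (x₀ : M) :
    ContMDiffAt (𝓡 n) 𝓘(ℝ, Euc n) ∞ (coordField x₀ Z) x₀ := by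
  have h := hZ x₀
  rw [Bundle.contMDiffAt_section] at h
  exact h

variable (X : Fin m → ∀ x : M, TangentSpace (𝓡 n) x)

/-- The noise map in the trivialization at `x₀`. -/
theorem sum_coordField (x₀ y : M)
    (hy : y ∈ (trivializationAt (Euc n) (TangentSpace (𝓡 n)) x₀).baseSet) (e : Euc m) :
    ∑ j, e j • coordField x₀ (X j) y =
      (trivializationAt (Euc n) (TangentSpace (𝓡 n)) x₀).continuousLinearEquivAt ℝ y hy
        (noise X y e) := by
  rw [noise_apply, map_sum]
  refine Finset.sum_congr rfl fun j _ => ?_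
  rw [map_smul]
  rfl

/-- The formula `P = Fᵀ (F Fᵀ)⁻¹ F` holds for a surjective `F` with the same kernel as the noise.
Such an `F` is obtained near `x₀` by projecting the noise, read in the trivialization at `x₀`, onto
its range `E₀` at `x₀`. Constancy of the rank is what makes the two kernels agree at nearby points.
-/
theorem contMDiff_noiseProj
    (hX : ∀ j, ContMDiff (𝓡 n) (𝓡 n).tangent ∞ (fun x => (⟨x, X j x⟩ : TangentBundle (𝓡 n) M)))
    {p : ℕ} (hp : ∀ y, Module.finrank ℝ (symbolImage (𝓡 n) X y) = p) :
    ContMDiff (𝓡 n) 𝓘(ℝ, Euc m →L[ℝ] Euc m) ∞ (noiseProj X) := by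
  intro x₀
  set t := trivializationAt (Euc n) (TangentSpace (𝓡 n) : M → Type _) x₀ with ht
  have hx₀ : x₀ ∈ t.baseSet := FiberBundle.mem_baseSet_trivializationAt' x₀
  -- the range of the noise at `x₀`, in coordinates
  let N : Euc m →ₗ[ℝ] Euc n := (t.continuousLinearEquivAt ℝ x₀ hx₀).toLinearMap ∘ₗ noise X x₀
  let E₀ : Submodule ℝ (Euc n) := LinearMap.range N
  have hkerN : LinearMap.ker N = LinearMap.ker (noise X x₀) := by
    ext e
    simp only [N, LinearMap.mem_ker, LinearMap.comp_apply]
    exact (t.continuousLinearEquivAt ℝ x₀ hx₀).map_eq_zero_iff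
  have hE₀ : Module.finrank ℝ E₀ = p := by
    have h1 := LinearMap.finrank_range_add_finrank_ker N
    have h2 := finrank_ker_noise X x₀ (hp x₀)
    rw [hkerN, finrank_euclideanSpace_fin] at h1
    change Module.finrank ℝ E₀ + _ = _ at h1
    omega
  let f : Fin m → M → E₀ := fun j y => E₀.orthogonalProjectionOnto (coordField x₀ (X j) y)
  have hf : ∀ j, ContMDiffAt (𝓡 n) 𝓘(ℝ, E₀) ∞ (f j) x₀ := fun j =>
    (E₀.orthogonalProjectionOnto.contMDiff.contMDiffAt).comp x₀ (contMDiffAt_coordField (hX j) x₀)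
  let F : M → Euc m →L[ℝ] E₀ := fun y =>
    ∑ j, rankOne (EuclideanSpace.proj j : Euc m →L[ℝ] ℝ) (f j y)
  let Ft : M → E₀ →L[ℝ] Euc m := fun y =>
    ∑ j, rankOneAdjoint (EuclideanSpace.single j (1 : ℝ)) (f j y)
  have hF_apply : ∀ y e, F y e = ∑ j, e j • f j y := fun y e => by
    simp [F, rankOne]
  have hFt_apply : ∀ y v j, Ft y v j = inner ℝ (f j y) v := fun y v j => by
    simp [Ft, rankOneAdjoint, Finset.sum_apply, Pi.single_apply]
  have hFproj : ∀ y (hy : y ∈ t.baseSet) e,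
      F y e = E₀.orthogonalProjectionOnto (t.continuousLinearEquivAt ℝ y hy (noise X y e)) :=
    fun y hy e => by
      rw [hF_apply, ← sum_coordField, map_sum]
      simp [f]
  have hadj : ∀ y e v, inner ℝ (Ft y v) e = inner ℝ v (F y e) := fun y e v => by
    rw [hF_apply, PiLp.inner_apply, inner_sum]
    refine Finset.sum_congr rfl fun j _ => ?_
    have h : inner ℝ v (e j • f j y) = e j * inner ℝ v (f j y) := by
      rw [Submodule.coe_inner, Submodule.coe_inner, Submodule.coe_smul, real_inner_smul_right]
    rw [hFt_apply, real_inner_comm v]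
    refine Eq.trans ?_ h.symm
    simp
  let G : M → E₀ →L[ℝ] E₀ := fun y => (F y).comp (Ft y)
  have hF : ContMDiffAt (𝓡 n) 𝓘(ℝ, Euc m →L[ℝ] E₀) ∞ F x₀ :=
    ContMDiffAt.sum fun j _ => (ContinuousLinearMap.contMDiff _).contMDiffAt.comp x₀ (hf j)
  have hFt : ContMDiffAt (𝓡 n) 𝓘(ℝ, E₀ →L[ℝ] Euc m) ∞ Ft x₀ :=
    ContMDiffAt.sum fun j _ => (ContinuousLinearMap.contMDiff _).contMDiffAt.comp x₀ (hf j)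
  have hG : ContMDiffAt (𝓡 n) 𝓘(ℝ, E₀ →L[ℝ] E₀) ∞ G x₀ := hF.clm_comp hFt
  -- `G` is invertible at `x₀`
  have hsurj : ∀ v : E₀, ∃ e, F x₀ e = v := by
    rintro ⟨v, e, rfl⟩
    refine ⟨e, ?_⟩
    rw [hFproj x₀ hx₀]
    exact E₀.orthogonalProjectionOnto_mem_subspace_eq_self ⟨N e, e, rfl⟩
  have hinj : Function.Injective (G x₀) := by
    rw [injective_iff_map_eq_zero]
    intro v hv
    have h1 : Ft x₀ v = 0 := by
      rw [← inner_self_eq_zero (𝕜 := ℝ), hadj]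
      change inner ℝ v (G x₀ v) = 0
      rw [hv, inner_zero_right]
    obtain ⟨e, he⟩ := hsurj v
    rw [← inner_self_eq_zero (𝕜 := ℝ)]
    nth_rewrite 2 [← he]
    rw [← hadj, h1, inner_zero_left]
  have hGinv : (G x₀).IsInvertible := by
    refine ⟨(LinearEquiv.ofInjectiveEndo (G x₀).toLinearMap hinj).toContinuousLinearEquiv, ?_⟩
    ext v
    rfl
  obtain ⟨G₀, hG₀⟩ := hGinv
  have hev : ∀ᶠ y in 𝓝 x₀, (G y).IsInvertible := by
    have := hG.continuousAt.eventually (ContinuousLinearEquiv.isOpen.mem_nhds ⟨G₀, hG₀⟩)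
    filter_upwards [this] with y hy using hy
  have hGi : ContMDiffAt (𝓡 n) 𝓘(ℝ, E₀ →L[ℝ] E₀) ∞ (fun y => (G y).inverse) x₀ := by
    have h := (contDiffAt_map_inverse (𝕜 := ℝ) (n := ∞) G₀).contMDiffAt
    rw [hG₀] at h
    exact h.comp x₀ hG
  have hfin : ContMDiffAt (𝓡 n) 𝓘(ℝ, Euc m →L[ℝ] Euc m) ∞
      (fun y => (Ft y).comp (((G y).inverse).comp (F y))) x₀ :=
    hFt.clm_comp (hGi.clm_comp hF)
  refine hfin.congr_of_eventuallyEq ?_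
  filter_upwards [hev, t.open_baseSet.mem_nhds hx₀] with y hy hyt
  obtain ⟨g, hg⟩ := hy
  -- the kernels of `F y` and of the noise agree
  have hker : LinearMap.ker (noise X y) = LinearMap.ker (F y).toLinearMap := by
    apply Submodule.eq_of_le_of_finrank_eq
    · intro e he
      rw [LinearMap.mem_ker] at he ⊢
      change F y e = 0
      rw [hFproj y hyt, he, map_zero, map_zero]
    -- Invertibility of `F Fᵀ` at `y` makes `F y` surjective onto `E₀`, so its kernel has dimension
    -- `m - p`, the same as that of the noise.
    · have h1 := LinearMap.finrank_range_add_finrank_ker (F y).toLinearMap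
      have h2 := finrank_ker_noise X y (hp y)
      have h3 : LinearMap.range (F y).toLinearMap = ⊤ := by
        rw [LinearMap.range_eq_top]
        intro v
        refine ⟨Ft y (g.symm v), ?_⟩
        change G y (g.symm v) = v
        rw [← hg]
        simp
      rw [h3, finrank_top, hE₀, finrank_euclideanSpace_fin] at h1
      omega
  ext1 e
  symm
  rw [← hg]
  simp only [ContinuousLinearMap.comp_apply, ContinuousLinearMap.inverse_equiv,
    ContinuousLinearEquiv.coe_coe]
  -- The candidate is identified with `P e` by two properties: it is orthogonal to the kernel, and
  -- it has the same image as `e`.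
  apply eq_noiseProj
  · rw [hker]
    intro w hw
    rw [real_inner_comm, hadj]
    rw [LinearMap.mem_ker] at hw
    change F y w = 0 at hw
    rw [hw, inner_zero_right]
  · rw [← sub_eq_zero, ← map_sub, ← LinearMap.mem_ker, hker, LinearMap.mem_ker, map_sub,
      sub_eq_zero]
    change G y (g.symm (F y e)) = F y e
    rw [← hg]
    simp

end NoiseSmooth

/-! ### Derivatives in the preferred charts -/

theorem two_le_infty : (2 : ℕ∞ω) ≤ ∞ := WithTop.coe_le_coe.2 le_top

theorem one_add_one_le_infty : (1 + 1 : ℕ∞ω) ≤ ∞ := by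
  rw [one_add_one_eq_two]; exact two_le_infty

section ChartDerivative

variable {EN HN N F : Type*} [NormedAddCommGroup EN] [NormedSpace ℝ EN] [TopologicalSpace HN]
  {J : ModelWithCorners ℝ EN HN} [J.Boundaryless] [TopologicalSpace N] [ChartedSpace HN N]
  [NormedAddCommGroup F] [NormedSpace ℝ F]

theorem mfderiv_eq_fderiv_chart {h : N → F} {y : N} (hh : MDifferentiableAt J 𝓘(ℝ, F) h y) :
    (mfderiv J 𝓘(ℝ, F) h y : EN →L[ℝ] F) =
      fderiv ℝ (h ∘ (extChartAt J y).symm) (extChartAt J y y) := by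
  rw [hh.mfderiv, J.range_eq_univ, fderivWithin_univ]
  rfl

theorem contDiffAt_comp_extChartAt_symm {h : N → F} {y : N} {k : ℕ∞ω}
    (hh : ContMDiffAt J 𝓘(ℝ, F) k h y) :
    ContDiffAt ℝ k (h ∘ (extChartAt J y).symm) (extChartAt J y y) := by
  have := (contMDiffAt_iff.1 hh).2
  rw [J.range_eq_univ, contDiffWithinAt_univ] at this
  exact this

theorem contDiffAt_comp_extChartAt_symm' [IsManifold J ∞ N] {h : N → F} {x y : N}
    (hh : ContMDiffAt J 𝓘(ℝ, F) ∞ h y) (hy : y ∈ (extChartAt J x).source) :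
    ContDiffAt ℝ ∞ (h ∘ (extChartAt J x).symm) (extChartAt J x y) := by
  rw [← contMDiffAt_iff_contDiffAt]
  have h1 := (contMDiffOn_extChartAt_symm (I := J) (n := ∞) x).contMDiffAt
    ((isOpen_extChartAt_target x).mem_nhds ((extChartAt J x).map_source hy))
  have h2 : ContMDiffAt J 𝓘(ℝ, F) ∞ h ((extChartAt J x).symm (extChartAt J x y)) := by
    rw [(extChartAt J x).left_inv hy]; exact hh
  exact h2.comp _ h1

/-- `mfderiv` at `y` is expressed in the preferred chart at `y`, which varies with `y`. This moves
it to the fixed chart at `x`, as needed before differentiating a second time. -/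
theorem mfderiv_eq_fderiv_comp_mfderiv [IsManifold J ∞ N] {h : N → F} {x y : N}
    (hh : ContMDiffAt J 𝓘(ℝ, F) ∞ h y) (hy : y ∈ (extChartAt J x).source) :
    (mfderiv J 𝓘(ℝ, F) h y : EN →L[ℝ] F) =
      (fderiv ℝ (h ∘ (extChartAt J x).symm) (extChartAt J x y)).comp
        (mfderiv J 𝓘(ℝ, EN) (extChartAt J x) y : EN →L[ℝ] EN) := by
  have h1 := (contDiffAt_comp_extChartAt_symm' hh hy).differentiableAt (by simp)
  have hy' : y ∈ (chartAt HN x).source := by rwa [extChartAt_source] at hy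
  have h2 := mdifferentiableAt_extChartAt (I := J) hy'
  have h3 : h =ᶠ[𝓝 y] (h ∘ (extChartAt J x).symm) ∘ extChartAt J x := by
    filter_upwards [(isOpen_extChartAt_source x).mem_nhds hy] with z hz
    rw [Function.comp_apply, Function.comp_apply, (extChartAt J x).left_inv hz]
  have h4 := mfderiv_comp (I := J) y h1.mdifferentiableAt h2
  rw [mfderiv_eq_fderiv] at h4
  exact h3.mfderiv_eq.trans h4

end ChartDerivative

/-! ### Charts of the frame bundle and their transition maps. -/

section FrameCharts

variable {n : ℕ} {M : Type*} [TopologicalSpace M] [ChartedSpace (EuclideanSpace ℝ (Fin n)) M]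
  [IsManifold (𝓡 n) ∞ M]

/-- The frame `u` in the trivialization of the tangent bundle at `x₀`. -/
def frameCoord (x₀ : M) (u : GLM n M) : Euc n →L[ℝ] Euc n :=
  ((trivializationAt (Euc n) (TangentSpace (𝓡 n)) x₀).continuousLinearMapAt ℝ (proj u)).comp
    (frameMap u)

theorem extChartAt_GLM (u₀ u : GLM n M) :
    extChartAt (modelGL n) u₀ u =
      (extChartAt (𝓡 n) (proj u₀) (proj u), frameCoord (proj u₀) u) := by
  have h : extChartAt (modelGL n) u₀ u = extChartAt (modelGL n) (u₀ : HomBundle n M) u := rfl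
  rw [h, FiberBundle.extChartAt]
  refine Prod.ext rfl ?_
  change ContinuousLinearMap.inCoordinates _ _ _ _ _ _ _ _ _ = _
  ext v
  simp [ContinuousLinearMap.inCoordinates, frameCoord]
  rfl

theorem mem_extChartAt_source_GLM {u₀ u : GLM n M} :
    u ∈ (extChartAt (modelGL n) u₀).source ↔
      proj u ∈ (extChartAt (𝓡 n) (proj u₀)).source := by
  rw [extChartAt_source, extChartAt_source, TopologicalSpace.Opens.chartAt_eq,
    OpenPartialHomeomorph.subtypeRestr_source, FiberBundle.chartedSpace_chartAt]
  simp only [mfld_simps]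
  constructor
  · rintro ⟨-, h⟩
    exact h
  · intro h
    exact ⟨⟨trivial, h⟩, h⟩

theorem frameCoord_self (u : GLM n M) : frameCoord (proj u) u = frameMap u := by
  rw [frameCoord, TangentBundle.continuousLinearMapAt_trivializationAt (mem_chart_source _ _),
    mfderiv_extChartAt_self]
  rfl

theorem contMDiff_proj : ContMDiff (modelGL n) (𝓡 n) ∞ (proj : GLM n M → M) :=
  (Bundle.contMDiff_proj _).comp contMDiff_subtype_val

theorem extChartAt_GLM_self (u : GLM n M) :
    extChartAt (modelGL n) u u = (extChartAt (𝓡 n) (proj u) (proj u), frameMap u) := by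
  rw [extChartAt_GLM, frameCoord_self]
  rfl

theorem mfderiv_proj_apply (u : GLM n M) (v : Euc n × (Euc n →L[ℝ] Euc n)) :
    mfderiv (modelGL n) (𝓡 n) (proj : GLM n M → M) u v = v.1 := by
  have h : MDifferentiableAt (modelGL n) (𝓡 n) (proj : GLM n M → M) u :=
    (contMDiff_proj u).mdifferentiableAt (by simp)
  have hw : writtenInExtChartAt (modelGL n) (𝓡 n) u (proj : GLM n M → M)
      =ᶠ[𝓝 (extChartAt (modelGL n) u u)] Prod.fst := by
    filter_upwards [extChartAt_target_mem_nhds (I := modelGL n) u] with q hq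
    have h1 := (extChartAt (modelGL n) u).right_inv hq
    rw [extChartAt_GLM] at h1
    exact congrArg Prod.fst h1
  rw [h.mfderiv, (modelGL n).range_eq_univ, fderivWithin_univ, hw.fderiv_eq, fderiv_fst]
  rfl

/-- The map `(y, A) ↦ (g y, Dg(y) ∘ A)` plays two roles: for `g` a coordinate change of `M` it is
the induced change of frame coordinates, and for `g` a vector field in a chart it is the natural
lift. -/
theorem differentiableAt_frame_transition {E E' : Type*} [NormedAddCommGroup E] [NormedSpace ℝ E]
    [NormedAddCommGroup E'] [NormedSpace ℝ E'] {g : E → E} {y : E} (hg : ContDiffAt ℝ ∞ g y)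
    (A : E' →L[ℝ] E) :
    DifferentiableAt ℝ (fun q : E × (E' →L[ℝ] E) => (g q.1, (fderiv ℝ g q.1).comp q.2)) (y, A) := by
  have h1 : DifferentiableAt ℝ (fun q : E × (E' →L[ℝ] E) => g q.1) (y, A) :=
    DifferentiableAt.comp (g := g) (y, A) (hg.differentiableAt (by simp)) differentiableAt_fst
  have h2 : DifferentiableAt ℝ (fun q : E × (E' →L[ℝ] E) => fderiv ℝ g q.1) (y, A) :=
    DifferentiableAt.comp (g := fderiv ℝ g) (y, A)
      ((hg.fderiv_right (m := 1) one_add_one_le_infty).differentiableAt (by simp))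
      differentiableAt_fst
  exact h1.prodMk (h2.clm_comp differentiableAt_snd)

/-- The expression of the lift to frames of a local diffeomorphism, and its derivative in the
direction of a natural lift. -/
theorem fderiv_frame_transition {E E' : Type*} [NormedAddCommGroup E] [NormedSpace ℝ E]
    [NormedAddCommGroup E'] [NormedSpace ℝ E'] {g : E → E} {y : E} (hg : ContDiffAt ℝ ∞ g y)
    (A : E' →L[ℝ] E) (v : E) (B : E' →L[ℝ] E) :
    fderiv ℝ (fun q : E × (E' →L[ℝ] E) => (g q.1, (fderiv ℝ g q.1).comp q.2)) (y, A) (v, B) =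
      (fderiv ℝ g y v, (fderiv ℝ (fderiv ℝ g) y v).comp A + (fderiv ℝ g y).comp B) := by
  have h1 : HasFDerivAt g (fderiv ℝ g y) y := (hg.differentiableAt (by simp)).hasFDerivAt
  have h2 : HasFDerivAt (fderiv ℝ g) (fderiv ℝ (fderiv ℝ g) y) y :=
    ((hg.fderiv_right (m := 1) one_add_one_le_infty).differentiableAt (by simp)).hasFDerivAt
  have hfst : HasFDerivAt (Prod.fst : E × (E' →L[ℝ] E) → E) (ContinuousLinearMap.fst ℝ _ _) (y, A) :=
    hasFDerivAt_fst
  have hsnd : HasFDerivAt (Prod.snd : E × (E' →L[ℝ] E) → _) (ContinuousLinearMap.snd ℝ _ _)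
    (y, A) := hasFDerivAt_snd
  have h3 : HasFDerivAt (fun q : E × (E' →L[ℝ] E) => g q.1) _ (y, A) :=
    HasFDerivAt.comp (g := g) (y, A) h1 hfst
  have h4 : HasFDerivAt (fun q : E × (E' →L[ℝ] E) => fderiv ℝ g q.1) _ (y, A) :=
    HasFDerivAt.comp (g := fderiv ℝ g) (y, A) h2 hfst
  rw [(h3.prodMk (h4.clm_comp hsnd)).fderiv]
  refine Prod.ext (by simp) ?_
  ext w
  simp [add_comm]

theorem fderiv_frame_transition_vertical {E E' : Type*} [NormedAddCommGroup E] [NormedSpace ℝ E]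
    [NormedAddCommGroup E'] [NormedSpace ℝ E'] {g : E → E} {y : E} (hg : ContDiffAt ℝ ∞ g y)
    (A B : E' →L[ℝ] E) :
    fderiv ℝ (fun q : E × (E' →L[ℝ] E) => (g q.1, (fderiv ℝ g q.1).comp q.2)) (y, A) (0, B) =
      (0, (fderiv ℝ g y).comp B) := by
  rw [fderiv_frame_transition hg, map_zero, map_zero, ContinuousLinearMap.zero_comp, zero_add]

/-- Differentiating `Z' ∘ g = Dg(Z)` gives `DZ' ∘ Dg = D²g(·, Z) + Dg ∘ DZ`, while the transition
map produces `D²g(Z, ·) + Dg ∘ DZ`. The symmetry of `D²g` reconciles them, so the coordinate formula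
for the natural lift is independent of the chart. -/
theorem naturalLift_transition {E E' : Type*} [NormedAddCommGroup E] [NormedSpace ℝ E]
    [NormedAddCommGroup E'] [NormedSpace ℝ E'] {g Z Z' : E → E} {y : E} (hg : ContDiffAt ℝ ∞ g y)
    (hZ : DifferentiableAt ℝ Z y) (hZ' : DifferentiableAt ℝ Z' (g y))
    (hgZ : Z' ∘ g =ᶠ[𝓝 y] fun z => fderiv ℝ g z (Z z)) (A : E' →L[ℝ] E) :
    fderiv ℝ (fun q : E × (E' →L[ℝ] E) => (g q.1, (fderiv ℝ g q.1).comp q.2)) (y, A)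
        (Z y, (fderiv ℝ Z y).comp A) =
      (Z' (g y), (fderiv ℝ Z' (g y)).comp ((fderiv ℝ g y).comp A)) := by
  have h1 : HasFDerivAt g (fderiv ℝ g y) y := (hg.differentiableAt (by simp)).hasFDerivAt
  have h2 : HasFDerivAt (fderiv ℝ g) (fderiv ℝ (fderiv ℝ g) y) y :=
    ((hg.fderiv_right (m := 1) one_add_one_le_infty).differentiableAt (by simp)).hasFDerivAt
  have hsymm : IsSymmSndFDerivAt ℝ g y :=
    hg.isSymmSndFDerivAt (by simpa using two_le_infty)
  have h3 := hgZ.fderiv_eq (𝕜 := ℝ)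
  rw [(h2.clm_apply hZ.hasFDerivAt).fderiv, (hZ'.hasFDerivAt.comp y h1).fderiv] at h3
  rw [fderiv_frame_transition hg, ← hgZ.eq_of_nhds]
  refine Prod.ext rfl ?_
  ext w
  have h4 := congrArg (fun L : E →L[ℝ] E => L (A w)) h3
  simp only [ContinuousLinearMap.comp_apply, add_apply,
    ContinuousLinearMap.flip_apply] at h4 ⊢
  have h5 : fderiv ℝ (fderiv ℝ g) y (A w) (Z y) = fderiv ℝ (fderiv ℝ g) y (Z y) (A w) :=
    hsymm (A w) (Z y)
  rw [h4, h5, add_comm]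

end FrameCharts

/-! ### Vector fields, natural lifts and fundamental fields in a fixed chart. -/

section FrameCoordinates

variable {n : ℕ} {M : Type*} [TopologicalSpace M] [ChartedSpace (EuclideanSpace ℝ (Fin n)) M]
  [IsManifold (𝓡 n) ∞ M]

theorem continuousLinearMapAt_eq_mfderiv {x₀ y : M} (hy : y ∈ (extChartAt (𝓡 n) x₀).source) :
    (trivializationAt (Euc n) (TangentSpace (𝓡 n)) x₀).continuousLinearMapAt ℝ y =
      (mfderiv (𝓡 n) 𝓘(ℝ, Euc n) (extChartAt (𝓡 n) x₀) y : TangentSpace (𝓡 n) y →L[ℝ] Euc n) := by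
  rw [extChartAt_source] at hy
  exact TangentBundle.continuousLinearMapAt_trivializationAt hy

theorem coordField_eq_mfderiv {x₀ y : M} (hy : y ∈ (extChartAt (𝓡 n) x₀).source)
    (Z : ∀ x : M, TangentSpace (𝓡 n) x) :
    coordField x₀ Z y = mfderiv (𝓡 n) 𝓘(ℝ, Euc n) (extChartAt (𝓡 n) x₀) y (Z y) := by
  have h := congrArg (fun L : TangentSpace (𝓡 n) y →L[ℝ] Euc n => L (Z y))
    (continuousLinearMapAt_eq_mfderiv hy)
  refine Eq.trans ?_ h
  rw [extChartAt_source] at hy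
  rw [Bundle.Trivialization.continuousLinearMapAt_apply,
    Bundle.Trivialization.linearMapAt_apply, if_pos]
  · rfl
  · exact hy

theorem coordField_self (x : M) (Z : ∀ x : M, TangentSpace (𝓡 n) x) :
    coordField x Z x = Z x := by
  rw [coordField_eq_mfderiv (mem_extChartAt_source x), mfderiv_extChartAt_self]
  rfl

/-- The vector field `Z` in the preferred chart at `x₀`. -/
def chartField (x₀ : M) (Z : ∀ x : M, TangentSpace (𝓡 n) x) : Euc n → Euc n :=
  coordField x₀ Z ∘ (extChartAt (𝓡 n) x₀).symm

theorem chartField_apply {x₀ y : M} (hy : y ∈ (extChartAt (𝓡 n) x₀).source)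
    (Z : ∀ x : M, TangentSpace (𝓡 n) x) :
    chartField x₀ Z (extChartAt (𝓡 n) x₀ y) = coordField x₀ Z y := by
  rw [chartField, Function.comp_apply, (extChartAt (𝓡 n) x₀).left_inv hy]

theorem contMDiffAt_coordField' {Z : ∀ x : M, TangentSpace (𝓡 n) x} {x₀ y : M}
    (hZ : ContMDiffAt (𝓡 n) (𝓡 n).tangent ∞ (fun x => (⟨x, Z x⟩ : TangentBundle (𝓡 n) M)) y)
    (hy : y ∈ (extChartAt (𝓡 n) x₀).source) :
    ContMDiffAt (𝓡 n) 𝓘(ℝ, Euc n) ∞ (coordField x₀ Z) y := by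
  rw [extChartAt_source] at hy
  exact ((trivializationAt (Euc n) (TangentSpace (𝓡 n) : M → Type _) x₀).contMDiffAt_section_iff
    hy).1 hZ

theorem contDiffAt_chartField {Z : ∀ x : M, TangentSpace (𝓡 n) x} {x₀ y : M}
    (hZ : ContMDiffAt (𝓡 n) (𝓡 n).tangent ∞ (fun x => (⟨x, Z x⟩ : TangentBundle (𝓡 n) M)) y)
    (hy : y ∈ (extChartAt (𝓡 n) x₀).source) :
    ContDiffAt ℝ ∞ (chartField x₀ Z) (extChartAt (𝓡 n) x₀ y) :=
  contDiffAt_comp_extChartAt_symm' (contMDiffAt_coordField' hZ hy) hy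

theorem contMDiffAt_extChartAt_of_mem {x₀ y : M} (hy : y ∈ (extChartAt (𝓡 n) x₀).source) :
    ContMDiffAt (𝓡 n) 𝓘(ℝ, Euc n) ∞ (extChartAt (𝓡 n) x₀) y := by
  rw [extChartAt_source] at hy
  exact contMDiffAt_extChartAt' hy

theorem chartField_comp_eventuallyEq {x₀ x : M} (hx : x ∈ (extChartAt (𝓡 n) x₀).source)
    (Z : ∀ x : M, TangentSpace (𝓡 n) x) :
    chartField x₀ Z ∘ (extChartAt (𝓡 n) x₀ ∘ (extChartAt (𝓡 n) x).symm)
      =ᶠ[𝓝 (extChartAt (𝓡 n) x x)]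
      fun z => fderiv ℝ (extChartAt (𝓡 n) x₀ ∘ (extChartAt (𝓡 n) x).symm) z
        (chartField x Z z) := by
  have h1 : ∀ᶠ z in 𝓝 (extChartAt (𝓡 n) x x),
      (extChartAt (𝓡 n) x).symm z ∈ (extChartAt (𝓡 n) x₀).source := by
    have h := continuousAt_extChartAt_symm (I := 𝓡 n) x
    refine h.eventually ((isOpen_extChartAt_source x₀).mem_nhds ?_)
    rwa [extChartAt_to_inv]
  filter_upwards [h1, extChartAt_target_mem_nhds (I := 𝓡 n) x] with z hz hzt
  obtain ⟨y, hy, rfl⟩ : ∃ y ∈ (extChartAt (𝓡 n) x).source, extChartAt (𝓡 n) x y = z :=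
    ⟨_, (extChartAt (𝓡 n) x).map_target hzt, (extChartAt (𝓡 n) x).right_inv hzt⟩
  rw [(extChartAt (𝓡 n) x).left_inv hy] at hz
  rw [chartField_apply hy, Function.comp_apply, Function.comp_apply,
    (extChartAt (𝓡 n) x).left_inv hy, chartField_apply hz, coordField_eq_mfderiv hz,
    coordField_eq_mfderiv hy]
  have h := mfderiv_eq_fderiv_comp_mfderiv (contMDiffAt_extChartAt_of_mem hz) hy
  exact congrArg (fun L : Euc n →L[ℝ] Euc n => L (Z y)) h

theorem frameCoord_eq_comp {x₀ x : M} {u : GLM n M}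
    (hx₀ : proj u ∈ (extChartAt (𝓡 n) x₀).source) (hx : proj u ∈ (extChartAt (𝓡 n) x).source) :
    frameCoord x₀ u = (fderiv ℝ (extChartAt (𝓡 n) x₀ ∘ (extChartAt (𝓡 n) x).symm)
      (extChartAt (𝓡 n) x (proj u))).comp (frameCoord x u) := by
  rw [frameCoord, frameCoord, continuousLinearMapAt_eq_mfderiv hx₀,
    continuousLinearMapAt_eq_mfderiv hx]
  have h := mfderiv_eq_fderiv_comp_mfderiv (contMDiffAt_extChartAt_of_mem hx₀) hx
  exact congrArg (fun L : Euc n →L[ℝ] Euc n => L.comp (frameMap u)) h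

theorem extChartAt_GLM_comp_symm_eventuallyEq {u₀ u : GLM n M}
    (hu : proj u ∈ (extChartAt (𝓡 n) (proj u₀)).source) :
    extChartAt (modelGL n) u₀ ∘ (extChartAt (modelGL n) u).symm
      =ᶠ[𝓝 (extChartAt (modelGL n) u u)]
      fun q => ((extChartAt (𝓡 n) (proj u₀) ∘ (extChartAt (𝓡 n) (proj u)).symm) q.1,
        (fderiv ℝ (extChartAt (𝓡 n) (proj u₀) ∘ (extChartAt (𝓡 n) (proj u)).symm) q.1).comp
          q.2) := by
  have h1 : ∀ᶠ q in 𝓝 (extChartAt (modelGL n) u u),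
      (extChartAt (modelGL n) u).symm q ∈ (extChartAt (modelGL n) u₀).source := by
    have h := continuousAt_extChartAt_symm (I := modelGL n) u
    refine h.eventually ((isOpen_extChartAt_source u₀).mem_nhds ?_)
    rwa [extChartAt_to_inv, mem_extChartAt_source_GLM]
  filter_upwards [h1, extChartAt_target_mem_nhds (I := modelGL n) u] with q hq hqt
  obtain ⟨v, hv, rfl⟩ : ∃ v ∈ (extChartAt (modelGL n) u).source, extChartAt (modelGL n) u v = q :=
    ⟨_, (extChartAt (modelGL n) u).map_target hqt, (extChartAt (modelGL n) u).right_inv hqt⟩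
  rw [(extChartAt (modelGL n) u).left_inv hv] at hq
  rw [mem_extChartAt_source_GLM] at hq
  rw [Function.comp_apply, (extChartAt (modelGL n) u).left_inv hv]
  rw [mem_extChartAt_source_GLM] at hv
  rw [extChartAt_GLM, extChartAt_GLM]
  refine Prod.ext ?_ ?_
  · simp only [Function.comp_apply, (extChartAt (𝓡 n) (proj u)).left_inv hv]
  · exact frameCoord_eq_comp hq hv

theorem contMDiffAt_extChartAt_GLM {u₀ u : GLM n M}
    (hu : proj u ∈ (extChartAt (𝓡 n) (proj u₀)).source) :
    ContMDiffAt (modelGL n) 𝓘(ℝ, Euc n × (Euc n →L[ℝ] Euc n)) ∞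
      (extChartAt (modelGL n) u₀) u := by
  rw [← mem_extChartAt_source_GLM, extChartAt_source] at hu
  exact contMDiffAt_extChartAt' hu

theorem mfderiv_extChartAt_GLM {u₀ u : GLM n M}
    (hu : proj u ∈ (extChartAt (𝓡 n) (proj u₀)).source) :
    (mfderiv (modelGL n) 𝓘(ℝ, Euc n × (Euc n →L[ℝ] Euc n)) (extChartAt (modelGL n) u₀) u :
      (Euc n × (Euc n →L[ℝ] Euc n)) →L[ℝ] (Euc n × (Euc n →L[ℝ] Euc n))) =
    fderiv ℝ (fun q : Euc n × (Euc n →L[ℝ] Euc n) =>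
        ((extChartAt (𝓡 n) (proj u₀) ∘ (extChartAt (𝓡 n) (proj u)).symm) q.1,
        (fderiv ℝ (extChartAt (𝓡 n) (proj u₀) ∘ (extChartAt (𝓡 n) (proj u)).symm) q.1).comp
          q.2)) (extChartAt (𝓡 n) (proj u) (proj u), (frameMap u : Euc n →L[ℝ] Euc n)) := by
  rw [mfderiv_eq_fderiv_chart ((contMDiffAt_extChartAt_GLM hu).mdifferentiableAt (by simp)),
    (extChartAt_GLM_comp_symm_eventuallyEq hu).fderiv_eq, extChartAt_GLM_self]
  rfl

theorem naturalLift_eq {Z : ∀ x : M, TangentSpace (𝓡 n) x} (u : GLM n M)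
    (hZ : ContMDiffAt (𝓡 n) (𝓡 n).tangent ∞ (fun x => (⟨x, Z x⟩ : TangentBundle (𝓡 n) M))
      (proj u)) :
    naturalLift Z u = ((chartField (proj u) Z (extChartAt (𝓡 n) (proj u) (proj u)),
      (fderiv ℝ (chartField (proj u) Z) (extChartAt (𝓡 n) (proj u) (proj u))).comp
        (frameMap u : Euc n →L[ℝ] Euc n)) : Euc n × (Euc n →L[ℝ] Euc n)) := by
  have h := (contMDiffAt_coordField' hZ (mem_extChartAt_source (proj u))).mdifferentiableAt
    (by simp)
  have h2 := mfderiv_eq_fderiv_chart h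
  refine Prod.ext ?_ ?_
  · change Z (proj u) = _
    rw [chartField_apply (mem_extChartAt_source _), coordField_self]
  · exact congrArg (fun L : Euc n →L[ℝ] Euc n => L.comp (frameMap u : Euc n →L[ℝ] Euc n)) h2

/-- `naturalLift` at `u` is defined through the chart at `π(u)`. Iterated Lie derivatives at `u₀`
need its expression in the single chart at `u₀`, for all `u` nearby. -/
theorem mfderiv_extChartAt_naturalLift {Z : ∀ x : M, TangentSpace (𝓡 n) x} {u₀ u : GLM n M}
    (hZ : ContMDiffAt (𝓡 n) (𝓡 n).tangent ∞ (fun x => (⟨x, Z x⟩ : TangentBundle (𝓡 n) M))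
      (proj u))
    (hu : proj u ∈ (extChartAt (𝓡 n) (proj u₀)).source) :
    (mfderiv (modelGL n) 𝓘(ℝ, Euc n × (Euc n →L[ℝ] Euc n)) (extChartAt (modelGL n) u₀) u
      (naturalLift Z u) : Euc n × (Euc n →L[ℝ] Euc n)) =
    (chartField (proj u₀) Z (extChartAt (𝓡 n) (proj u₀) (proj u)),
      (fderiv ℝ (chartField (proj u₀) Z) (extChartAt (𝓡 n) (proj u₀) (proj u))).comp
        (frameCoord (proj u₀) u)) := by
  have hself := mem_extChartAt_source (I := 𝓡 n) (proj u)
  have h1 := mfderiv_extChartAt_GLM hu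
  have hg := contDiffAt_comp_extChartAt_symm' (contMDiffAt_extChartAt_of_mem hu) hself
  have hd := (contDiffAt_chartField hZ hself).differentiableAt (by simp)
  have hd0 := (contDiffAt_chartField hZ hu).differentiableAt (by simp)
  have hd0' : DifferentiableAt ℝ (chartField (proj u₀) Z)
      ((extChartAt (𝓡 n) (proj u₀) ∘ (extChartAt (𝓡 n) (proj u)).symm)
        (extChartAt (𝓡 n) (proj u) (proj u))) := by
    rwa [Function.comp_apply, extChartAt_to_inv]
  have h2 := naturalLift_transition hg hd hd0' (chartField_comp_eventuallyEq hu Z)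
    (frameMap u : Euc n →L[ℝ] Euc n)
  rw [naturalLift_eq u hZ, frameCoord_eq_comp hu hself, frameCoord_self]
  refine (congrArg (fun L : (Euc n × (Euc n →L[ℝ] Euc n)) →L[ℝ] (Euc n × (Euc n →L[ℝ] Euc n)) =>
    L _) h1).trans ?_
  refine h2.trans ?_
  rw [Function.comp_apply, extChartAt_to_inv]

theorem mfderiv_extChartAt_fundamental {u₀ u : GLM n M} (A : Euc n →L[ℝ] Euc n)
    (hu : proj u ∈ (extChartAt (𝓡 n) (proj u₀)).source) :
    (mfderiv (modelGL n) 𝓘(ℝ, Euc n × (Euc n →L[ℝ] Euc n)) (extChartAt (modelGL n) u₀) u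
      (fundamental A u) : Euc n × (Euc n →L[ℝ] Euc n)) =
    (0, (frameCoord (proj u₀) u).comp A) := by
  have hself := mem_extChartAt_source (I := 𝓡 n) (proj u)
  have h1 := mfderiv_extChartAt_GLM hu
  have hg := contDiffAt_comp_extChartAt_symm' (contMDiffAt_extChartAt_of_mem hu) hself
  have h2 := fderiv_frame_transition_vertical hg (frameMap u : Euc n →L[ℝ] Euc n)
    ((frameMap u : Euc n →L[ℝ] Euc n).comp A)
  rw [frameCoord_eq_comp hu hself, frameCoord_self]
  refine (congrArg (fun L : (Euc n × (Euc n →L[ℝ] Euc n)) →L[ℝ] (Euc n × (Euc n →L[ℝ] Euc n)) =>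
    L _) h1).trans ?_
  exact h2

/-- A function on `GLM` in the preferred chart at `u₀`. -/
def chartFun {F : Type*} (u₀ : GLM n M) (f : GLM n M → F) : Euc n × (Euc n →L[ℝ] Euc n) → F :=
  f ∘ (extChartAt (modelGL n) u₀).symm

theorem chartFun_lieDer_eventuallyEq {f : GLM n M → ℝ}
    (hf : ContMDiff (modelGL n) 𝓘(ℝ, ℝ) ∞ f) (u₀ : GLM n M)
    (V : ∀ u : GLM n M, TangentSpace (modelGL n) u) :
    chartFun u₀ (lieDer (modelGL n) V f) =ᶠ[𝓝 (extChartAt (modelGL n) u₀ u₀)] fun q =>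
      fderiv ℝ (chartFun u₀ f) q
        (mfderiv (modelGL n) 𝓘(ℝ, Euc n × (Euc n →L[ℝ] Euc n)) (extChartAt (modelGL n) u₀)
          ((extChartAt (modelGL n) u₀).symm q) (V ((extChartAt (modelGL n) u₀).symm q))) := by
  filter_upwards [extChartAt_target_mem_nhds (I := modelGL n) u₀] with q hq
  have hs := (extChartAt (modelGL n) u₀).map_target hq
  have h := mfderiv_eq_fderiv_comp_mfderiv (hf _) hs
  rw [(extChartAt (modelGL n) u₀).right_inv hq] at h
  exact congrArg (fun L : (Euc n × (Euc n →L[ℝ] Euc n)) →L[ℝ] ℝ =>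
    L (V ((extChartAt (modelGL n) u₀).symm q))) h

theorem chartFun_lieDer_naturalLift {f : GLM n M → ℝ}
    (hf : ContMDiff (modelGL n) 𝓘(ℝ, ℝ) ∞ f) (u₀ : GLM n M)
    {Z : ∀ x : M, TangentSpace (𝓡 n) x}
    (hZ : ContMDiff (𝓡 n) (𝓡 n).tangent ∞ (fun x => (⟨x, Z x⟩ : TangentBundle (𝓡 n) M))) :
    chartFun u₀ (lieDer (modelGL n) (naturalLift Z) f) =ᶠ[𝓝 (extChartAt (modelGL n) u₀ u₀)]
      fun q => fderiv ℝ (chartFun u₀ f) q (chartField (proj u₀) Z q.1,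
        (fderiv ℝ (chartField (proj u₀) Z) q.1).comp q.2) := by
  filter_upwards [chartFun_lieDer_eventuallyEq hf u₀ (naturalLift Z),
    extChartAt_target_mem_nhds (I := modelGL n) u₀] with q hq hqt
  have hs := (extChartAt (modelGL n) u₀).map_target hqt
  have hr := (extChartAt (modelGL n) u₀).right_inv hqt
  rw [mem_extChartAt_source_GLM] at hs
  rw [extChartAt_GLM] at hr
  have h1 := congrArg Prod.fst hr
  have h2 := congrArg Prod.snd hr
  dsimp only at h1 h2
  rw [hq, mfderiv_extChartAt_naturalLift (hZ _) hs, h1, h2]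

theorem chartFun_lieDer_fundamental {f : GLM n M → ℝ}
    (hf : ContMDiff (modelGL n) 𝓘(ℝ, ℝ) ∞ f) (u₀ : GLM n M) (A : Euc n →L[ℝ] Euc n) :
    chartFun u₀ (lieDer (modelGL n) (fundamental A) f) =ᶠ[𝓝 (extChartAt (modelGL n) u₀ u₀)]
      fun q => fderiv ℝ (chartFun u₀ f) q (0, q.2.comp A) := by
  filter_upwards [chartFun_lieDer_eventuallyEq hf u₀ (fundamental A),
    extChartAt_target_mem_nhds (I := modelGL n) u₀] with q hq hqt
  have hs := (extChartAt (modelGL n) u₀).map_target hqt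
  have hr := (extChartAt (modelGL n) u₀).right_inv hqt
  rw [mem_extChartAt_source_GLM] at hs
  rw [extChartAt_GLM] at hr
  have h2 := congrArg Prod.snd hr
  dsimp only at h2
  rw [hq, mfderiv_extChartAt_fundamental _ hs, h2]

end FrameCoordinates

/-! ### The derivative of the noise -/

/-- Both traces equal `∑ S_jk L(e_j, e_k)`, since the matrix of `S` is symmetric. Applied to `P` and
to `dP(v)`, this identity gives the vanishing of the cross terms, `X d = 0` and the Ricci trace. -/
theorem sum_selfAdjoint_comm {m : ℕ} {F : Type*} [AddCommGroup F] [Module ℝ F]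
    (L : Euc m →ₗ[ℝ] Euc m →ₗ[ℝ] F) (S : Euc m →L[ℝ] Euc m)
    (hS : ∀ a b, inner ℝ (S a) b = inner ℝ a (S b)) :
    ∑ k, L (S (EuclideanSpace.single k 1)) (EuclideanSpace.single k 1) =
      ∑ k, L (EuclideanSpace.single k 1) (S (EuclideanSpace.single k 1)) := by
  have hdec : ∀ a : Euc m, a = ∑ j, a j • EuclideanSpace.single j (1 : ℝ) := fun a => by
    ext i; simp [Finset.sum_apply, Pi.single_apply]
  have hsymm : ∀ j k, S (EuclideanSpace.single k 1) j = S (EuclideanSpace.single j 1) k := by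
    intro j k
    have := hS (EuclideanSpace.single k 1) (EuclideanSpace.single j 1)
    simpa [EuclideanSpace.inner_single_left, EuclideanSpace.inner_single_right] using this
  have h1 : ∀ k, L (S (EuclideanSpace.single k 1)) (EuclideanSpace.single k 1) =
      ∑ j, S (EuclideanSpace.single k 1) j •
        L (EuclideanSpace.single j 1) (EuclideanSpace.single k 1) := fun k => by
    conv_lhs => rw [hdec (S (EuclideanSpace.single k 1))]
    simp only [map_sum, map_smul, LinearMap.sum_apply, LinearMap.smul_apply]
  have h2 : ∀ k, L (EuclideanSpace.single k 1) (S (EuclideanSpace.single k 1)) =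
      ∑ j, S (EuclideanSpace.single k 1) j •
        L (EuclideanSpace.single k 1) (EuclideanSpace.single j 1) := fun k => by
    conv_lhs => rw [hdec (S (EuclideanSpace.single k 1))]
    simp only [map_sum, map_smul]
  simp only [h1, h2]
  rw [Finset.sum_comm]
  exact Finset.sum_congr rfl fun j _ => Finset.sum_congr rfl fun k _ => by rw [hsymm]

section NoiseDeriv

variable {n m p : ℕ} {M : Type*} [TopologicalSpace M] [ChartedSpace (EuclideanSpace ℝ (Fin n)) M]
  [IsManifold (𝓡 n) ∞ M] (X : Fin m → ∀ x : M, TangentSpace (𝓡 n) x)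

/-- `e ↦ ∑ₖ eₖ DXᵏ(x)`, in the preferred chart at `x`. -/
def noiseChartDeriv (x : M) : Euc m →ₗ[ℝ] Euc n →L[ℝ] Euc n :=
  ∑ k, (EuclideanSpace.proj k : Euc m →L[ℝ] ℝ).toLinearMap.smulRight
    (fderiv ℝ (chartField x (X k)) (extChartAt (𝓡 n) x x))

theorem noiseChartDeriv_apply (x : M) (e : Euc m) (v : Euc n) :
    noiseChartDeriv X x e v =
      ∑ k, e k • fderiv ℝ (chartField x (X k)) (extChartAt (𝓡 n) x x) v := by
  simp only [noiseChartDeriv, LinearMap.sum_apply, LinearMap.smulRight_apply, sum_apply]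
  rfl

theorem noiseChartDeriv_single (x : M) (k : Fin m) :
    noiseChartDeriv X x (EuclideanSpace.single k 1) =
      fderiv ℝ (chartField x (X k)) (extChartAt (𝓡 n) x x) := by
  ext1 v
  rw [noiseChartDeriv_apply, Finset.sum_eq_single k] <;> simp +contextual

/-- The noise at `x`, with `T_x M` identified with `ℝⁿ` through the preferred chart. -/
def noiseCoord (x : M) : Euc m →ₗ[ℝ] Euc n := noise X x

omit [IsManifold (𝓡 n) ∞ M] in
theorem noiseCoord_apply (x : M) (e : Euc m) : noiseCoord X x e = ∑ j, e j • (X j x : Euc n) := rfl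

omit [IsManifold (𝓡 n) ∞ M] in
theorem noiseCoord_noiseProj (x : M) (e : Euc m) :
    noiseCoord X x (noiseProj X x e) = noiseCoord X x e :=
  noise_noiseProj X x e

/-- The differential of `x ↦ noiseProj X x`. -/
def noiseProjDeriv (x : M) : Euc n →L[ℝ] Euc m →L[ℝ] Euc m :=
  mfderiv (𝓡 n) 𝓘(ℝ, Euc m →L[ℝ] Euc m) (noiseProj X) x

/-- The endomorphism `v ↦ ∇̆_v Xᵏ` of `T_x M`. -/
def shape (x : M) (k : Fin m) : Euc n →L[ℝ] Euc n :=
  noiseChartDeriv X x (EuclideanSpace.single k 1 - noiseProj X x (EuclideanSpace.single k 1))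

/-- The vector `∑ⱼ dP(Xʲ) eⱼ`, where `P` is the projection onto `(ker X)ᗮ`. -/
def noiseDivergence (x : M) : Euc m :=
  ∑ j, noiseProjDeriv X x (noiseCoord X x (EuclideanSpace.single j 1)) (EuclideanSpace.single j 1)

variable (hX : ∀ j, ContMDiff (𝓡 n) (𝓡 n).tangent ∞ (fun x => (⟨x, X j x⟩ : TangentBundle (𝓡 n) M)))
  (hp : ∀ y, Module.finrank ℝ (symbolImage (𝓡 n) X y) = p)

include hX hp

/-- This is the derivative at `x` of the identity `X(y) P(y) e = X(y) e`, read in the preferred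
chart. -/
theorem noiseCoord_noiseProjDeriv (x : M) (v : Euc n) (e : Euc m) :
    noiseCoord X x (noiseProjDeriv X x v e) =
      noiseChartDeriv X x e v - noiseChartDeriv X x (noiseProj X x e) v := by
  set z₀ := extChartAt (𝓡 n) x x with hz₀
  have hxs := mem_extChartAt_source (I := 𝓡 n) x
  have hP := contMDiff_noiseProj X hX hp
  have hPd : HasFDerivAt (noiseProj X ∘ (extChartAt (𝓡 n) x).symm) (noiseProjDeriv X x) z₀ := by
    have h1 := (contDiffAt_comp_extChartAt_symm (hP x)).differentiableAt (by simp)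
    have h2 := mfderiv_eq_fderiv_chart ((hP x).mdifferentiableAt (by simp))
    rw [noiseProjDeriv, h2]
    exact h1.hasFDerivAt
  have hXd : ∀ k, HasFDerivAt (chartField x (X k)) (fderiv ℝ (chartField x (X k)) z₀) z₀ :=
    fun k => ((contDiffAt_chartField (hX k x) hxs).differentiableAt (by simp)).hasFDerivAt
  have hPe : ∀ k, HasFDerivAt
      (fun z => ((noiseProj X ∘ (extChartAt (𝓡 n) x).symm) z e) k)
      ((EuclideanSpace.proj k : Euc m →L[ℝ] ℝ).comp ((noiseProjDeriv X x).flip e)) z₀ := fun k =>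
    ((EuclideanSpace.proj k : Euc m →L[ℝ] ℝ).hasFDerivAt).comp z₀
      ((hPd.clm_apply (hasFDerivAt_const e z₀)).congr_fderiv (by ext; simp))
  have hev : (fun z => ∑ k, ((noiseProj X ∘ (extChartAt (𝓡 n) x).symm) z e) k •
      chartField x (X k) z) =ᶠ[𝓝 z₀] fun z => ∑ k, e k • chartField x (X k) z := by
    filter_upwards [extChartAt_target_mem_nhds (I := 𝓡 n) x] with z hz
    have hy := (extChartAt (𝓡 n) x).map_target hz
    rw [extChartAt_source] at hy
    simp only [Function.comp_apply, chartField]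
    rw [sum_coordField X x _ hy, sum_coordField X x _ hy, noise_noiseProj]
  have hd1 := HasFDerivAt.fun_sum (u := Finset.univ) fun k _ => (hPe k).smul (hXd k)
  have hd2 := HasFDerivAt.fun_sum (u := Finset.univ) fun k _ => (hXd k).const_smul (e k)
  have h := (hd1.congr_of_eventuallyEq hev.symm).unique hd2
  have hv := congrArg (fun L : Euc n →L[ℝ] Euc n => L v) h
  have hx0 : ∀ k, chartField x (X k) z₀ = (X k x : Euc n) := fun k => by
    rw [hz₀, chartField_apply hxs, coordField_self]
  have hx1 : (extChartAt (𝓡 n) x).symm z₀ = x := extChartAt_to_inv x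
  rw [eq_sub_iff_add_eq, noiseCoord_apply]
  simp only [sum_apply, add_apply,
    smul_apply,
    Function.comp_apply, hx1,
    Finset.sum_add_distrib, hx0] at hv
  rw [add_comm] at hv
  simp only [noiseChartDeriv_apply]
  exact hv

/-- This form shows that the shape operators take values in `E_x` and connects them with `dP`,
through which the curvature is expressed. -/
theorem shape_apply (x : M) (k : Fin m) (v : Euc n) :
    shape X x k v = noiseCoord X x (noiseProjDeriv X x v (EuclideanSpace.single k 1)) := by
  rw [noiseCoord_noiseProjDeriv X hX hp, shape, map_sub]
  rfl

/-- By the derivative of `X P = X`, the left side is `∑ (DX(e_j)(X e_j) - DX(P e_j)(X e_j))`. The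
trace identity moves `P` onto the other argument, where `X P = X` absorbs it. -/
theorem noiseCoord_noiseDivergence (x : M) : noiseCoord X x (noiseDivergence X x) = 0 := by
  rw [noiseDivergence, map_sum]
  simp only [noiseCoord_noiseProjDeriv X hX hp, Finset.sum_sub_distrib]
  rw [sub_eq_zero]
  let L : Euc m →ₗ[ℝ] Euc m →ₗ[ℝ] Euc n :=
    LinearMap.mk₂ ℝ (fun a b => noiseChartDeriv X x b (noiseCoord X x a))
      (fun a a' b => by
        rw [map_add, map_add])
      (fun c a b => by
        rw [map_smul, map_smul])
      (fun a b b' => by simp) (fun c a b => by simp)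
  have h := sum_selfAdjoint_comm L (noiseProj X x) (inner_noiseProj X x)
  simp only [L, LinearMap.mk₂_apply, noiseCoord_noiseProj] at h
  exact h

end NoiseDeriv

/-! ### The vertical part in coordinates -/

section SecondOrder

variable {E W : Type*} [NormedAddCommGroup E] [NormedSpace ℝ E] [NormedAddCommGroup W]
  [NormedSpace ℝ W]

theorem _root_.ContDiffAt.hasFDerivAt_fderiv {f : E → W} {x : E} (h : ContDiffAt ℝ ∞ f x) :
    HasFDerivAt (fderiv ℝ f) (fderiv ℝ (fderiv ℝ f) x) x :=
  ((h.fderiv_right (m := 1) one_add_one_le_infty).differentiableAt (by simp)).hasFDerivAt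

/-- The bilinear form `(B, C) ↦ D₂(ιB, ιC) + D₁(ι(BC))`. -/
def secondOrderForm (ι : (E →L[ℝ] E) →ₗ[ℝ] W) (D₂ : W →L[ℝ] W →L[ℝ] ℝ) (D₁ : W →L[ℝ] ℝ) :
    (E →L[ℝ] E) →ₗ[ℝ] (E →L[ℝ] E) →ₗ[ℝ] ℝ :=
  LinearMap.mk₂ ℝ (fun B C => D₂ (ι B) (ι C) + D₁ (ι (B.comp C)))
    (fun B B' C => by
      rw [ContinuousLinearMap.add_comp]
      simp only [map_add, add_apply]
      ring)
    (fun c B C => by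
      rw [ContinuousLinearMap.smul_comp]
      simp only [map_smul, smul_apply, smul_add])
    (fun B C C' => by
      rw [ContinuousLinearMap.comp_add]
      simp only [map_add]
      ring)
    (fun c B C => by
      rw [ContinuousLinearMap.comp_smul]
      simp only [map_smul, smul_add])

end SecondOrder

section VerticalPart

variable {n m p : ℕ} {M : Type*} [TopologicalSpace M] [ChartedSpace (EuclideanSpace ℝ (Fin n)) M]
  [IsManifold (𝓡 n) ∞ M]

/-- The point of the preferred chart of `GLM` at `u` corresponding to `u`. -/
def chartPoint (u : GLM n M) : Euc n × (Euc n →L[ℝ] Euc n) :=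
  (extChartAt (𝓡 n) (proj u) (proj u), (frameMap u : Euc n →L[ℝ] Euc n))

theorem extChartAt_eq_chartPoint (u : GLM n M) : extChartAt (modelGL n) u u = chartPoint u :=
  extChartAt_GLM_self u

theorem contDiffAt_chartFun {f : GLM n M → ℝ} (hf : ContMDiff (modelGL n) 𝓘(ℝ, ℝ) ∞ f)
    (u : GLM n M) : ContDiffAt ℝ ∞ (chartFun u f) (chartPoint u) := by
  rw [← extChartAt_eq_chartPoint]
  exact contDiffAt_comp_extChartAt_symm (hf u)

/-- Only a derivative at one point of a local coordinate expression is required. The lemma therefore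
applies to first Lie derivatives, for which no separate smoothness statement is needed. -/
theorem lieDer_eq_of_chartFun {f : GLM n M → ℝ} {u : GLM n M}
    {H : Euc n × (Euc n →L[ℝ] Euc n) → ℝ}
    {H' : Euc n × (Euc n →L[ℝ] Euc n) →L[ℝ] ℝ} (hH : HasFDerivAt H H' (chartPoint u))
    (h : chartFun u f =ᶠ[𝓝 (extChartAt (modelGL n) u u)] H)
    (V : ∀ u : GLM n M, TangentSpace (modelGL n) u) :
    lieDer (modelGL n) V f u = H' (V u) := by
  have hd : HasFDerivAt (chartFun u f) H' (chartPoint u) :=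
    hH.congr_of_eventuallyEq (by rwa [← extChartAt_eq_chartPoint])
  have hφ := contMDiffAt_extChartAt_GLM (mem_extChartAt_source (I := 𝓡 n) (proj u))
  have hdm : MDifferentiableAt 𝓘(ℝ, Euc n × (Euc n →L[ℝ] Euc n)) 𝓘(ℝ, ℝ) (chartFun u f)
      (extChartAt (modelGL n) u u) := by
    rw [extChartAt_eq_chartPoint]
    exact hd.differentiableAt.mdifferentiableAt
  have hm : MDifferentiableAt (modelGL n) 𝓘(ℝ, ℝ) f u := by
    refine MDifferentiableAt.congr_of_eventuallyEq
      (hdm.comp u (hφ.mdifferentiableAt (by simp))) ?_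
    filter_upwards [extChartAt_source_mem_nhds (I := modelGL n) u] with v hv
    rw [Function.comp_apply, chartFun, Function.comp_apply, (extChartAt (modelGL n) u).left_inv hv]
  have h1 := mfderiv_eq_fderiv_chart hm
  rw [extChartAt_eq_chartPoint] at h1
  have h2 := h1.trans hd.fderiv
  exact congrArg (fun L : Euc n × (Euc n →L[ℝ] Euc n) →L[ℝ] ℝ => L (V u)) h2

theorem lieDer_eq {f : GLM n M → ℝ} (hf : ContMDiff (modelGL n) 𝓘(ℝ, ℝ) ∞ f) (u : GLM n M)
    (V : ∀ u : GLM n M, TangentSpace (modelGL n) u) :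
    lieDer (modelGL n) V f u = fderiv ℝ (chartFun u f) (chartPoint u) (V u) :=
  lieDer_eq_of_chartFun ((contDiffAt_chartFun hf u).differentiableAt (by simp)).hasFDerivAt
    Filter.EventuallyEq.rfl V

/-- The vertical vector `uB` in fibre coordinates. -/
def vertical (u : GLM n M) : (Euc n →L[ℝ] Euc n) →ₗ[ℝ] Euc n × (Euc n →L[ℝ] Euc n) :=
  LinearMap.inr ℝ (Euc n) (Euc n →L[ℝ] Euc n) ∘ₗ
    (ContinuousLinearMap.compL ℝ (Euc n) (Euc n) (Euc n) (chartPoint u).2).toLinearMap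

theorem vertical_apply (u : GLM n M) (B : Euc n →L[ℝ] Euc n) :
    vertical u B = (0, (chartPoint u).2.comp B) := rfl

/-- The bilinear form `(B, C) ↦ D²f(uB, uC) + Df(uBC)` in fibre coordinates. -/
def fiberForm (f : GLM n M → ℝ) (u : GLM n M) :
    (Euc n →L[ℝ] Euc n) →ₗ[ℝ] (Euc n →L[ℝ] Euc n) →ₗ[ℝ] ℝ :=
  secondOrderForm (vertical u) (fderiv ℝ (fderiv ℝ (chartFun u f)) (chartPoint u))
    (fderiv ℝ (chartFun u f) (chartPoint u))

theorem fiberForm_apply (f : GLM n M → ℝ) (u : GLM n M) (B C : Euc n →L[ℝ] Euc n) :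
    fiberForm f u B C =
      fderiv ℝ (fderiv ℝ (chartFun u f)) (chartPoint u) (vertical u B) (vertical u C) +
      fderiv ℝ (chartFun u f) (chartPoint u) (vertical u (B.comp C)) := rfl

/-- The linear form `B ↦ Df(uB)` in fibre coordinates. -/
def fiberDeriv (f : GLM n M → ℝ) (u : GLM n M) : (Euc n →L[ℝ] Euc n) →ₗ[ℝ] ℝ :=
  (fderiv ℝ (chartFun u f) (chartPoint u)).toLinearMap ∘ₗ vertical u

theorem fiberDeriv_apply (f : GLM n M → ℝ) (u : GLM n M) (B : Euc n →L[ℝ] Euc n) :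
    fiberDeriv f u B = fderiv ℝ (chartFun u f) (chartPoint u) (vertical u B) := rfl

theorem lieDer_fundamental {f : GLM n M → ℝ} (hf : ContMDiff (modelGL n) 𝓘(ℝ, ℝ) ∞ f)
    (u : GLM n M) (A : Euc n →L[ℝ] Euc n) :
    lieDer (modelGL n) (fundamental A) f u = fiberDeriv f u A :=
  lieDer_eq hf u _

theorem lieDer_fundamental_fundamental {f : GLM n M → ℝ}
    (hf : ContMDiff (modelGL n) 𝓘(ℝ, ℝ) ∞ f) (u : GLM n M) (A B : Euc n →L[ℝ] Euc n) :
    lieDer (modelGL n) (fundamental A) (lieDer (modelGL n) (fundamental B) f) u =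
      fiberForm f u A B := by
  -- In coordinates `B^*` is the linear field `(y, a) ↦ (0, a ∘ B)`. Its derivative along `u A` is
  -- `u A B`, the source of the first order term of `fiberForm`.
  let R : Euc n × (Euc n →L[ℝ] Euc n) →L[ℝ] Euc n × (Euc n →L[ℝ] Euc n) :=
    (0 : _ →L[ℝ] Euc n).prod
      (((ContinuousLinearMap.compL ℝ (Euc n) (Euc n) (Euc n)).flip B).comp
        (ContinuousLinearMap.snd ℝ (Euc n) (Euc n →L[ℝ] Euc n)))
  have hH := (contDiffAt_chartFun hf u).hasFDerivAt_fderiv.clm_apply (R.hasFDerivAt (x := chartPoint u))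
  rw [lieDer_eq_of_chartFun hH (chartFun_lieDer_fundamental hf u B), fiberForm_apply, add_comm]
  rfl

variable (X : Fin m → ∀ x : M, TangentSpace (𝓡 n) x)

/-- `e ↦ ∑ₖ eₖ (Xᵏ)^GL(u)`. -/
def frameNoise (u : GLM n M) : Euc m →ₗ[ℝ] Euc n × (Euc n →L[ℝ] Euc n) :=
  (noiseCoord X (proj u)).prod
    (((ContinuousLinearMap.compL ℝ (Euc n) (Euc n) (Euc n)).flip (chartPoint u).2).toLinearMap ∘ₗ
      noiseChartDeriv X (proj u))

theorem frameNoise_apply (u : GLM n M) (e : Euc m) :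
    frameNoise X u e =
      (noiseCoord X (proj u) e, (noiseChartDeriv X (proj u) e).comp (chartPoint u).2) := rfl

variable (hX : ∀ j, ContMDiff (𝓡 n) (𝓡 n).tangent ∞ (fun x => (⟨x, X j x⟩ : TangentBundle (𝓡 n) M)))

include hX

theorem naturalLift_eq_frameNoise (u : GLM n M) (k : Fin m) :
    (naturalLift (X k) u : Euc n × (Euc n →L[ℝ] Euc n)) =
      frameNoise X u (EuclideanSpace.single k 1) := by
  rw [naturalLift_eq u (hX k _), chartField_apply (mem_extChartAt_source _), coordField_self,
    frameNoise_apply, noiseChartDeriv_single]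
  refine Prod.ext ?_ rfl
  exact (noise_single X (proj u) k).symm

/-- `Tπ` sends `(X^k)^GL` to `X^k`, so the lift has coefficients `½ a(X^k)`. By
`symbolCoeff_epsilon` these are the components of `P e_j`, whichever covector `a` was chosen. -/
theorem horLift_eq_frameNoise (u : GLM n M) (j : Fin m) :
    (horLift X u (X j (proj u)) : Euc n × (Euc n →L[ℝ] Euc n)) =
      frameNoise X u (noiseProj X (proj u) (EuclideanSpace.single j 1)) := by
  rw [← symbolCoeff_epsilon]
  set a : TangentSpace (𝓡 n) (proj u) →L[ℝ] ℝ :=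
    Classical.epsilon fun a => symbol (𝓡 n) X (proj u) a = X j (proj u) with ha
  have h1 : (horLift X u (X j (proj u)) : Euc n × (Euc n →L[ℝ] Euc n)) =
      (1 / 2 : ℝ) • ∑ k, a (X k (proj u)) •
        (naturalLift (X k) u : Euc n × (Euc n →L[ℝ] Euc n)) := by
    change (1 / 2 : ℝ) • ∑ k, a (mfderiv (modelGL n) (𝓡 n) (proj : GLM n M → M) u
      (naturalLift (X k) u)) • (naturalLift (X k) u : Euc n × (Euc n →L[ℝ] Euc n)) = _
    congr 1
    refine Finset.sum_congr rfl fun k _ => ?_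
    exact congrArg (fun v => a v • (naturalLift (X k) u : Euc n × (Euc n →L[ℝ] Euc n)))
      (mfderiv_proj_apply u (naturalLift (X k) u))
  have h2 : symbolCoeff X (proj u) a =
      ∑ k, ((1 / 2 : ℝ) * a (X k (proj u))) • EuclideanSpace.single k (1 : ℝ) := by
    ext i
    simp [symbolCoeff, Finset.sum_apply, Pi.single_apply]
  rw [h1, h2, map_sum, Finset.smul_sum]
  refine Finset.sum_congr rfl fun k _ => ?_
  rw [map_smul, ← naturalLift_eq_frameNoise X hX]
  exact (mul_smul _ _ (naturalLift (X k) u : Euc n × (Euc n →L[ℝ] Euc n))).symm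

theorem lieDer_horLift {f : GLM n M → ℝ} (hf : ContMDiff (modelGL n) 𝓘(ℝ, ℝ) ∞ f)
    (u : GLM n M) (j : Fin m) :
    lieDer (modelGL n) (fun u => horLift X u (X j (proj u))) f u =
      ∑ k, noiseProj X (proj u) (EuclideanSpace.single j 1) k *
        lieDer (modelGL n) (naturalLift (X k)) f u := by
  have hdec : ∀ a : Euc m, a = ∑ j, a j • EuclideanSpace.single j (1 : ℝ) := fun a => by
    ext i; simp [Finset.sum_apply, Pi.single_apply]
  rw [lieDer_eq hf, horLift_eq_frameNoise X hX]
  conv_lhs => rw [hdec (noiseProj X (proj u) (EuclideanSpace.single j 1))]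
  rw [map_sum, map_sum]
  refine Finset.sum_congr rfl fun k _ => ?_
  rw [map_smul, map_smul, ← naturalLift_eq_frameNoise X hX, lieDer_eq hf]
  rfl

end VerticalPart

/-! ### The vertical part as a sum of squares with drift. -/

section VerticalFormula

variable {n m p : ℕ} {M : Type*} [TopologicalSpace M] [ChartedSpace (EuclideanSpace ℝ (Fin n)) M]
  [IsManifold (𝓡 n) ∞ M]

theorem isInvertible_chartPoint (u : GLM n M) : (chartPoint u).2.IsInvertible := u.2

/-- The endomorphism `B` of `T_x M` read in the frame `u`. -/
def frameConj (u : GLM n M) (B : Euc n →L[ℝ] Euc n) : Euc n →L[ℝ] Euc n :=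
  (chartPoint u).2.inverse.comp (B.comp (chartPoint u).2)

theorem frame_comp_frameConj (u : GLM n M) (B : Euc n →L[ℝ] Euc n) :
    (chartPoint u).2.comp (frameConj u B) = B.comp (chartPoint u).2 := by
  obtain ⟨g, hg⟩ := isInvertible_chartPoint u
  rw [frameConj, ← hg]
  ext v
  simp

theorem frame_comp_frameConj_comp (u : GLM n M) (B C : Euc n →L[ℝ] Euc n) :
    (chartPoint u).2.comp ((frameConj u B).comp C) = B.comp ((chartPoint u).2.comp C) := by
  rw [← ContinuousLinearMap.comp_assoc, frame_comp_frameConj, ContinuousLinearMap.comp_assoc]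

/-- The lift of a vector field to `GLM`, in coordinates. -/
def liftCoord (Z : Euc n → Euc n) (q : Euc n × (Euc n →L[ℝ] Euc n)) :
    Euc n × (Euc n →L[ℝ] Euc n) :=
  (Z q.1, (fderiv ℝ Z q.1).comp q.2)

variable (X : Fin m → ∀ x : M, TangentSpace (𝓡 n) x)

/-- The derivative at `u`, in coordinates, of `(Xᵏ)^GL f`. -/
def liftDeriv (f : GLM n M → ℝ) (u : GLM n M) (k : Fin m) :
    Euc n × (Euc n →L[ℝ] Euc n) →L[ℝ] ℝ :=
  fderiv ℝ (fun q => fderiv ℝ (chartFun u f) q (liftCoord (chartField (proj u) (X k)) q))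
    (chartPoint u)

/-- `(e', e) ↦ ∑ e'ⱼ eₖ (Xʲ)^GL (Xᵏ)^GL f(u)`. -/
def liftForm (f : GLM n M → ℝ) (u : GLM n M) : Euc m →ₗ[ℝ] Euc m →ₗ[ℝ] ℝ :=
  ∑ k, ((liftDeriv X f u k).toLinearMap ∘ₗ frameNoise X u).smulRight
    (EuclideanSpace.proj k : Euc m →L[ℝ] ℝ).toLinearMap

theorem liftForm_apply (f : GLM n M → ℝ) (u : GLM n M) (e e' : Euc m) :
    liftForm X f u e e' = ∑ k, liftDeriv X f u k (frameNoise X u e) * e' k := by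
  simp only [liftForm, LinearMap.sum_apply, LinearMap.smulRight_apply, LinearMap.smul_apply]
  rfl

theorem euclidean_decomp (a : Euc m) : a = ∑ j, a j • EuclideanSpace.single j (1 : ℝ) := by
  ext i; simp [Finset.sum_apply, Pi.single_apply]

variable (hX : ∀ j, ContMDiff (𝓡 n) (𝓡 n).tangent ∞ (fun x => (⟨x, X j x⟩ : TangentBundle (𝓡 n) M)))

include hX

theorem contDiffAt_chartField_self (u : GLM n M) (k : Fin m) :
    ContDiffAt ℝ ∞ (chartField (proj u) (X k)) (chartPoint u).1 :=
  contDiffAt_chartField (hX k _) (mem_extChartAt_source _)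

theorem liftCoord_chartPoint (u : GLM n M) (k : Fin m) :
    liftCoord (chartField (proj u) (X k)) (chartPoint u) =
      frameNoise X u (EuclideanSpace.single k 1) := by
  rw [← naturalLift_eq_frameNoise X hX, naturalLift_eq u (hX k _)]
  rfl

theorem hasFDerivAt_lift {f : GLM n M → ℝ} (hf : ContMDiff (modelGL n) 𝓘(ℝ, ℝ) ∞ f)
    (u : GLM n M) (k : Fin m) :
    HasFDerivAt (fun q => fderiv ℝ (chartFun u f) q (liftCoord (chartField (proj u) (X k)) q))
      (liftDeriv X f u k) (chartPoint u) := by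
  have h := (differentiableAt_frame_transition (contDiffAt_chartField_self X hX u k)
    (chartPoint u).2).hasFDerivAt
  exact ((contDiffAt_chartFun hf u).hasFDerivAt_fderiv.clm_apply h).differentiableAt.hasFDerivAt

/-- A vertical displacement fixes the base point, so `X^k` and `DX^k` stay frozen and no second
derivative of `X^k` appears. -/
theorem liftDeriv_vertical {f : GLM n M → ℝ} (hf : ContMDiff (modelGL n) 𝓘(ℝ, ℝ) ∞ f)
    (u : GLM n M) (k : Fin m) (B : Euc n →L[ℝ] Euc n) :
    liftDeriv X f u k (vertical u B) =
      fderiv ℝ (fderiv ℝ (chartFun u f)) (chartPoint u) (vertical u B)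
        (frameNoise X u (EuclideanSpace.single k 1)) +
      fderiv ℝ (chartFun u f) (chartPoint u)
        (0, (noiseChartDeriv X (proj u) (EuclideanSpace.single k 1)).comp
          ((chartPoint u).2.comp B)) := by
  have h := (differentiableAt_frame_transition (contDiffAt_chartField_self X hX u k)
    (chartPoint u).2).hasFDerivAt
  have h1 := ((contDiffAt_chartFun hf u).hasFDerivAt_fderiv.clm_apply h).fderiv
  have h2 := fderiv_frame_transition_vertical (contDiffAt_chartField_self X hX u k)
    (chartPoint u).2 ((chartPoint u).2.comp B)
  rw [← liftCoord_chartPoint X hX, add_comm, noiseChartDeriv_single]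
  refine (congrArg (fun L : Euc n × (Euc n →L[ℝ] Euc n) →L[ℝ] ℝ => L (vertical u B)) h1).trans ?_
  exact congrArg₂ (· + ·) (congrArg (fderiv ℝ (chartFun u f) (chartPoint u)) h2) rfl

theorem derivGenerator_eq {f : GLM n M → ℝ} (hf : ContMDiff (modelGL n) 𝓘(ℝ, ℝ) ∞ f)
    (u : GLM n M) :
    derivGenerator X f u = (1 / 2 : ℝ) * ∑ j, liftForm X f u
      (EuclideanSpace.single j 1) (EuclideanSpace.single j 1) := by
  rw [derivGenerator, hormander]
  congr 1
  refine Finset.sum_congr rfl fun j _ => ?_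
  have h1 : lieDer (modelGL n) (naturalLift (X j)) (lieDer (modelGL n) (naturalLift (X j)) f) u =
      liftDeriv X f u j (naturalLift (X j) u) :=
    lieDer_eq_of_chartFun (hasFDerivAt_lift X hX hf u j)
      (chartFun_lieDer_naturalLift hf u (hX j)) _
  rw [liftForm_apply, Finset.sum_eq_single j]
  · rw [h1, ← naturalLift_eq_frameNoise X hX]
    simp
  · intro k _ hk
    simp [hk]
  · simp

variable (hp : ∀ y, Module.finrank ℝ (symbolImage (𝓡 n) X y) = p)

include hp

theorem hasFDerivAt_noiseProj (x : M) :
    HasFDerivAt (noiseProj X ∘ (extChartAt (𝓡 n) x).symm) (noiseProjDeriv X x)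
      (extChartAt (𝓡 n) x x) := by
  have hP := contMDiff_noiseProj X hX hp
  have h1 := (contDiffAt_comp_extChartAt_symm (hP x)).differentiableAt (by simp)
  have h2 := mfderiv_eq_fderiv_chart ((hP x).mdifferentiableAt (by simp))
  rw [noiseProjDeriv, h2]
  exact h1.hasFDerivAt

/-- This is the product rule for `X̄^j = ∑ (P e_j)_k (X^k)^GL`. The last term comes from
differentiating the coefficients `P e_j`, which depend only on the base point, along `X^j`. -/
theorem lieDer_horLift_horLift {f : GLM n M → ℝ} (hf : ContMDiff (modelGL n) 𝓘(ℝ, ℝ) ∞ f)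
    (u : GLM n M) (j : Fin m) :
    lieDer (modelGL n) (fun u => horLift X u (X j (proj u)))
        (lieDer (modelGL n) (fun u => horLift X u (X j (proj u))) f) u =
      liftForm X f u (noiseProj X (proj u) (EuclideanSpace.single j 1))
        (noiseProj X (proj u) (EuclideanSpace.single j 1)) +
      fderiv ℝ (chartFun u f) (chartPoint u) (frameNoise X u
        (noiseProjDeriv X (proj u) (noiseCoord X (proj u) (EuclideanSpace.single j 1))
          (EuclideanSpace.single j 1))) := by
  have hev : chartFun u (lieDer (modelGL n) (fun u => horLift X u (X j (proj u))) f)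
      =ᶠ[𝓝 (extChartAt (modelGL n) u u)] fun q =>
      ∑ k, ((noiseProj X ∘ (extChartAt (𝓡 n) (proj u)).symm) q.1 (EuclideanSpace.single j 1)) k *
        fderiv ℝ (chartFun u f) q (liftCoord (chartField (proj u) (X k)) q) := by
    filter_upwards [extChartAt_target_mem_nhds (I := modelGL n) u,
      Filter.eventually_all.2 fun k => chartFun_lieDer_naturalLift hf u (hX k)] with q hq hk
    rw [chartFun, Function.comp_apply, lieDer_horLift X hX hf]
    have hs := (extChartAt (modelGL n) u).map_target hq
    have hr := (extChartAt (modelGL n) u).right_inv hq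
    rw [mem_extChartAt_source_GLM] at hs
    rw [extChartAt_GLM] at hr
    have h1 := congrArg Prod.fst hr
    dsimp only at h1
    rw [Function.comp_apply, ← h1, (extChartAt (𝓡 n) (proj u)).left_inv hs]
    refine Finset.sum_congr rfl fun k _ => ?_
    exact congrArg _ (hk k)
  have hd := HasFDerivAt.fun_sum (u := Finset.univ) fun k _ =>
    (((EuclideanSpace.proj k : Euc m →L[ℝ] ℝ).hasFDerivAt.comp (chartPoint u)
      (((hasFDerivAt_noiseProj X hX hp (proj u)).comp (chartPoint u)
        (hasFDerivAt_fst (p := chartPoint u))).clm_apply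
        (hasFDerivAt_const (EuclideanSpace.single j (1 : ℝ)) (chartPoint u)))).mul
      (hasFDerivAt_lift X hX hf u k))
  rw [lieDer_eq_of_chartFun hd hev, horLift_eq_frameNoise X hX, liftForm_apply]
  have hx : (noiseProj X ∘ (extChartAt (𝓡 n) (proj u)).symm) (chartPoint u).1 =
      noiseProj X (proj u) := congrArg (noiseProj X) (extChartAt_to_inv (proj u))
  conv_rhs =>
    arg 2
    rw [euclidean_decomp (noiseProjDeriv X (proj u)
      (noiseCoord X (proj u) (EuclideanSpace.single j 1)) (EuclideanSpace.single j 1))]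
    rw [map_sum, map_sum]
  rw [sum_apply, ← Finset.sum_add_distrib]
  refine Finset.sum_congr rfl fun k _ => ?_
  rw [map_smul, map_smul, ← liftCoord_chartPoint X hX, ContinuousLinearMap.comp_zero, zero_add]
  -- The base component of the horizontal lift is `X P e_j = X e_j`, the direction in which `P` is
  -- differentiated.
  have h1 : (frameNoise X u (noiseProj X (proj u) (EuclideanSpace.single j 1))).1 =
      noiseCoord X (proj u) (EuclideanSpace.single j 1) := noiseCoord_noiseProj _ _ _
  set F := frameNoise X u (noiseProj X (proj u) (EuclideanSpace.single j 1))
  rw [← h1]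
  have h2 := congrArg (fun Q : Euc m →L[ℝ] Euc m => (Q (EuclideanSpace.single j 1)) k) hx
  have h3 := congrArg (· * liftDeriv X f u k F) h2
  rw [mul_comm (liftDeriv X f u k F)]
  refine congrArg₂ (· + ·) h3 ?_
  exact mul_comm _ _

omit hX hp in
theorem frameNoise_shape (u : GLM n M) (k : Fin m) :
    frameNoise X u (EuclideanSpace.single k 1 -
      noiseProj X (proj u) (EuclideanSpace.single k 1)) =
      vertical u (frameConj u (shape X (proj u) k)) := by
  rw [vertical_apply, frame_comp_frameConj, frameNoise_apply, map_sub, noiseCoord_noiseProj,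
    sub_self]
  rfl

/-- The generator is half the trace of `liftForm`. The horizontal part is half its trace over the
vectors `P e_j`, plus half the derivative along `F_u(d)`. The difference of traces is the trace over
`(1 - P) e_j`, where `F_u` is vertical. The drift is also vertical because `X d = 0`. -/
theorem verticalPart_eq {f : GLM n M → ℝ} (hf : ContMDiff (modelGL n) 𝓘(ℝ, ℝ) ∞ f)
    (u : GLM n M) :
    verticalPart X f u =
      (1 / 2 : ℝ) * ∑ k, fiberForm f u (frameConj u (shape X (proj u) k))
        (frameConj u (shape X (proj u) k)) -
      (1 / 2 : ℝ) * fiberDeriv f u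
        (frameConj u (noiseChartDeriv X (proj u) (noiseDivergence X (proj u)))) := by
  set P := noiseProj X (proj u) with hP
  have hhor : horizontalPart X f u = (1 / 2 : ℝ) * ∑ j, (liftForm X f u
      (P (EuclideanSpace.single j 1)) (P (EuclideanSpace.single j 1)) +
      fderiv ℝ (chartFun u f) (chartPoint u) (frameNoise X u
        (noiseProjDeriv X (proj u) (noiseCoord X (proj u) (EuclideanSpace.single j 1))
          (EuclideanSpace.single j 1)))) := by
    rw [horizontalPart, hormander]
    congr 1
    exact Finset.sum_congr rfl fun j _ => lieDer_horLift_horLift X hX hp hf u j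
  have hdrift : ∑ j, fderiv ℝ (chartFun u f) (chartPoint u) (frameNoise X u
        (noiseProjDeriv X (proj u) (noiseCoord X (proj u) (EuclideanSpace.single j 1))
          (EuclideanSpace.single j 1))) =
      fiberDeriv f u
        (frameConj u (noiseChartDeriv X (proj u) (noiseDivergence X (proj u)))) := by
    rw [← map_sum, ← map_sum, ← noiseDivergence, fiberDeriv_apply, vertical_apply,
      frame_comp_frameConj, frameNoise_apply, noiseCoord_noiseDivergence X hX hp]
  -- the cross terms vanish
  have hPQ : ∑ j, liftForm X f u (EuclideanSpace.single j 1) (EuclideanSpace.single j 1) =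
      ∑ j, liftForm X f u (P (EuclideanSpace.single j 1)) (P (EuclideanSpace.single j 1)) +
      ∑ j, liftForm X f u (EuclideanSpace.single j 1 - P (EuclideanSpace.single j 1))
        (EuclideanSpace.single j 1 - P (EuclideanSpace.single j 1)) := by
    have h1 := sum_selfAdjoint_comm (liftForm X f u) P (inner_noiseProj X _)
    -- For the form `L(·, P ·)` the trace identity reads `∑ L(P e_j, P e_j) = ∑ L(e_j, P e_j)`, by
    -- idempotence of `P`.
    have h2 := sum_selfAdjoint_comm ((liftForm X f u).compl₂ P.toLinearMap) P (inner_noiseProj X _)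
    simp only [LinearMap.compl₂_apply, ContinuousLinearMap.coe_coe, hP, noiseProj_noiseProj] at h2
    rw [← hP] at h2
    simp only [map_sub, LinearMap.sub_apply, Finset.sum_sub_distrib]
    rw [h2, ← h1]
    ring
  have hQ : ∀ k, liftForm X f u (EuclideanSpace.single k 1 - P (EuclideanSpace.single k 1))
      (EuclideanSpace.single k 1 - P (EuclideanSpace.single k 1)) =
      fiberForm f u (frameConj u (shape X (proj u) k)) (frameConj u (shape X (proj u) k)) := by
    intro k
    rw [liftForm_apply, frameNoise_shape X, fiberForm_apply]
    set e := EuclideanSpace.single k 1 - P (EuclideanSpace.single k 1) with he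
    set C := frameConj u (shape X (proj u) k) with hC
    have h1 : vertical u C = frameNoise X u e := (frameNoise_shape X u k).symm
    -- For `e = (1 - P) e_k` one has `DX(e) ∘ u = u ∘ C`. The first order terms `DX(e_i) ∘ u ∘ C`,
    -- weighted by the components of `e`, therefore add up to `u ∘ C ∘ C`.
    let N : Euc m →ₗ[ℝ] Euc n × (Euc n →L[ℝ] Euc n) :=
      LinearMap.prod 0
        (((ContinuousLinearMap.compL ℝ (Euc n) (Euc n) (Euc n)).flip
          ((chartPoint u).2.comp C)).toLinearMap ∘ₗ noiseChartDeriv X (proj u))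
    have h2 : vertical u (C.comp C) = N e := by
      rw [vertical_apply, hC, frame_comp_frameConj_comp]
      rfl
    have h3 : ∀ i, liftDeriv X f u i (vertical u C) =
        fderiv ℝ (fderiv ℝ (chartFun u f)) (chartPoint u) (vertical u C)
          (frameNoise X u (EuclideanSpace.single i 1)) +
        fderiv ℝ (chartFun u f) (chartPoint u) (N (EuclideanSpace.single i 1)) :=
      fun i => liftDeriv_vertical X hX hf u i C
    have h4 : fderiv ℝ (fderiv ℝ (chartFun u f)) (chartPoint u) (vertical u C) (vertical u C) =
        ∑ i, e i * fderiv ℝ (fderiv ℝ (chartFun u f)) (chartPoint u) (vertical u C)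
          (frameNoise X u (EuclideanSpace.single i 1)) := by
      conv_lhs =>
        arg 2
        rw [h1, euclidean_decomp e, map_sum]
      rw [map_sum]
      exact Finset.sum_congr rfl fun i _ => by rw [map_smul, map_smul]; rfl
    have h5 : fderiv ℝ (chartFun u f) (chartPoint u) (vertical u (C.comp C)) =
        ∑ i, e i * fderiv ℝ (chartFun u f) (chartPoint u) (N (EuclideanSpace.single i 1)) := by
      rw [h2]
      conv_lhs => rw [euclidean_decomp e, map_sum, map_sum]
      exact Finset.sum_congr rfl fun i _ => by rw [map_smul, map_smul]; rfl
    rw [h4, h5, ← Finset.sum_add_distrib]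
    refine Finset.sum_congr rfl fun i _ => ?_
    rw [h3]
    ring
  rw [verticalPart, derivGenerator_eq X hX hf, hhor, hPQ, Finset.sum_add_distrib, hdrift]
  simp only [hQ]
  ring

end VerticalFormula

/-! ### Existence and uniqueness of the representation of the vertical part -/

section QuadraticTest

variable {W : Type*} [NormedAddCommGroup W] [NormedSpace ℝ W]

theorem fderiv_of_eventuallyEq_sub {f : W → ℝ} {q₀ : W} {L : W →L[ℝ] ℝ}
    (h : f =ᶠ[𝓝 q₀] fun q => L (q - q₀)) :
    fderiv ℝ f q₀ = L ∧ fderiv ℝ (fderiv ℝ f) q₀ = 0 := by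
  have h1 : fderiv ℝ f =ᶠ[𝓝 q₀] fun _ => L := by
    refine h.fderiv.trans (Filter.Eventually.of_forall fun q => ?_)
    exact (L.hasFDerivAt.comp q ((hasFDerivAt_id q).sub_const q₀)).fderiv
  exact ⟨h1.eq_of_nhds, by rw [h1.fderiv_eq, fderiv_const_apply]⟩

theorem fderiv_of_eventuallyEq_sub_mul_sub {f : W → ℝ} {q₀ : W} {L L' : W →L[ℝ] ℝ}
    (h : f =ᶠ[𝓝 q₀] fun q => L (q - q₀) * L' (q - q₀)) :
    fderiv ℝ f q₀ = 0 ∧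
      ∀ v w, fderiv ℝ (fderiv ℝ f) q₀ v w = L v * L' w + L' v * L w := by
  have hd : ∀ (L : W →L[ℝ] ℝ) (q : W), HasFDerivAt (fun q => L (q - q₀)) L q := fun L q =>
    L.hasFDerivAt.comp q ((hasFDerivAt_id q).sub_const q₀)
  have h1 : fderiv ℝ f =ᶠ[𝓝 q₀] fun q => L (q - q₀) • L' + L' (q - q₀) • L := by
    refine h.fderiv.trans (Filter.Eventually.of_forall fun q => ?_)
    exact ((hd L q).mul (hd L' q)).fderiv
  refine ⟨by rw [h1.eq_of_nhds]; simp, fun v w => ?_⟩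
  rw [h1.fderiv_eq, (((hd L q₀).smul_const L').fun_add ((hd L' q₀).smul_const L)).fderiv]
  simp

end QuadraticTest

section Representation

variable {n m p : ℕ} {M : Type*} [TopologicalSpace M] [ChartedSpace (EuclideanSpace ℝ (Fin n)) M]
  [IsManifold (𝓡 n) ∞ M]

/-- A bump function on `M` pulled back by `proj` suffices as a cutoff: the chart domains of `GLM`
are full preimages of chart domains of `M`, so none is needed along the fibres. -/
theorem exists_contMDiff_chartFun_eventuallyEq [T2Space M] (u : GLM n M)
    {H : Euc n × (Euc n →L[ℝ] Euc n) → ℝ} (hH : ContDiff ℝ ∞ H) :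
    ∃ f : GLM n M → ℝ, ContMDiff (modelGL n) 𝓘(ℝ, ℝ) ∞ f ∧
      chartFun u f =ᶠ[𝓝 (chartPoint u)] H := by
  obtain ⟨ρ⟩ : Nonempty (SmoothBumpFunction (𝓡 n) (proj u)) := inferInstance
  let g : GLM n M → ℝ := fun v => ρ (proj v) * H (extChartAt (modelGL n) u v)
  refine ⟨g, fun v => ?_, ?_⟩
  · by_cases hv : proj v ∈ tsupport ρ
    · have h1 : proj v ∈ (extChartAt (𝓡 n) (proj u)).source :=
        ρ.tsupport_subset_extChartAt_source hv
      exact ((ρ.contMDiff.comp contMDiff_proj).contMDiffAt (x := v)).mul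
        (hH.contMDiff.contMDiffAt.comp v (contMDiffAt_extChartAt_GLM h1))
    · have h1 : g =ᶠ[𝓝 v] fun _ => 0 := by
        have h2 : ∀ᶠ w : GLM n M in 𝓝 v, proj w ∈ (tsupport ρ)ᶜ :=
          contMDiff_proj.continuous.continuousAt.eventually
            ((isClosed_tsupport ρ).isOpen_compl.mem_nhds hv)
        filter_upwards [h2] with w hw
        change ρ (proj w) * _ = 0
        rw [image_eq_zero_of_notMem_tsupport hw, zero_mul]
      exact contMDiffAt_const.congr_of_eventuallyEq h1
  · rw [← extChartAt_eq_chartPoint]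
    have h1 : ∀ᶠ q in 𝓝 (extChartAt (modelGL n) u u),
        ρ (proj ((extChartAt (modelGL n) u).symm q)) = 1 := by
      have hc : ContinuousAt (fun q => proj ((extChartAt (modelGL n) u).symm q))
          (extChartAt (modelGL n) u u) :=
        contMDiff_proj.continuous.continuousAt.comp (continuousAt_extChartAt_symm u)
      refine hc.eventually (p := fun x => ρ x = 1) ?_
      dsimp only
      rw [extChartAt_to_inv]
      exact ρ.eventuallyEq_one
    filter_upwards [h1, extChartAt_target_mem_nhds (I := modelGL n) u] with q hq hqt
    change ρ _ * H (extChartAt (modelGL n) u ((extChartAt (modelGL n) u).symm q)) = H q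
    rw [hq, one_mul, (extChartAt (modelGL n) u).right_inv hqt]

/-- The linear form `(v, B) ↦ ℓ(u⁻¹B)` in fibre coordinates. -/
def fiberLinear (u : GLM n M) (ℓ : (Euc n →L[ℝ] Euc n) →ₗ[ℝ] ℝ) :
    Euc n × (Euc n →L[ℝ] Euc n) →L[ℝ] ℝ :=
  (LinearMap.toContinuousLinearMap ℓ).comp
    ((ContinuousLinearMap.compL ℝ (Euc n) (Euc n) (Euc n) (chartPoint u).2.inverse).comp
      (ContinuousLinearMap.snd ℝ (Euc n) (Euc n →L[ℝ] Euc n)))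

theorem fiberLinear_vertical (u : GLM n M) (ℓ : (Euc n →L[ℝ] Euc n) →ₗ[ℝ] ℝ)
    (B : Euc n →L[ℝ] Euc n) : fiberLinear u ℓ (vertical u B) = ℓ B := by
  change ℓ ((chartPoint u).2.inverse.comp ((chartPoint u).2.comp B)) = ℓ B
  congr 1
  obtain ⟨g, hg⟩ := isInvertible_chartPoint u
  rw [← hg]
  ext v
  simp

theorem exists_fiberDeriv_eq [T2Space M] (u : GLM n M) (ℓ : (Euc n →L[ℝ] Euc n) →ₗ[ℝ] ℝ) :
    ∃ f : GLM n M → ℝ, ContMDiff (modelGL n) 𝓘(ℝ, ℝ) ∞ f ∧ ∀ B, fiberDeriv f u B = ℓ B := by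
  set L := fiberLinear u ℓ
  obtain ⟨f, hf, h⟩ := exists_contMDiff_chartFun_eventuallyEq u
    (H := fun q => L (q - chartPoint u)) (L.contDiff.comp (contDiff_id.sub contDiff_const))
  refine ⟨f, hf, fun B => ?_⟩
  rw [fiberDeriv_apply, (fderiv_of_eventuallyEq_sub h).1, fiberLinear_vertical]

/-- A product of two linear functions vanishing at the point has zero first derivative there, so
only the second derivative, the symmetrised product, survives. -/
theorem exists_fiberForm_eq [T2Space M] (u : GLM n M)
    (ℓ ℓ' : (Euc n →L[ℝ] Euc n) →ₗ[ℝ] ℝ) :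
    ∃ f : GLM n M → ℝ, ContMDiff (modelGL n) 𝓘(ℝ, ℝ) ∞ f ∧ (∀ B, fiberDeriv f u B = 0) ∧
      ∀ B C, fiberForm f u B C = ℓ B * ℓ' C + ℓ' B * ℓ C := by
  set L := fiberLinear u ℓ with hL
  set L' := fiberLinear u ℓ' with hL'
  obtain ⟨f, hf, h⟩ := exists_contMDiff_chartFun_eventuallyEq u
    (H := fun q => L (q - chartPoint u) * L' (q - chartPoint u))
    ((L.contDiff.comp (contDiff_id.sub contDiff_const)).mul
      (L'.contDiff.comp (contDiff_id.sub contDiff_const)))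
  obtain ⟨h1, h2⟩ := fderiv_of_eventuallyEq_sub_mul_sub h
  refine ⟨f, hf, fun B => ?_, fun B C => ?_⟩
  · rw [fiberDeriv_apply, h1, zero_apply]
  · rw [fiberForm_apply, h1, h2, zero_apply, add_zero, hL, hL']
    simp only [fiberLinear_vertical]

variable {κ : Type*} [Fintype κ] (A : Module.Basis κ ℝ (Euc n →L[ℝ] Euc n))

/-- A quadratic test function built from the coordinates `i` and `j` sees no first order term and
returns `a i j + a j i`, which determines a symmetric `a`. Once the second order parts agree, linear
test functions read off `b`. -/
theorem repr_unique_of_symm [T2Space M] (u : GLM n M) {a a' : Matrix κ κ ℝ} {b b' : κ → ℝ}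
    (ha : a.IsHermitian) (ha' : a'.IsHermitian)
    (h : ∀ f : GLM n M → ℝ, ContMDiff (modelGL n) 𝓘(ℝ, ℝ) ∞ f →
      ∑ i, ∑ j, a i j * fiberForm f u (A i) (A j) + ∑ k, b k * fiberDeriv f u (A k) =
      ∑ i, ∑ j, a' i j * fiberForm f u (A i) (A j) + ∑ k, b' k * fiberDeriv f u (A k)) :
    a = a' ∧ b = b' := by
  classical
  have hsum : ∀ (c : Matrix κ κ ℝ) (i j : κ), c.IsHermitian →
      ∑ r, ∑ s, c r s * (A.coord i (A r) * A.coord j (A s) + A.coord j (A r) * A.coord i (A s)) =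
        2 * c i j := by
    intro c i j hc
    have hji : c j i = c i j := by simpa using hc.apply i j
    simp only [Module.Basis.coord_apply, Module.Basis.repr_self, Finsupp.single_apply, mul_add,
      Finset.sum_add_distrib, mul_ite, mul_one, mul_zero, Finset.sum_ite_eq', Finset.mem_univ, if_true]
    rw [hji]
    ring
  have h1 : a = a' := by
    ext i j
    obtain ⟨f, hf, hf1, hf2⟩ := exists_fiberForm_eq u (A.coord i) (A.coord j)
    have h2 := h f hf
    simp only [hf1, hf2, mul_zero, Finset.sum_const_zero, add_zero] at h2
    rw [hsum a i j ha, hsum a' i j ha'] at h2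
    linarith
  subst h1
  refine ⟨rfl, funext fun i => ?_⟩
  obtain ⟨f, hf, hf1⟩ := exists_fiberDeriv_eq u (A.coord i)
  have h2 := add_left_cancel (h f hf)
  simpa [hf1, Finsupp.single_apply] using h2

theorem bilin_eq_sum_repr {V : Type*} [AddCommGroup V] [Module ℝ V] (A : Module.Basis κ ℝ V)
    {F : Type*} [AddCommGroup F] [Module ℝ F] (T : V →ₗ[ℝ] V →ₗ[ℝ] F) (B C : V) :
    T B C = ∑ i, ∑ j, (A.repr B i * A.repr C j) • T (A i) (A j) := by
  conv_lhs => rw [← A.sum_repr B, ← A.sum_repr C]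
  rw [map_sum T, LinearMap.sum_apply]
  simp only [map_sum, map_smul, LinearMap.smul_apply]
  exact Finset.sum_congr rfl fun i _ => Finset.sum_congr rfl fun j _ => by
    rw [smul_smul, mul_comm]

variable (X : Fin m → ∀ x : M, TangentSpace (𝓡 n) x)

/-- The drift of the vertical part, read in the frame `u`. -/
def verticalDrift (u : GLM n M) : Euc n →L[ℝ] Euc n :=
  (-(1 / 2) : ℝ) • frameConj u (noiseChartDeriv X (proj u) (noiseDivergence X (proj u)))

/-- The second order coefficients of the vertical part. -/
def verticalAlpha (u : GLM n M) : Matrix κ κ ℝ := fun i j =>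
  (1 / 2 : ℝ) * ∑ k, A.repr (frameConj u (shape X (proj u) k)) i *
    A.repr (frameConj u (shape X (proj u) k)) j

/-- The first order coefficients of the vertical part. -/
def verticalBeta (u : GLM n M) : κ → ℝ := fun k => A.repr (verticalDrift X u) k

theorem posSemidef_verticalAlpha (u : GLM n M) : (verticalAlpha A X u).PosSemidef := by
  let Y : Matrix κ (Fin m) ℝ := fun i k => A.repr (frameConj u (shape X (proj u) k)) i
  have h : verticalAlpha A X u = (1 / 2 : ℝ) • (Y * Y.conjTranspose) := by
    ext i j
    rw [Matrix.smul_apply, Matrix.mul_apply]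
    rfl
  rw [h]
  exact (Matrix.posSemidef_self_mul_conjTranspose Y).smul (by norm_num)

theorem sum_verticalAlpha_smul {F : Type*} [AddCommGroup F] [Module ℝ F] (u : GLM n M)
    (T : (Euc n →L[ℝ] Euc n) →ₗ[ℝ] (Euc n →L[ℝ] Euc n) →ₗ[ℝ] F) :
    ∑ i, ∑ j, verticalAlpha A X u i j • T (A i) (A j) =
      (1 / 2 : ℝ) • ∑ k, T (frameConj u (shape X (proj u) k))
        (frameConj u (shape X (proj u) k)) := by
  simp only [verticalAlpha, mul_smul, Finset.sum_smul, bilin_eq_sum_repr A T (frameConj _ _),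
    ← Finset.smul_sum]
  rw [Finset.sum_comm_cycle]
  simp only [Finset.smul_sum]

theorem sum_verticalBeta_smul {F : Type*} [AddCommGroup F] [Module ℝ F] (u : GLM n M)
    (T : (Euc n →L[ℝ] Euc n) →ₗ[ℝ] F) :
    ∑ k, verticalBeta A X u k • T (A k) = T (verticalDrift X u) := by
  conv_rhs => rw [← A.sum_repr (verticalDrift X u), map_sum]
  exact Finset.sum_congr rfl fun k _ => by rw [map_smul]; rfl

variable (hX : ∀ j, ContMDiff (𝓡 n) (𝓡 n).tangent ∞ (fun x => (⟨x, X j x⟩ : TangentBundle (𝓡 n) M)))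
  (hp : ∀ y, Module.finrank ℝ (symbolImage (𝓡 n) X y) = p)

include hX hp

theorem isVerticalRep_vertical : IsVerticalRep X A (verticalAlpha A X) (verticalBeta A X) where
  posSemidef := posSemidef_verticalAlpha A X
  eq f hf u := by
    have h1 := sum_verticalAlpha_smul A X u (fiberForm f u)
    have h2 := sum_verticalBeta_smul A X u (fiberDeriv f u)
    simp only [smul_eq_mul] at h1 h2
    simp only [lieDer_fundamental hf, lieDer_fundamental_fundamental hf]
    rw [h1, h2, verticalPart_eq X hX hp hf, verticalDrift, map_smul, smul_eq_mul]
    ring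

theorem IsVerticalRep.eq_vertical [T2Space M] {α : GLM n M → Matrix κ κ ℝ} {β : GLM n M → κ → ℝ}
    (h : IsVerticalRep X A α β) (u : GLM n M) :
    α u = verticalAlpha A X u ∧ β u = verticalBeta A X u := by
  refine repr_unique_of_symm A u (h.posSemidef u).1 (posSemidef_verticalAlpha A X u).1
    fun f hf => ?_
  have h1 := h.eq f hf u
  rw [(isVerticalRep_vertical A X hX hp).eq f hf u] at h1
  simp only [lieDer_fundamental hf, lieDer_fundamental_fundamental hf] at h1
  exact h1.symm

theorem existsUnique_isVerticalRep [T2Space M] :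
    ∃! c : (GLM n M → Matrix κ κ ℝ) × (GLM n M → κ → ℝ), IsVerticalRep X A c.1 c.2 :=
  ⟨(verticalAlpha A X, verticalBeta A X), isVerticalRep_vertical A X hX hp, fun _ hc =>
    Prod.ext (funext fun u => (hc.eq_vertical A X hX hp u).1)
      (funext fun u => (hc.eq_vertical A X hX hp u).2)⟩

end Representation

/-! ### The curvature of the connection -/

section ChartDerivative

variable {EN HN N F : Type*} [NormedAddCommGroup EN] [NormedSpace ℝ EN] [TopologicalSpace HN]
  {J : ModelWithCorners ℝ EN HN} [J.Boundaryless] [TopologicalSpace N] [ChartedSpace HN N]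
  [IsManifold J 1 N] [NormedAddCommGroup F] [NormedSpace ℝ F]

theorem mfderiv_eq_of_hasFDerivAt_chart {h : N → F} {y : N} {h' : EN →L[ℝ] F}
    (hh : HasFDerivAt (h ∘ (extChartAt J y).symm) h' (extChartAt J y y)) :
    (mfderiv J 𝓘(ℝ, F) h y : EN →L[ℝ] F) = h' := by
  have hφ : MDifferentiableAt J 𝓘(ℝ, EN) (extChartAt J y) y :=
    mdifferentiableAt_extChartAt (mem_chart_source _ _)
  have hm : MDifferentiableAt J 𝓘(ℝ, F) h y := by
    refine MDifferentiableAt.congr_of_eventuallyEq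
      (hh.differentiableAt.mdifferentiableAt.comp y hφ) ?_
    filter_upwards [extChartAt_source_mem_nhds (I := J) y] with z hz
    rw [Function.comp_apply, Function.comp_apply, (extChartAt J y).left_inv hz]
  rw [mfderiv_eq_fderiv_chart hm, hh.fderiv]

end ChartDerivative

theorem _root_.HasFDerivAt.clm_apply_const {E E' F : Type*} [NormedAddCommGroup E]
    [NormedSpace ℝ E] [NormedAddCommGroup E'] [NormedSpace ℝ E'] [NormedAddCommGroup F]
    [NormedSpace ℝ F] {c : E → E' →L[ℝ] F} {c' : E →L[ℝ] E' →L[ℝ] F} {x : E}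
    (h : HasFDerivAt c c' x) (w : E') : HasFDerivAt (fun y => c y w) (c'.flip w) x :=
  (h.clm_apply (hasFDerivAt_const w x)).congr_fderiv
    (by rw [ContinuousLinearMap.comp_zero, zero_add])

theorem lieBracketWithin_const_const {E : Type*} [NormedAddCommGroup E] [NormedSpace ℝ E]
    (v w : E) (s : Set E) (x : E) :
    VectorField.lieBracketWithin ℝ (fun _ => v) (fun _ => w) s x = 0 := by
  simp [VectorField.lieBracketWithin_eq]

section Extend

variable {n : ℕ} {M : Type*} [TopologicalSpace M] [ChartedSpace (EuclideanSpace ℝ (Fin n)) M]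
  [IsManifold (𝓡 n) ∞ M]

theorem chartField_extend {x : M} {z : Euc n} (hz : z ∈ (extChartAt (𝓡 n) x).target)
    (v : TangentSpace (𝓡 n) x) :
    chartField x (FiberBundle.extend (Euc n) v) z = v := by
  have hy := (extChartAt (𝓡 n) x).map_target hz
  have h1 := coordField_self x (fun y => FiberBundle.extend (Euc n) v y)
  rw [FiberBundle.extend_apply_self] at h1
  refine Eq.trans ?_ h1
  rw [chartField, Function.comp_apply]
  rw [extChartAt_source] at hy
  set t := trivializationAt (Euc n) (TangentSpace (𝓡 n)) x
  have h2 : ∀ y ∈ t.baseSet, coordField x (fun y => FiberBundle.extend (Euc n) v y) y =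
      (t ⟨x, v⟩).2 := fun y hy => by
    rw [coordField, FiberBundle.extend, Bundle.Trivialization.apply_mk_symm _ hy]
  exact (h2 _ hy).trans (h2 _ (FiberBundle.mem_baseSet_trivializationAt' x)).symm

theorem mpullbackWithin_extChartAt_symm {x : M} {z : Euc n}
    (hz : z ∈ (extChartAt (𝓡 n) x).target) (Z : ∀ x : M, TangentSpace (𝓡 n) x) :
    VectorField.mpullbackWithin 𝓘(ℝ, Euc n) (𝓡 n) (extChartAt (𝓡 n) x).symm Z
      (Set.range (𝓡 n)) z = chartField x Z z := by
  have hy := (extChartAt (𝓡 n) x).map_target hz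
  rw [VectorField.mpullbackWithin_apply,
    ContinuousLinearMap.inverse_eq (mfderivWithin_extChartAt_symm_comp_mfderiv_extChartAt hz)
      (mfderiv_extChartAt_comp_mfderivWithin_extChartAt_symm hz),
    chartField, Function.comp_apply, coordField_eq_mfderiv hy]
  rfl

/-- The extensions are constant in the preferred chart at `x`, so the bracket term disappears from
the curvature. -/
theorem mlieBracket_extend {x : M} (v w : TangentSpace (𝓡 n) x) :
    VectorField.mlieBracket (𝓡 n) (FiberBundle.extend (Euc n) v)
      (FiberBundle.extend (Euc n) w) x = 0 := by
  have h : ∀ v : TangentSpace (𝓡 n) x,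
      VectorField.mpullbackWithin 𝓘(ℝ, Euc n) (𝓡 n) (extChartAt (𝓡 n) x).symm
        (FiberBundle.extend (Euc n) v) (Set.range (𝓡 n))
        =ᶠ[𝓝 (extChartAt (𝓡 n) x x)] fun _ => (v : Euc n) := fun v => by
    filter_upwards [extChartAt_target_mem_nhds (I := 𝓡 n) x] with z hz
    rw [mpullbackWithin_extChartAt_symm hz]
    exact chartField_extend hz v
  rw [← VectorField.mlieBracketWithin_univ, VectorField.mlieBracketWithin_apply,
    Set.preimage_univ, Set.univ_inter]
  have h0 := (h v).lieBracketWithin_vectorField_eq_nhds (𝕜 := ℝ) (s := Set.range (𝓡 n)) (h w)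
  have h1 := lieBracketWithin_const_const (E := Euc n) v w (Set.range (𝓡 n))
    (extChartAt (𝓡 n) x x)
  refine (congrArg _ (h0.trans h1)).trans ?_
  exact map_zero _

variable {F : Type*} [NormedAddCommGroup F] [NormedSpace ℝ F]

/-- In the chart the extended field is the constant `w`, so the function is `z ↦ Dg(z) w` there and
its derivative is the second derivative of `g` with one slot filled. -/
theorem hasFDerivAt_mfderiv_extend {g : M → F} (hg : ContMDiff (𝓡 n) 𝓘(ℝ, F) ∞ g) (x : M)
    (w : TangentSpace (𝓡 n) x) :
    HasFDerivAt ((fun y => (mfderiv (𝓡 n) 𝓘(ℝ, F) g y (FiberBundle.extend (Euc n) w y) : F)) ∘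
        (extChartAt (𝓡 n) x).symm)
      ((fderiv ℝ (fderiv ℝ (g ∘ (extChartAt (𝓡 n) x).symm)) (extChartAt (𝓡 n) x x)).flip w)
      (extChartAt (𝓡 n) x x) := by
  have h1 := (contDiffAt_comp_extChartAt_symm (hg x)).hasFDerivAt_fderiv
  refine (h1.clm_apply_const (w : Euc n)).congr_of_eventuallyEq ?_
  filter_upwards [extChartAt_target_mem_nhds (I := 𝓡 n) x] with z hz
  have hy := (extChartAt (𝓡 n) x).map_target hz
  have h3 := mfderiv_eq_fderiv_comp_mfderiv (hg _) hy
  have h4 := congrArg (fun L : Euc n →L[ℝ] F =>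
    L (FiberBundle.extend (Euc n) w ((extChartAt (𝓡 n) x).symm z))) h3
  refine h4.trans ?_
  rw [(extChartAt (𝓡 n) x).right_inv hz]
  refine congrArg (fderiv ℝ (g ∘ (extChartAt (𝓡 n) x).symm) z) ?_
  exact (coordField_eq_mfderiv hy _).symm.trans (chartField_extend hz w)

end Extend

section Curvature

variable {n m p : ℕ} {M : Type*} [TopologicalSpace M] [ChartedSpace (EuclideanSpace ℝ (Fin n)) M]
  [IsManifold (𝓡 n) ∞ M] (X : Fin m → ∀ x : M, TangentSpace (𝓡 n) x)

omit [IsManifold (𝓡 n) ∞ M] in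
-- Since `Y X = P`, the connection becomes ordinary differentiation of `P s` in `ℝᵐ` followed by
-- `X`.
theorem covDeriv_noise (s : M → Euc m) (x : M) (v : TangentSpace (𝓡 n) x) :
    covDeriv X (fun y => noise X y (s y)) x v =
      noiseCoord X x (mfderiv (𝓡 n) 𝓘(ℝ, Euc m) (fun y => noiseProj X y (s y)) x v) := by
  have h : (fun y => noiseInv X y (noise X y (s y))) = fun y => noiseProj X y (s y) :=
    funext fun y => noiseInv_noise X y (s y)
  rw [covDeriv, h]
  rfl

variable (hX : ∀ j, ContMDiff (𝓡 n) (𝓡 n).tangent ∞ (fun x => (⟨x, X j x⟩ : TangentBundle (𝓡 n) M)))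
  (hp : ∀ y, Module.finrank ℝ (symbolImage (𝓡 n) X y) = p)

include hX hp

theorem mfderiv_noiseProj_apply {s : M → Euc m} {s' : Euc n →L[ℝ] Euc m} {x : M}
    (hs : HasFDerivAt (s ∘ (extChartAt (𝓡 n) x).symm) s' (extChartAt (𝓡 n) x x))
    (v : Euc n) :
    (mfderiv (𝓡 n) 𝓘(ℝ, Euc m) (fun y => noiseProj X y (s y)) x v : Euc m) =
      noiseProjDeriv X x v (s x) + noiseProj X x (s' v) := by
  have h1 := (hasFDerivAt_noiseProj X hX hp x).clm_apply hs
  have h2 := mfderiv_eq_of_hasFDerivAt_chart (h := fun y => noiseProj X y (s y)) h1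
  refine (congrArg (fun L : Euc n →L[ℝ] Euc m => L v) h2).trans ?_
  simp [add_comm]

/-- With `e₀ = P(x) e`, the section `y ↦ X(y) e₀` corresponds to `g(y) = P(y) e₀`. Its iterated
covariant derivative is `X dP(v) dP(w) e₀ + X D²g(v, w)`. The Hessian term is symmetric and cancels
in the commutator. -/
theorem curvature_noise (x : M) (v w : TangentSpace (𝓡 n) x) (e : Euc m) :
    curvature X x v w (noise X x e) =
      noiseCoord X x (noiseProjDeriv X x v (noiseProjDeriv X x w (noiseProj X x e)) -
        noiseProjDeriv X x w (noiseProjDeriv X x v (noiseProj X x e))) := by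
  rw [curvature, noiseInv_noise, curvatureField, mlieBracket_extend]
  set e₀ := noiseProj X x e
  let g : M → Euc m := fun y => noiseProj X y e₀
  have hg : ContMDiff (𝓡 n) 𝓘(ℝ, Euc m) ∞ g :=
    (contMDiff_noiseProj X hX hp).clm_apply contMDiff_const
  have hgx : ∀ v : Euc n, (mfderiv (𝓡 n) 𝓘(ℝ, Euc m) g x v : Euc m) = noiseProjDeriv X x v e₀ :=
    fun v => (mfderiv_noiseProj_apply X hX hp (s := fun _ => e₀)
      (hasFDerivAt_const e₀ _) v).trans (by
        rw [zero_apply, map_zero, add_zero])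
  have key : ∀ v w : TangentSpace (𝓡 n) x,
      (covDeriv X (fun y => covDeriv X (fun y => noise X y e₀) y
        (FiberBundle.extend (Euc n) w y)) x v : Euc n) =
      noiseCoord X x (noiseProjDeriv X x v (noiseProjDeriv X x w e₀)) +
        noiseCoord X x (fderiv ℝ (fderiv ℝ (g ∘ (extChartAt (𝓡 n) x).symm))
          (extChartAt (𝓡 n) x x) v w) := by
    intro v w
    have h1 : (fun y => covDeriv X (fun y => noise X y e₀) y
        (FiberBundle.extend (Euc n) w y)) = fun y => noise X y
        (mfderiv (𝓡 n) 𝓘(ℝ, Euc m) g y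
          (FiberBundle.extend (Euc n) w y)) :=
      funext fun y => covDeriv_noise X (fun _ => e₀) y _
    rw [h1]
    refine (covDeriv_noise X _ x v).trans ?_
    refine (congrArg (noiseCoord X x) (mfderiv_noiseProj_apply X hX hp
      (hasFDerivAt_mfderiv_extend hg x w) v)).trans ?_
    rw [map_add, noiseCoord_noiseProj, FiberBundle.extend_apply_self]
    exact congrArg₂ (· + ·) (congrArg (fun a => noiseCoord X x (noiseProjDeriv X x v a)) (hgx w)) rfl
  have hsymm := (contDiffAt_comp_extChartAt_symm (hg x)).isSymmSndFDerivAt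
    (by simpa using two_le_infty) v w
  have h0 : (covDeriv X (fun y => noise X y e₀) x (0 : TangentSpace (𝓡 n) x)) = 0 := by
    rw [covDeriv, map_zero]
    exact map_zero _
  rw [FiberBundle.extend_apply_self, FiberBundle.extend_apply_self, h0, sub_zero, map_sub]
  refine (congrArg₂ (fun a b : Euc n => a - b) (key v w) (key w v)).trans ?_
  rw [hsymm]
  exact add_sub_add_right_eq_sub _ _ _

end Curvature

/-! ### The Ricci and curvature tensors in terms of the shape operators -/

section ProjectionDerivative

variable {E H : Type*} [NormedAddCommGroup E] [NormedSpace ℝ E] [NormedAddCommGroup H]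
  [InnerProductSpace ℝ H]

theorem inner_hasFDerivAt_of_selfAdjoint {Q : E → H →L[ℝ] H} {Q' : E →L[ℝ] H →L[ℝ] H} {z : E}
    (hQ : HasFDerivAt Q Q' z) (hs : ∀ z a b, inner ℝ (Q z a) b = inner ℝ a (Q z b))
    (v : E) (a b : H) : inner ℝ (Q' v a) b = inner ℝ a (Q' v b) := by
  have h1 := ((innerSL ℝ b).hasFDerivAt.comp z (hQ.clm_apply_const a))
  have h2 := ((innerSL ℝ a).hasFDerivAt.comp z (hQ.clm_apply_const b))
  have h3 : (innerSL ℝ b : H → ℝ) ∘ (fun z => Q z a) = (innerSL ℝ a : H → ℝ) ∘ fun z => Q z b := by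
    funext z
    simp only [Function.comp_apply, innerSL_apply_apply]
    rw [← hs, real_inner_comm]
  rw [h3] at h1
  have h4 := congrArg (fun L : E →L[ℝ] ℝ => L v) (h1.unique h2)
  simp only [ContinuousLinearMap.comp_apply, ContinuousLinearMap.flip_apply,
    innerSL_apply_apply] at h4
  rw [real_inner_comm, h4]

end ProjectionDerivative

section RicciCurvature

variable {n m p : ℕ} {M : Type*} [TopologicalSpace M] [ChartedSpace (EuclideanSpace ℝ (Fin n)) M]
  [IsManifold (𝓡 n) ∞ M] (X : Fin m → ∀ x : M, TangentSpace (𝓡 n) x)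

/-- The Ricci endomorphism of the connection. -/
def ricciSharp (x : M) : Euc n →L[ℝ] Euc n :=
  noiseChartDeriv X x (noiseDivergence X x) - ∑ k, (shape X x k).comp (shape X x k)

theorem ricciSharp_apply (x : M) (v : Euc n) :
    ricciSharp X x v = noiseChartDeriv X x (noiseDivergence X x) v -
      ∑ k, shape X x k (shape X x k v) := by
  simp [ricciSharp]

variable (hX : ∀ j, ContMDiff (𝓡 n) (𝓡 n).tangent ∞ (fun x => (⟨x, X j x⟩ : TangentBundle (𝓡 n) M)))
  (hp : ∀ y, Module.finrank ℝ (symbolImage (𝓡 n) X y) = p)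

include hX hp

theorem inner_noiseProjDeriv (x : M) (v : Euc n) (a b : Euc m) :
    inner ℝ (noiseProjDeriv X x v a) b = inner ℝ a (noiseProjDeriv X x v b) :=
  inner_hasFDerivAt_of_selfAdjoint (hasFDerivAt_noiseProj X hX hp x)
    (fun _ => inner_noiseProj X _) v a b

omit hX hp [IsManifold (𝓡 n) ∞ M] in
theorem sum_noiseProjDeriv_noiseProj (x : M) :
    ∑ j, noiseProjDeriv X x (noiseCoord X x (EuclideanSpace.single j 1))
      (noiseProj X x (EuclideanSpace.single j 1)) = noiseDivergence X x := by
  let L : Euc m →ₗ[ℝ] Euc m →ₗ[ℝ] Euc m :=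
    LinearMap.mk₂ ℝ (fun a b => noiseProjDeriv X x (noiseCoord X x a) b)
      (fun a a' b => by simp) (fun c a b => by simp) (fun a b b' => by simp)
      (fun c a b => by simp)
  have h := sum_selfAdjoint_comm L (noiseProj X x) (inner_noiseProj X x)
  simp only [L, LinearMap.mk₂_apply, noiseCoord_noiseProj] at h
  exact h.symm

/-- The trace identity for `P` moves it into `X`, where it is absorbed. The one for `dP(v)` then
produces `X dP(X dP(v) e_j) e_j`, which is `Γ_j (Γ_j v)`. -/
theorem sum_noiseProjDeriv_noiseProjDeriv_noiseProj (x : M) (v : Euc n) :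
    ∑ j, noiseCoord X x (noiseProjDeriv X x (noiseCoord X x (EuclideanSpace.single j 1))
      (noiseProjDeriv X x v (noiseProj X x (EuclideanSpace.single j 1)))) =
      ∑ k, shape X x k (shape X x k v) := by
  let L : Euc m →ₗ[ℝ] Euc m →ₗ[ℝ] Euc n :=
    LinearMap.mk₂ ℝ (fun a b => noiseCoord X x (noiseProjDeriv X x (noiseCoord X x a) b))
      (fun a a' b => by simp) (fun c a b => by simp) (fun a b b' => by simp)
      (fun c a b => by simp)
  have h1 := sum_selfAdjoint_comm (L.compl₂ (noiseProjDeriv X x v).toLinearMap) (noiseProj X x)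
    (inner_noiseProj X x)
  have h2 := sum_selfAdjoint_comm L (noiseProjDeriv X x v) (inner_noiseProjDeriv X hX hp x v)
  simp only [L, LinearMap.compl₂_apply, LinearMap.mk₂_apply, noiseCoord_noiseProj,
    ContinuousLinearMap.coe_coe] at h1 h2
  rw [← h1, ← h2]
  simp only [shape_apply X hX hp]

/-- The first product sums to `X dP(v) d`. Since `X d = 0` gives `P d = 0`, the derivative of `X P =
X` reduces this to `DX(d) v`. The second product sums to `∑ Γ_k² v`. -/
theorem ricciSharp_eq_sum (x : M) (v : Euc n) :
    ricciSharp X x v = ∑ j, noiseCoord X x (noiseProjDeriv X x v (noiseProjDeriv X x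
          (noiseCoord X x (EuclideanSpace.single j 1))
          (noiseProj X x (EuclideanSpace.single j 1))) -
        noiseProjDeriv X x (noiseCoord X x (EuclideanSpace.single j 1))
          (noiseProjDeriv X x v (noiseProj X x (EuclideanSpace.single j 1)))) := by
  have h : noiseCoord X x (noiseProjDeriv X x v (noiseDivergence X x)) =
      noiseChartDeriv X x (noiseDivergence X x) v := by
    rw [noiseCoord_noiseProjDeriv X hX hp,
      noiseProj_eq_zero X (noiseCoord_noiseDivergence X hX hp x)]
    simp
  rw [ricciSharp_apply, ← h, ← sum_noiseProjDeriv_noiseProj X,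
    ← sum_noiseProjDeriv_noiseProjDeriv_noiseProj X hX hp x v]
  simp only [map_sub, map_sum]
  exact (Finset.sum_sub_distrib ..).symm

theorem isRicciSharp_ricciSharp (x : M) :
    IsRicciSharp X x (ricciSharp X x : Euc n →L[ℝ] Euc n).toLinearMap := by
  intro v
  refine (ricciSharp_eq_sum X hX hp x v).trans (Finset.sum_congr rfl fun j _ => ?_)
  have h := curvature_noise X hX hp x v (noise X x (EuclideanSpace.single j 1))
    (EuclideanSpace.single j 1)
  refine h.symm.trans ?_
  rw [noise_single]

omit hX hp [IsManifold (𝓡 n) ∞ M] in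
theorem innerE_noise_noise (x : M) (a b : Euc m) :
    innerE X x (noise X x a) (noise X x b) = inner ℝ (noiseProj X x a) b := by
  rw [innerE_noise, inner_noiseProj, noiseProj_noiseProj, ← inner_noiseProj]

/-- The pairing is `⟨P e, dP(v) e_r⟩`, and `dP(v)` is self-adjoint as the derivative of self-adjoint
operators. -/
theorem innerE_shape (x : M) (e : Euc m) (r : Fin m) (v : Euc n) :
    innerE X x (noise X x e) (shape X x r v : Euc n) =
      noiseProjDeriv X x v (noiseProj X x e) r := by
  rw [shape_apply X hX hp]
  refine (innerE_noise_noise X x e _).trans ?_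
  rw [← inner_noiseProjDeriv X hX hp]
  simp [EuclideanSpace.inner_single_right]

/-- A Gauss-type equation: self-adjointness moves the outer `dP` of each product in `[dP(v), dP(w)]`
onto the second argument. The resulting inner products in `ℝᵐ` are then expanded in components,
which are pairings with the shape operators. -/
theorem innerE_curvature (x : M) (v w : Euc n) (z z' : TangentSpace (𝓡 n) x)
    (hz : z ∈ symbolImage (𝓡 n) X x) (hz' : z' ∈ symbolImage (𝓡 n) X x) :
    innerE X x (curvature X x v w z) z' =
      ∑ r, (innerE X x z (shape X x r w : Euc n) * innerE X x z' (shape X x r v : Euc n) -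
        innerE X x z (shape X x r v : Euc n) * innerE X x z' (shape X x r w : Euc n)) := by
  rw [symbolImage_eq_range_noise] at hz hz'
  obtain ⟨e, rfl⟩ := hz
  obtain ⟨e', rfl⟩ := hz'
  have h1 : ∀ a b : Euc m, inner ℝ a b = ∑ r, a r * b r := fun a b => by
    rw [PiLp.inner_apply]
    exact Finset.sum_congr rfl fun r _ => mul_comm _ _
  simp only [innerE_shape X hX hp, Finset.sum_sub_distrib]
  rw [← h1, ← h1]
  refine (congrArg (fun y => innerE X x y (noise X x e'))
    (curvature_noise X hX hp x v w e)).trans ?_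
  refine (innerE_noise_noise X x _ _).trans ?_
  rw [inner_noiseProj, inner_sub_left, inner_noiseProjDeriv X hX hp x v,
    inner_noiseProjDeriv X hX hp x w (noiseProjDeriv X x v _)]

omit hX [IsManifold (𝓡 n) ∞ M] in
/-- In an adapted basis, the coordinates of a vector of `E_x` are its inner products with the
first `p` members. -/
theorem IsAdapted.coord_noise {x : M} {e : Module.Basis (Fin n) ℝ (TangentSpace (𝓡 n) x)}
    (he : IsAdapted X p x e) (a : Euc m) (j : Fin n) :
    e.coord j (noise X x a) = if j.val < p then innerE X x (e j) (noise X x a) else 0 := by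
  set s : Set (Fin n) := {j | j.val < p} with hs
  have hmem : ∀ j ∈ s, e j ∈ symbolImage (𝓡 n) X x := fun j hj => (he j j hj hj).1
  have hfin : FiniteDimensional ℝ (TangentSpace (𝓡 n) x) := Module.Finite.of_basis e
  have hpn : p ≤ n := by
    have h := Submodule.finrank_le (symbolImage (𝓡 n) X x)
    rw [hp x, Module.finrank_eq_card_basis e, Fintype.card_fin] at h
    exact h
  have hspan : Submodule.span ℝ (e '' s) = symbolImage (𝓡 n) X x := by
    -- The first `p` members are independent and lie in the `p`-dimensional space `E_x`, so they
    -- span it.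
    refine Submodule.eq_of_le_of_finrank_eq (Submodule.span_le.2 ?_) ?_
    · rintro _ ⟨j, hj, rfl⟩
      exact hmem j hj
    · have h : e '' s = Set.range (e ∘ Fin.castLE hpn) := by
        rw [Set.range_comp, Fin.range_castLE]
      rw [hp x, h, finrank_span_eq_card (e.linearIndependent.comp _ (Fin.castLE_injective hpn)),
        Fintype.card_fin]
  have hsupp : ∀ j ∉ s, e.repr (noise X x a) j = 0 := by
    have h : noise X x a ∈ Submodule.span ℝ (e '' s) := by
      rw [hspan, symbolImage_eq_range_noise]
      exact ⟨a, rfl⟩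
    rw [Module.Basis.mem_span_image] at h
    intro j hj
    by_contra h0
    exact hj (h (Finsupp.mem_support_iff.2 h0))
  split_ifs with hj
  -- `innerE` is defined by a choice of right inverse, so its linearity on `E_x` is read off on
  -- preimages in `ℝᵐ` under the noise. Outside `s` the value of `b` is irrelevant, since the
  -- coordinate there is zero.
  · have hex : ∀ i : Fin n, ∃ b : Euc m, i ∈ s → noise X x b = e i := by
      intro i
      by_cases hi : i ∈ s
      · have h := hmem i hi
        rw [symbolImage_eq_range_noise] at h
        obtain ⟨b, hb⟩ := h
        exact ⟨b, fun _ => hb⟩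
      · exact ⟨0, fun h => absurd h hi⟩
    choose b hb using hex
    have hsum : noise X x a = noise X x (∑ i, e.repr (noise X x a) i • b i) := by
      conv_lhs => rw [← e.sum_repr (noise X x a)]
      rw [map_sum]
      refine Finset.sum_congr rfl fun i _ => ?_
      by_cases hi : i ∈ s
      · rw [map_smul, hb i hi]
      · rw [hsupp i hi, zero_smul, zero_smul, map_zero]
    rw [Module.Basis.coord_apply]
    set c := e.repr (noise X x a) with hc
    rw [hsum, ← hb j hj, innerE_noise_noise, inner_sum]
    symm
    rw [Finset.sum_eq_single j]
    · rw [inner_smul_right, ← innerE_noise_noise, hb j hj, (he j j hj hj).2]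
      simp
    · intro i _ hij
      by_cases hi : i ∈ s
      · rw [inner_smul_right, ← innerE_noise_noise, hb j hj, hb i hi, (he j i hj hi).2,
          if_neg hij.symm, mul_zero]
      · rw [hsupp i hi, zero_smul, inner_zero_right]
    · simp
  · exact hsupp j hj

end RicciCurvature

/-! ### The zero order operator -/

/-- The Weitzenböck formula for a sum of squares of derivations `dΛ(Γᵣ)`. -/
theorem sum_dExt_dExt_eq {V : Type*} [AddCommGroup V] [Module ℝ V] {n m p : ℕ}
    (e : Module.Basis (Fin n) ℝ V) (G : V →ₗ[ℝ] V) (Γ : Fin m → V →ₗ[ℝ] V)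
    (hΓ : ∀ r v (j : Fin n), p ≤ j.val → e.coord j (Γ r v) = 0)
    (R : Fin n → Fin n → Fin n → Fin n → ℝ)
    (hR : ∀ i k j l : Fin n, j.val < p → l.val < p → R i k j l =
      ∑ r, (e.coord l (Γ r (e k)) * e.coord j (Γ r (e i)) -
        e.coord l (Γ r (e i)) * e.coord j (Γ r (e k)))) (x : ExteriorAlgebra ℝ V) :
    (-(1 / 2) : ℝ) • dExt G x + (1 / 2 : ℝ) • ∑ r, dExt (Γ r) (dExt (Γ r) x) =
      (-(1 / 2) : ℝ) • dExt (G - ∑ r, Γ r ∘ₗ Γ r) x -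
      ∑ i : Fin n, ∑ k : Fin n, ∑ j : Fin n, ∑ l : Fin n,
        if i ≤ k ∧ j < l ∧ l.val < p then
          R i k j l • creation (e l) (creation (e j)
            (annihilation (e.coord k) (annihilation (e.coord i) x)))
        else 0 := by
  rw [sum_quartic_eq e Γ hΓ R hR]
  -- After normal ordering, the terms `dΛ(Γᵣ ∘ Γᵣ)` combine with `dΛ(G)` by linearity, and the
  -- quartic remainders cancel against the curvature sum.
  simp only [dExt_dExt e, Finset.sum_sub_distrib]
  simp only [← dExtₗ_apply, map_sub, map_sum, LinearMap.sub_apply, LinearMap.sum_apply]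
  module

section ZeroOrder

variable {n m p : ℕ} {M : Type*} [TopologicalSpace M] [ChartedSpace (EuclideanSpace ℝ (Fin n)) M]
  [IsManifold (𝓡 n) ∞ M]

/-- The endomorphism `B` of `ℝⁿ`, which is the model of `T_x M`, as an endomorphism of `T_x M`. -/
def tangentEnd (x : M) (B : Euc n →L[ℝ] Euc n) :
    TangentSpace (𝓡 n) x →ₗ[ℝ] TangentSpace (𝓡 n) x := B.toLinearMap

theorem map_frameMap_dExt (u : GLM n M) (B : Euc n →L[ℝ] Euc n) (w : ExteriorAlgebra ℝ (Euc n)) :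
    ExteriorAlgebra.map (frameMap u : Euc n →ₗ[ℝ] TangentSpace (𝓡 n) (proj u))
      (dExt (frameConj u B : Euc n →ₗ[ℝ] Euc n) w) =
    dExt (tangentEnd (proj u) B)
      (ExteriorAlgebra.map (frameMap u : Euc n →ₗ[ℝ] TangentSpace (𝓡 n) (proj u)) w) :=
  map_dExt (fun v => congrArg (fun L : Euc n →L[ℝ] Euc n => L v) (frame_comp_frameConj u B)) w

variable (X : Fin m → ∀ x : M, TangentSpace (𝓡 n) x)

/-- The operator `-½ dΛ(G) + ½ ∑ₖ dΛ(Γₖ)²` on `ΛT_x M`. -/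
def zeroOrderTangent (x : M) (V : ExteriorAlgebra ℝ (TangentSpace (𝓡 n) x)) :
    ExteriorAlgebra ℝ (TangentSpace (𝓡 n) x) :=
  (-(1 / 2) : ℝ) • dExt (tangentEnd x (noiseChartDeriv X x (noiseDivergence X x))) V +
    (1 / 2 : ℝ) • ∑ k, dExt (tangentEnd x (shape X x k)) (dExt (tangentEnd x (shape X x k)) V)

/-- `Λu` intertwines `dΛ` of an endomorphism read in the frame `u` with `dΛ` of the endomorphism
itself. The conjugated operator thus depends only on the base point. -/
theorem map_frameMap_zeroOrder {κ : Type*} [Fintype κ]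
    (A : Module.Basis κ ℝ (Euc n →L[ℝ] Euc n)) (u : GLM n M) (w : ExteriorAlgebra ℝ (Euc n)) :
    ExteriorAlgebra.map (frameMap u : Euc n →ₗ[ℝ] TangentSpace (𝓡 n) (proj u))
      (zeroOrder A (verticalAlpha A X u) (verticalBeta A X u) w) =
    zeroOrderTangent X (proj u)
      (ExteriorAlgebra.map (frameMap u : Euc n →ₗ[ℝ] TangentSpace (𝓡 n) (proj u)) w) := by
  let D : (Euc n →L[ℝ] Euc n) →ₗ[ℝ] Module.End ℝ (ExteriorAlgebra ℝ (Euc n)) :=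
    dExtₗ ∘ₗ ContinuousLinearMap.coeLM ℝ
  have h1 := sum_verticalBeta_smul A X u D
  have h2 := sum_verticalAlpha_smul A X u ((LinearMap.mul ℝ _).compl₁₂ D D)
  have h3 : zeroOrder A (verticalAlpha A X u) (verticalBeta A X u) = D (verticalDrift X u) +
      (1 / 2 : ℝ) • ∑ k, (LinearMap.mul ℝ _).compl₁₂ D D (frameConj u (shape X (proj u) k))
        (frameConj u (shape X (proj u) k)) := by
    rw [← h1, ← h2]
    rfl
  rw [h3, verticalDrift, map_smul]
  simp only [LinearMap.add_apply, LinearMap.smul_apply, LinearMap.sum_apply, map_add, map_smul,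
    map_sum, zeroOrderTangent, ← map_frameMap_dExt]
  rfl

theorem map_frameMap_map_inverse (u : GLM n M)
    (V : ExteriorAlgebra ℝ (TangentSpace (𝓡 n) (proj u))) :
    ExteriorAlgebra.map (frameMap u : Euc n →ₗ[ℝ] TangentSpace (𝓡 n) (proj u))
      (ExteriorAlgebra.map
        ((frameMap u).inverse : TangentSpace (𝓡 n) (proj u) →ₗ[ℝ] Euc n) V) = V := by
  obtain ⟨g, hg⟩ : (frameMap u).IsInvertible := u.2
  rw [← AlgHom.comp_apply, ExteriorAlgebra.map_comp_map, ← hg, ContinuousLinearMap.inverse_equiv]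
  have h : ((g : Euc n →L[ℝ] TangentSpace (𝓡 n) (proj u)) :
        Euc n →ₗ[ℝ] TangentSpace (𝓡 n) (proj u)) ∘ₗ
      ((g.symm : TangentSpace (𝓡 n) (proj u) →L[ℝ] Euc n) :
        TangentSpace (𝓡 n) (proj u) →ₗ[ℝ] Euc n) = LinearMap.id := by
    ext v
    simp
  rw [h, ExteriorAlgebra.map_id, AlgHom.id_apply]

variable (hX : ∀ j, ContMDiff (𝓡 n) (𝓡 n).tangent ∞ (fun x => (⟨x, X j x⟩ : TangentBundle (𝓡 n) M)))
  (hp : ∀ y, Module.finrank ℝ (symbolImage (𝓡 n) X y) = p)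

include hX hp

/-- The shape operators take values in `E_x`, so in an adapted basis their coordinates beyond `p`
vanish and the others are inner products. The curvature coefficients then have the form required for
the algebraic formula. -/
theorem zeroOrderTangent_eq_weitzenbock {x : M}
    {e : Module.Basis (Fin n) ℝ (TangentSpace (𝓡 n) x)} (he : IsAdapted X p x e)
    (V : ExteriorAlgebra ℝ (TangentSpace (𝓡 n) x)) :
    zeroOrderTangent X x V = weitzenbock X p x (tangentEnd x (ricciSharp X x)) e V := by
  have hc : ∀ r (v : TangentSpace (𝓡 n) x) (j : Fin n),
      e.coord j (tangentEnd x (shape X x r) v) =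
        if j.val < p then innerE X x (e j) (tangentEnd x (shape X x r) v) else 0 := by
    intro r v j
    have h := he.coord_noise X hp (noiseProjDeriv X x v (EuclideanSpace.single r 1)) j
    have h1 : noise X x (noiseProjDeriv X x v (EuclideanSpace.single r 1)) =
        tangentEnd x (shape X x r) v := (shape_apply X hX hp x r v).symm
    rwa [h1] at h
  have h := sum_dExt_dExt_eq (p := p) e
    (tangentEnd x (noiseChartDeriv X x (noiseDivergence X x)))
    (fun r => tangentEnd x (shape X x r))
    (fun r v j hj => by rw [hc, if_neg (not_lt.2 hj)])
    (fun i k j l => innerE X x (curvature X x (e i) (e k) (e l)) (e j))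
    (fun i k j l hj hl => by
      simp only [hc, if_pos hj, if_pos hl]
      exact innerE_curvature X hX hp x (e i) (e k) (e l) (e j) (he l l hl hl).1 (he j j hj hj).1) V
  have hRic : tangentEnd x (noiseChartDeriv X x (noiseDivergence X x)) -
      ∑ r, tangentEnd x (shape X x r) ∘ₗ tangentEnd x (shape X x r) =
      tangentEnd x (ricciSharp X x) := by
    ext1 v
    rw [LinearMap.sub_apply, LinearMap.sum_apply]
    exact (ricciSharp_apply X x v).symm
  rw [hRic] at h
  refine h.trans ?_
  rw [weitzenbock, LinearMap.sub_apply, LinearMap.smul_apply]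
  congr 1
  simp only [LinearMap.sum_apply]
  refine Finset.sum_congr rfl fun i _ => Finset.sum_congr rfl fun k _ =>
    Finset.sum_congr rfl fun j _ => Finset.sum_congr rfl fun l _ => ?_
  split_ifs <;> rfl

end ZeroOrder

/-! ### The vertical part on differential forms -/

section Forms

variable {n m p : ℕ} {M : Type*} [TopologicalSpace M] [ChartedSpace (EuclideanSpace ℝ (Fin n)) M]
  [IsManifold (𝓡 n) ∞ M]

theorem isInvertible_frameMap_comp (u : GLM n M) {g : Euc n →L[ℝ] Euc n} (hg : g.IsInvertible) :
    ((frameMap u).comp g).IsInvertible := by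
  obtain ⟨a, ha⟩ : (frameMap u).IsInvertible := u.2
  obtain ⟨b, hb⟩ := hg
  exact ⟨b.trans a, by rw [← ha, ← hb]; rfl⟩

/-- The frame `u ∘ g`. -/
def frameComp (u : GLM n M) {g : Euc n →L[ℝ] Euc n} (hg : g.IsInvertible) : GLM n M :=
  ⟨⟨proj u, (frameMap u).comp g⟩, isInvertible_frameMap_comp u hg⟩

theorem extChartAt_frameComp (u : GLM n M) {g : Euc n →L[ℝ] Euc n} (hg : g.IsInvertible) :
    extChartAt (modelGL n) u (frameComp u hg) = ((chartPoint u).1, (chartPoint u).2.comp g) := by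
  rw [extChartAt_GLM]
  refine Prod.ext rfl ?_
  exact congrArg (fun L : Euc n →L[ℝ] Euc n => L.comp g) (frameCoord_self u)

theorem chartFun_frameComp {F : Type*} (f : GLM n M → F) (u : GLM n M)
    {g : Euc n →L[ℝ] Euc n} (hg : g.IsInvertible) :
    chartFun u f ((chartPoint u).1, (chartPoint u).2.comp g) = f (frameComp u hg) := by
  rw [← extChartAt_frameComp u hg, chartFun, Function.comp_apply,
    (extChartAt (modelGL n) u).left_inv]
  rw [mem_extChartAt_source_GLM]
  exact mem_extChartAt_source (proj u)

theorem formFunction_frameComp (φ : ∀ x : M, Module.Dual ℝ (ExteriorAlgebra ℝ (TangentSpace (𝓡 n) x)))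
    (w : ExteriorAlgebra ℝ (Euc n)) (u : GLM n M) {g : Euc n →L[ℝ] Euc n} (hg : g.IsInvertible) :
    formFunction φ w (frameComp u hg) =
      formFunction φ (ExteriorAlgebra.map (g : Euc n →ₗ[ℝ] Euc n) w) u := by
  rw [formFunction, formFunction, ← AlgHom.comp_apply, ExteriorAlgebra.map_comp_map]
  rfl

/-- Replacing `u` by `u ∘ g` amounts to replacing `w` by `(Λg) w`. Along the straight line `g = 1 +
tB` the derivative at `t = 0` is `dΛ(B) w`. -/
theorem fiberDeriv_formFunction
    {φ : ∀ x : M, Module.Dual ℝ (ExteriorAlgebra ℝ (TangentSpace (𝓡 n) x))} (hφ : IsSmoothForm φ)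
    (w : ExteriorAlgebra ℝ (Euc n)) (u : GLM n M) (B : Euc n →L[ℝ] Euc n) :
    fiberDeriv (formFunction φ w) u B =
      formFunction φ (dExt (B : Euc n →ₗ[ℝ] Euc n) w) u := by
  have h1 := ((contDiffAt_chartFun (hφ w) u).differentiableAt (by simp)).hasFDerivAt
  have h2 : HasDerivAt (fun t : ℝ => chartFun u (formFunction φ w)
      (chartPoint u + t • vertical u B)) (fiberDeriv (formFunction φ w) u B) 0 :=
    h1.hasLineDerivAt (vertical u B)
  have h3 := hasDerivAt_map_one_add_smul (B : Euc n →ₗ[ℝ] Euc n) w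
    (φ (proj u) ∘ₗ (ExteriorAlgebra.map
      (frameMap u : Euc n →ₗ[ℝ] TangentSpace (𝓡 n) (proj u))).toLinearMap)
  refine h2.unique (h3.congr_of_eventuallyEq ?_)
  have hg : ContinuousAt (fun t : ℝ => ContinuousLinearMap.id ℝ (Euc n) + t • B) 0 := by
    fun_prop
  -- The line `1 + tB` stays among the frames only for small `t`, which is enough for a derivative
  -- at `0`.
  have hg0 : ∀ᶠ t in 𝓝 (0 : ℝ), (ContinuousLinearMap.id ℝ (Euc n) + t • B).IsInvertible := by
    refine hg.eventually (p := fun L => L.IsInvertible) ?_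
    refine ContinuousLinearEquiv.isOpen.mem_nhds ?_
    exact ⟨ContinuousLinearEquiv.refl ℝ (Euc n), by ext; simp⟩
  filter_upwards [hg0] with t ht
  have h4 : chartPoint u + t • vertical u B = ((chartPoint u).1,
      (chartPoint u).2.comp (ContinuousLinearMap.id ℝ (Euc n) + t • B)) := by
    rw [vertical_apply, ContinuousLinearMap.comp_add, ContinuousLinearMap.comp_smul,
      ContinuousLinearMap.comp_id]
    refine Prod.ext ?_ rfl
    simp
  rw [h4, chartFun_frameComp _ u ht, formFunction_frameComp]
  rfl

/-- The derivative of a form function along `C^*` is again a form function, now of `dΛ(C) w`, so the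
first order formula can be applied twice. -/
theorem fiberForm_formFunction
    {φ : ∀ x : M, Module.Dual ℝ (ExteriorAlgebra ℝ (TangentSpace (𝓡 n) x))} (hφ : IsSmoothForm φ)
    (w : ExteriorAlgebra ℝ (Euc n)) (u : GLM n M) (B C : Euc n →L[ℝ] Euc n) :
    fiberForm (formFunction φ w) u B C =
      formFunction φ (dExt (B : Euc n →ₗ[ℝ] Euc n) (dExt (C : Euc n →ₗ[ℝ] Euc n) w)) u := by
  have h : lieDer (modelGL n) (fundamental C) (formFunction φ w) =
      formFunction φ (dExt (C : Euc n →ₗ[ℝ] Euc n) w) := funext fun v => by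
    rw [lieDer_fundamental (hφ w), fiberDeriv_formFunction hφ]
  rw [← lieDer_fundamental_fundamental (hφ w), h, lieDer_fundamental (hφ _),
    fiberDeriv_formFunction hφ]

variable (X : Fin m → ∀ x : M, TangentSpace (𝓡 n) x)
  (hX : ∀ j, ContMDiff (𝓡 n) (𝓡 n).tangent ∞ (fun x => (⟨x, X j x⟩ : TangentBundle (𝓡 n) M)))
  (hp : ∀ y, Module.finrank ℝ (symbolImage (𝓡 n) X y) = p)

include hX hp

theorem verticalPart_formFunction
    {φ : ∀ x : M, Module.Dual ℝ (ExteriorAlgebra ℝ (TangentSpace (𝓡 n) x))} (hφ : IsSmoothForm φ)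
    (w : ExteriorAlgebra ℝ (Euc n)) (u : GLM n M) :
    verticalPart X (formFunction φ w) u = φ (proj u) (zeroOrderTangent X (proj u)
      (ExteriorAlgebra.map (frameMap u : Euc n →ₗ[ℝ] TangentSpace (𝓡 n) (proj u)) w)) := by
  rw [verticalPart_eq X hX hp (hφ w)]
  simp only [fiberDeriv_formFunction hφ, fiberForm_formFunction hφ, formFunction,
    map_frameMap_dExt, zeroOrderTangent, map_add, map_smul, map_sum, smul_eq_mul]
  ring

end Forms

end DerivativeProcess

end

theorem mainTheorem7 {n m p : ℕ} {M : Type*} [TopologicalSpace M]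
    [ChartedSpace (EuclideanSpace ℝ (Fin n)) M] [IsManifold (𝓡 n) ∞ M] [T2Space M]
    [SigmaCompactSpace M]
    (X : Fin m → ∀ x : M, TangentSpace (𝓡 n) x)
    (hX : ∀ j, ContMDiff (𝓡 n) (𝓡 n).tangent ∞ (fun x => (⟨x, X j x⟩ : TangentBundle (𝓡 n) M)))
    (hcoh : IsCohesive (𝓡 n) X p)
    {κ : Type*} [Fintype κ] (A : Module.Basis κ ℝ (Euc n →L[ℝ] Euc n)) :
    (∃! c : (GLM n M → Matrix κ κ ℝ) × (GLM n M → κ → ℝ), IsVerticalRep X A c.1 c.2) ∧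
    ∃ Ric : ∀ x : M, TangentSpace (𝓡 n) x →ₗ[ℝ] TangentSpace (𝓡 n) x,
      (∀ x, IsRicciSharp X x (Ric x)) ∧
      ∀ (u : GLM n M) (e : Module.Basis (Fin n) ℝ (TangentSpace (𝓡 n) (proj u))),
        IsAdapted X p (proj u) e →
        (∀ α β, IsVerticalRep X A α β →
          ∀ q : ℕ, ∀ V ∈ ⋀[ℝ]^q (TangentSpace (𝓡 n) (proj u)),
            ExteriorAlgebra.map (frameMap u : Euc n →ₗ[ℝ] TangentSpace (𝓡 n) (proj u))
              (zeroOrder A (α u) (β u)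
                (ExteriorAlgebra.map
                  ((frameMap u).inverse : TangentSpace (𝓡 n) (proj u) →ₗ[ℝ] Euc n) V)) =
              weitzenbock X p (proj u) (Ric (proj u)) e V) ∧
        (∀ φ : ∀ x : M, Module.Dual ℝ (ExteriorAlgebra ℝ (TangentSpace (𝓡 n) x)),
          IsSmoothForm φ → ∀ w : ExteriorAlgebra ℝ (Euc n),
            verticalPart X (formFunction φ w) u =
              φ (proj u) (weitzenbock X p (proj u) (Ric (proj u)) e
                (ExteriorAlgebra.map
                  (frameMap u : Euc n →ₗ[ℝ] TangentSpace (𝓡 n) (proj u)) w))) := by 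
  have hp := hcoh.rank_eq
  refine ⟨existsUnique_isVerticalRep A X hX hp, fun x => tangentEnd x (ricciSharp X x),
    isRicciSharp_ricciSharp X hX hp, fun u e he => ⟨fun α β hαβ q V _ => ?_, fun φ hφ w => ?_⟩⟩
  -- By uniqueness the coefficients are the explicit ones. The identity then holds on the whole
  -- exterior algebra, so in particular in each degree `q`.
  · obtain ⟨h1, h2⟩ := hαβ.eq_vertical A X hX hp u
    rw [h1, h2, map_frameMap_zeroOrder, map_frameMap_map_inverse,
      zeroOrderTangent_eq_weitzenbock X hX hp he]
  · rw [verticalPart_formFunction X hX hp hφ, zeroOrderTangent_eq_weitzenbock X hX hp he]
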